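/- Let $d\ge 1$ be an integer, $G=SL(2,\mathbb R)$, $K=SO(2)$, $\mathfrak g=\mathfrak{sl}(2,\mathbb R)$. Let $I_d$ be the space of smooth $\phi:\mathbb R\to\mathbb C$ for which $x^{-d-1}\phi(-1/x)$ extends to a smooth function on $\mathbb R$, with the representation of $G$ $$\Big(\pi_d\begin{pmatrix}p&q\\r&s\end{pmatrix}\phi\Big)(x)=(rx+p)^{-d-1}\phi\Big(\frac{sx+q}{rx+p}\Big)$$ (extended by continuity where $rx+p=0$). Let $S_d([0,\infty))$ be the space of functions $x^{(d+1)/2}f_1(x)$ with $f_1$ a Schwartz function on $[0,\infty)$ (smooth on $[0,\infty)$, all derivatives rapidly decreasing). For a sign $\varepsilon=\pm1$ put $$T_d^\varepsilon f(z)=\frac1{\sqrt{2\pi}}\int_0^\infty x^{(d-1)/2}f(x)e^{i\varepsilon xz}\,dx,\qquad M_d^\varepsilon\phi(y)=\frac{y^{(1-d)/2}}{\sqrt{2\pi}}\int_{-\infty}^\infty\phi(x)e^{-i\varepsilon xy}\,dx\quad(y>0),$$ and let $I_d^+=T_d^{+}(S_d([0,\infty)))\subset I_d$. Then for each $\varepsilon=\pm1$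 there is exactly one representation $R_d^\varepsilon$ of $G$ by isometries on the Kirillov space $\mathcal H_d=L^2((0,\infty),dx/x)$ such that $R_d^\varepsilon(g)f=M_d^\varepsilon(\pi_d(g)\,T_d^\varepsilon f)$ for all $g\in G$ and $f\in S_d([0,\infty))$. The $K$-finite vectors of $R_d^{\varepsilon}$ are, for $\varepsilon=+1$ and for $\varepsilon=-1$, exactly the (classes of the) functions $x^{(d+1)/2}e^{-x}p(x)$ with $p$ a complex polynomial. Moreover, the $K$-finite vectors of $I_d^+$ under $\pi_d$, and the $K$-finite vectors of $\mathcal H_d$ under $R_d^+$, are $(\mathfrak g,K)$-modules, where $X\in\mathfrak g$ acts by differentiating the action of $\exp(tX)$ at $t=0$ (pointwise on $\mathbb R$ for $I_d^+$, in the norm of $\mathcal H_d$ for $R_d^+$). These two $(\mathfrak g,K)$-modules are isomorphic, and both are irreducible. -/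

import Mathlib

open MeasureTheory Filter Topology Set Polynomial
open scoped MatrixGroups ContDiff

noncomputable section

namespace Kirillov

attribute [local instance] LieRing.ofAssociativeRing

/-! ## The group `SL(2, ℝ)`, its Lie algebra and its maximal compact subgroup -/

/-- The real Lie algebra `𝔰𝔩(2, ℝ)` of trace zero matrices. -/
abbrev sl2 : LieSubalgebra ℝ (Matrix (Fin 2) (Fin 2) ℝ) := LieAlgebra.SpecialLinear.sl (Fin 2) ℝ

theorem trace_sl2 (X : sl2) : (X : Matrix (Fin 2) (Fin 2) ℝ).trace = 0 := X.2

theorem det_exp_sl2 (X : sl2) :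
    (NormedSpace.exp (X : Matrix (Fin 2) (Fin 2) ℝ)).det = 1 := by
  obtain ⟨A, hA⟩ := X
  have htr : A 0 0 + A 1 1 = 0 := by
    have := trace_sl2 ⟨A, hA⟩
    simpa [Matrix.trace, Fin.sum_univ_two] using this
  set J : Matrix (Fin 2) (Fin 2) ℝ := !![0, -1; 1, 0] with hJ
  have hJu : IsUnit J := by
    rw [Matrix.isUnit_iff_isUnit_det]; simp [hJ, Matrix.det_fin_two]
  have hJi : J⁻¹ = !![0, 1; -1, 0] := by
    apply Matrix.inv_eq_right_inv
    ext i j; fin_cases i <;> fin_cases j <;> simp [hJ, Matrix.mul_apply, Fin.sum_univ_two]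
  have hconj : J * A.transpose * J⁻¹ = -A := by
    rw [hJi]
    ext i j
    fin_cases i <;> fin_cases j <;>
      simp [hJ, Matrix.mul_apply, Fin.sum_univ_two, Matrix.vecMul, dotProduct] <;> linarith
  have hadj : ∀ M : Matrix (Fin 2) (Fin 2) ℝ, J * M.transpose * J⁻¹ = M.adjugate := by
    intro M
    rw [hJi]
    ext i j
    fin_cases i <;> fin_cases j <;>
      simp [hJ, Matrix.mul_apply, Fin.sum_univ_two, Matrix.adjugate_fin_two, Matrix.vecMul,
        dotProduct]
  have h1 : (NormedSpace.exp A).adjugate = NormedSpace.exp (-A) := by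
    rw [← hadj, ← Matrix.exp_transpose, ← Matrix.exp_conj _ _ hJu, hconj]
  have h2 : NormedSpace.exp A * NormedSpace.exp (-A) = 1 := by
    rw [← Matrix.exp_add_of_commute _ _ (Commute.neg_right (Commute.refl A))]
    simp
  rw [← h1, Matrix.mul_adjugate] at h2
  have := congrFun (congrFun h2 0) 0
  simpa using this

/-- The exponential map `𝔰𝔩(2, ℝ) → SL(2, ℝ)`. -/
def expSL (X : sl2) : SL(2, ℝ) :=
  ⟨NormedSpace.exp (X : Matrix (Fin 2) (Fin 2) ℝ), det_exp_sl2 X⟩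

/-- The adjoint action `X ↦ g X g⁻¹` of `SL(2, ℝ)` on `𝔰𝔩(2, ℝ)`. -/
def Ad (g : SL(2, ℝ)) (X : sl2) : sl2 :=
  ⟨(g : Matrix (Fin 2) (Fin 2) ℝ) * X * ((g⁻¹ : SL(2, ℝ)) : Matrix (Fin 2) (Fin 2) ℝ), by
    change Matrix.trace ((g : Matrix (Fin 2) (Fin 2) ℝ) * (X : Matrix (Fin 2) (Fin 2) ℝ) *
      ((g⁻¹ : SL(2, ℝ)) : Matrix (Fin 2) (Fin 2) ℝ)) = 0
    rw [Matrix.trace_mul_comm, ← mul_assoc, ← Matrix.SpecialLinearGroup.coe_mul]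
    simpa using trace_sl2 X⟩

/-- The maximal compact subgroup `K = SO(2)` of `SL(2, ℝ)`. -/
def SO2 : Subgroup SL(2, ℝ) where
  carrier := {g | (g : Matrix (Fin 2) (Fin 2) ℝ) ∈ Matrix.orthogonalGroup (Fin 2) ℝ}
  one_mem' := by simp [one_mem]
  mul_mem' := by
    intro a b ha hb
    simpa using mul_mem ha hb
  inv_mem' := by
    intro a ha
    have h : (a : Matrix (Fin 2) (Fin 2) ℝ) * star (a : Matrix (Fin 2) (Fin 2) ℝ) = 1 :=
      (Matrix.mem_orthogonalGroup_iff _ _).1 ha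
    have h2 : ((a⁻¹ : SL(2, ℝ)) : Matrix (Fin 2) (Fin 2) ℝ) * (a : Matrix (Fin 2) (Fin 2) ℝ) = 1 := by
      rw [← Matrix.SpecialLinearGroup.coe_mul]; simp
    have h3 : ((a⁻¹ : SL(2, ℝ)) : Matrix (Fin 2) (Fin 2) ℝ)
        = star (a : Matrix (Fin 2) (Fin 2) ℝ) := left_inv_eq_right_inv h2 h
    change ((a⁻¹ : SL(2, ℝ)) : Matrix (Fin 2) (Fin 2) ℝ) ∈ Matrix.orthogonalGroup (Fin 2) ℝ
    rw [h3]
    exact Unitary.star_mem ha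

/-! ## `(𝔤, K)`-modules -/

/-- A `(𝔤, K)`-module structure on a complex vector space `V`, for `𝔤 = 𝔰𝔩(2, ℝ)` and `K = SO(2)`. -/
structure GKModule (V : Type*) [AddCommGroup V] [Module ℂ V] where
  /-- the action of `𝔤` -/
  lie : sl2 →ₗ⁅ℝ⁆ Module.End ℂ V
  /-- the action of `K` -/
  grp : Representation ℂ SO2 V
  /-- every vector is `K`-finite -/
  finite : ∀ v, FiniteDimensional ℂ (Submodule.span ℂ (Set.range fun k => grp k v))
  /-- on `Lie(K)` the action of `𝔤` is the differential of the action of `K` (the derivative is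
  taken inside the finite-dimensional space spanned by `K v`, so it can be tested on linear
  functionals) -/
  diff : ∀ (A : sl2) (hA : ∀ t : ℝ, expSL (t • A) ∈ SO2) (v : V) (l : V →ₗ[ℂ] ℂ),
    HasDerivAt (fun t : ℝ => l (grp ⟨expSL (t • A), hA t⟩ v)) (l (lie A v)) 0
  /-- `k X v = (Ad(k) X) k v` -/
  equivariant : ∀ (k : SO2) (X : sl2) (v : V), grp k (lie X v) = lie (Ad k X) (grp k v)

/-- Isomorphism of `(𝔤, K)`-modules. -/
def GKModule.Iso {V W : Type*} [AddCommGroup V] [Module ℂ V] [AddCommGroup W] [Module ℂ W]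
    (A : GKModule V) (B : GKModule W) : Prop :=
  ∃ e : V ≃ₗ[ℂ] W, (∀ k v, e (A.grp k v) = B.grp k (e v)) ∧ ∀ X v, e (A.lie X v) = B.lie X (e v)

/-- Irreducibility: `V ≠ 0`, and `0` and `V` are the only `(𝔤, K)`-stable subspaces. -/
def GKModule.Irreducible {V : Type*} [AddCommGroup V] [Module ℂ V] (A : GKModule V) : Prop :=
  Nontrivial V ∧ ∀ U : Submodule ℂ V, (∀ k, ∀ v ∈ U, A.grp k v ∈ U) →
    (∀ X, ∀ v ∈ U, A.lie X v ∈ U) → U = ⊥ ∨ U = ⊤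

/-- The subspace of `K`-finite vectors of a representation of `SL(2, ℝ)`: the vectors `v` for
which the span of `K v` is finite-dimensional. -/
def kFinite {E : Type*} [AddCommGroup E] [Module ℂ E] (ρ : Representation ℂ SL(2, ℝ) E) :
    Submodule ℂ E where
  carrier := {v | FiniteDimensional ℂ (Submodule.span ℂ (Set.range fun k : SO2 => ρ k v))}
  zero_mem' := by
    change FiniteDimensional ℂ (Submodule.span ℂ (Set.range fun k : SO2 => ρ k (0 : E)))
    have h0 : (Set.range fun k : SO2 => ρ k (0 : E)) = {0} := by
      ext x
      simp
    rw [h0]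
    infer_instance
  add_mem' := by
    intro a b ha hb
    have ha' : FiniteDimensional ℂ (Submodule.span ℂ (Set.range fun k : SO2 => ρ k a)) := ha
    have hb' : FiniteDimensional ℂ (Submodule.span ℂ (Set.range fun k : SO2 => ρ k b)) := hb
    change FiniteDimensional ℂ _
    refine Submodule.finiteDimensional_of_le (S₂ :=
      Submodule.span ℂ (Set.range fun k : SO2 => ρ k a) ⊔
      Submodule.span ℂ (Set.range fun k : SO2 => ρ k b)) (Submodule.span_le.2 ?_)
    rintro _ ⟨k, rfl⟩
    simp only [map_add]
    exact Submodule.add_mem_sup (Submodule.subset_span ⟨k, rfl⟩) (Submodule.subset_span ⟨k, rfl⟩)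
  smul_mem' := by
    intro c a ha
    have ha' : FiniteDimensional ℂ (Submodule.span ℂ (Set.range fun k : SO2 => ρ k a)) := ha
    change FiniteDimensional ℂ _
    refine Submodule.finiteDimensional_of_le (S₂ :=
      Submodule.span ℂ (Set.range fun k : SO2 => ρ k a)) (Submodule.span_le.2 ?_)
    rintro _ ⟨k, rfl⟩
    simp only [map_smul]
    exact Submodule.smul_mem _ _ (Submodule.subset_span ⟨k, rfl⟩)

/-- The `(𝔤, K)`-module structure `A` on a subspace `V` of a representation `ρ` of `SL(2, ℝ)` is the
one induced by `ρ`: `K` acts through `ρ`, and `X ∈ 𝔤` acts by the derivative of `ρ(exp (t X))` at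
`t = 0` in the topology of the representation space. -/
def GKModule.IsInducedBy {E : Type*} [AddCommGroup E] [Module ℂ E] [TopologicalSpace E]
    {V : Submodule ℂ E} (A : GKModule V) (ρ : Representation ℂ SL(2, ℝ) E) : Prop :=
  (∀ (k : SO2) (v : V), (A.grp k v : E) = ρ k v) ∧
  ∀ (X : sl2) (v : V),
    Tendsto (fun t : ℝ => ((t⁻¹ : ℝ) : ℂ) • (ρ (expSL (t • X)) (v : E) - (v : E)))
      (𝓝[≠] 0) (𝓝 (A.lie X v : E))

/-! ## The induced space `I_d` and the action of `SL(2, ℝ)` on it -/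

/-- `I_d`: the smooth functions `φ : ℝ → ℂ` such that `x ↦ x^(-d-1) φ(-1/x)` is smooth, that is,
extends from `x ≠ 0` to a smooth function on `ℝ`. -/
def indSpace (d : ℕ) : Submodule ℂ (ℝ → ℂ) where
  carrier := {φ | ContDiff ℝ ∞ φ ∧ ∃ ψ : ℝ → ℂ, ContDiff ℝ ∞ ψ ∧
    ∀ x : ℝ, x ≠ 0 → ψ x = ((x : ℂ) ^ (d + 1))⁻¹ * φ (-1 / x)}
  zero_mem' := ⟨contDiff_const, 0, contDiff_const, by simp⟩
  add_mem' := by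
    rintro a b ⟨ha, p, hp, hpa⟩ ⟨hb, q, hq, hqb⟩
    refine ⟨ha.add hb, p + q, hp.add hq, fun x hx => ?_⟩
    simp [hpa x hx, hqb x hx, mul_add]
  smul_mem' := by
    rintro c a ⟨ha, p, hp, hpa⟩
    refine ⟨ha.const_smul c, c • p, hp.const_smul c, fun x hx => ?_⟩
    simp [hpa x hx]; ring

/-- The right hand side `(r x + p)^(-d-1) φ((s x + q) / (r x + p))` of the action of the matrix
`g` with rows `(p, q)` and `(r, s)`. -/
def indFormula (d : ℕ) (g : SL(2, ℝ)) (φ : ℝ → ℂ) (x : ℝ) : ℂ :=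
  (((g 1 0 * x + g 0 0 : ℝ) : ℂ) ^ (d + 1))⁻¹ * φ ((g 1 1 * x + g 0 1) / (g 1 0 * x + g 0 0))

/-- The function `π_d(g) φ`: given by `indFormula`, and extended by continuity to the
point with `r x + p = 0` (if there is one). -/
def indAct (d : ℕ) (g : SL(2, ℝ)) (φ : ℝ → ℂ) (x : ℝ) : ℂ :=
  if g 1 0 * x + g 0 0 = 0 then limUnder (𝓝[≠] x) (indFormula d g φ) else indFormula d g φ x

/-- Auxiliary: the homogeneous function on `ℝ² ∖ 0` of degree `-d-1` attached to `φ ∈ I_d`, where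
`ψ` is the smooth extension of `x^(-d-1) φ(-1/x)`. -/
def hom (d : ℕ) (φ ψ : ℝ → ℂ) (a b : ℝ) : ℂ :=
  if a = 0 then (((-b : ℝ) : ℂ) ^ (d + 1))⁻¹ * ψ 0 else ((a : ℂ) ^ (d + 1))⁻¹ * φ (b / a)

theorem hom_eq {d : ℕ} {φ ψ : ℝ → ℂ}
    (h : ∀ x : ℝ, x ≠ 0 → ψ x = ((x : ℂ) ^ (d + 1))⁻¹ * φ (-1 / x)) {a b : ℝ} (hb : b ≠ 0) :
    hom d φ ψ a b = (((-b : ℝ) : ℂ) ^ (d + 1))⁻¹ * ψ (-a / b) := by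
  unfold hom
  split_ifs with ha
  · simp [ha]
  · rw [h _ (div_ne_zero (neg_ne_zero.2 ha) hb)]
    have h1 : -1 / (-a / b) = b / a := by field_simp
    rw [h1, ← mul_assoc, ← mul_inv, ← mul_pow]
    congr 4
    have : (b : ℂ) ≠ 0 := by exact_mod_cast hb
    push_cast; field_simp

theorem hom_smul {d : ℕ} {φ ψ : ℝ → ℂ} {c a b : ℝ} (hc : c ≠ 0) :
    hom d φ ψ (c * a) (c * b) = ((c : ℂ) ^ (d + 1))⁻¹ * hom d φ ψ a b := by
  unfold hom
  by_cases ha : a = 0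
  · simp only [ha, mul_zero, if_true]
    rw [← mul_assoc, ← mul_inv, ← mul_pow]
    push_cast; congr 3; ring
  · simp only [ha, mul_eq_zero, hc, or_self, if_false]
    rw [mul_div_mul_left _ _ hc, ← mul_assoc, ← mul_inv, ← mul_pow]
    push_cast; rfl

theorem det_eq (g : SL(2, ℝ)) : g 0 0 * g 1 1 - g 0 1 * g 1 0 = 1 := by
  have := g.2
  rwa [Matrix.det_fin_two] at this

/-- The composition of `hom` with a line in `ℝ²` not through the origin is smooth. -/
theorem contDiff_hom {d : ℕ} {φ ψ : ℝ → ℂ} (hφ : ContDiff ℝ ∞ φ) (hψ : ContDiff ℝ ∞ ψ)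
    (h : ∀ x : ℝ, x ≠ 0 → ψ x = ((x : ℂ) ^ (d + 1))⁻¹ * φ (-1 / x))
    {r p s q : ℝ} (hdet : p * s - q * r ≠ 0) :
    ContDiff ℝ ∞ (fun x => hom d φ ψ (r * x + p) (s * x + q)) := by
  have hofReal : ContDiff ℝ ∞ (fun x : ℝ => (x : ℂ)) := Complex.ofRealCLM.contDiff
  rw [contDiff_iff_contDiffAt]
  intro x
  by_cases ha : r * x + p = 0
  · have hb : s * x + q ≠ 0 := by
      intro hb
      apply hdet
      rcases eq_or_ne r 0 with hr | hr
      · subst hr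
        have : p = 0 := by simpa using ha
        simp [this]
      · have hp : p = -(r * x) := by linarith
        have hq : q = -(s * x) := by linarith
        rw [hp, hq]; ring
    have hev : (fun x => hom d φ ψ (r * x + p) (s * x + q)) =ᶠ[𝓝 x]
        fun y => (((-(s * y + q) : ℝ) : ℂ) ^ (d + 1))⁻¹ * ψ (-(r * y + p) / (s * y + q)) := by
      have : ∀ᶠ y in 𝓝 x, s * y + q ≠ 0 :=
        (by fun_prop : Continuous fun y : ℝ => s * y + q).continuousAt.eventually_ne hb
      filter_upwards [this] with y hy
      exact hom_eq h hy
    refine ContDiffAt.congr_of_eventuallyEq ?_ hev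
    refine ContDiffAt.mul (ContDiffAt.inv ?_ ?_) (hψ.contDiffAt.comp x (ContDiffAt.div ?_ ?_ hb))
    · exact ((hofReal.comp (by fun_prop)).pow _).contDiffAt
    · apply pow_ne_zero
      exact_mod_cast neg_ne_zero.2 hb
    · fun_prop
    · fun_prop
  · have hev : (fun x => hom d φ ψ (r * x + p) (s * x + q)) =ᶠ[𝓝 x]
        fun y => (((r * y + p : ℝ) : ℂ) ^ (d + 1))⁻¹ * φ ((s * y + q) / (r * y + p)) := by
      have : ∀ᶠ y in 𝓝 x, r * y + p ≠ 0 :=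
        (by fun_prop : Continuous fun y : ℝ => r * y + p).continuousAt.eventually_ne ha
      filter_upwards [this] with y hy
      simp [hom, hy]
    refine ContDiffAt.congr_of_eventuallyEq ?_ hev
    refine ContDiffAt.mul (ContDiffAt.inv ?_ ?_) (hφ.contDiffAt.comp x (ContDiffAt.div ?_ ?_ ha))
    · exact ((hofReal.comp (by fun_prop)).pow _).contDiffAt
    · apply pow_ne_zero
      exact_mod_cast ha
    · fun_prop
    · fun_prop

theorem indAct_eq_hom {d : ℕ} {φ ψ : ℝ → ℂ} (hφ : ContDiff ℝ ∞ φ) (hψ : ContDiff ℝ ∞ ψ)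
    (h : ∀ x : ℝ, x ≠ 0 → ψ x = ((x : ℂ) ^ (d + 1))⁻¹ * φ (-1 / x)) (g : SL(2, ℝ)) (x : ℝ) :
    indAct d g φ x = hom d φ ψ (g 1 0 * x + g 0 0) (g 1 1 * x + g 0 1) := by
  have hdet := det_eq g
  unfold indAct
  split_ifs with hx
  · have hr : g 1 0 ≠ 0 := by
      intro hr
      rw [hr] at hx hdet
      have : g 0 0 = 0 := by simpa using hx
      simp [this] at hdet
    have hc : Continuous fun y => hom d φ ψ (g 1 0 * y + g 0 0) (g 1 1 * y + g 0 1) :=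
      (contDiff_hom hφ hψ h (by rw [hdet]; exact one_ne_zero)).continuous
    apply Tendsto.limUnder_eq
    refine ((hc.tendsto x).mono_left nhdsWithin_le_nhds).congr' ?_
    filter_upwards [self_mem_nhdsWithin] with y hy
    have hy' : g 1 0 * y + g 0 0 ≠ 0 := by
      intro h0
      apply hy
      have : g 1 0 * (y - x) = 0 := by linarith
      rcases mul_eq_zero.1 this with h | h
      · exact absurd h hr
      · simpa using (by linarith : y = x)
    simp [hom, hy', indFormula]
  · simp [hom, hx, indFormula]

/-- The smooth extension of `x^(-d-1) (π_d(g) φ)(-1/x)`. -/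
theorem hom_indAct_aux {d : ℕ} {φ ψ : ℝ → ℂ} (hφ : ContDiff ℝ ∞ φ) (hψ : ContDiff ℝ ∞ ψ)
    (h : ∀ x : ℝ, x ≠ 0 → ψ x = ((x : ℂ) ^ (d + 1))⁻¹ * φ (-1 / x)) (g : SL(2, ℝ)) (x : ℝ)
    (hx : x ≠ 0) :
    hom d φ ψ (g 0 0 * x + -g 1 0) (g 0 1 * x + -g 1 1)
      = ((x : ℂ) ^ (d + 1))⁻¹ * indAct d g φ (-1 / x) := by
  rw [indAct_eq_hom hφ hψ h, ← hom_smul hx]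
  congr 1 <;> field_simp <;> ring

theorem indAct_mem {d : ℕ} (g : SL(2, ℝ)) {φ : ℝ → ℂ} (hφ : φ ∈ indSpace d) :
    indAct d g φ ∈ indSpace d := by
  obtain ⟨h1, ψ, h2, h3⟩ := hφ
  have hdet := det_eq g
  refine ⟨?_, fun x => hom d φ ψ (g 0 0 * x + -g 1 0) (g 0 1 * x + -g 1 1), ?_, ?_⟩
  · rw [funext (indAct_eq_hom h1 h2 h3 g)]
    exact contDiff_hom h1 h2 h3 (by rw [hdet]; exact one_ne_zero)
  · refine contDiff_hom h1 h2 h3 ?_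
    have : -g 1 0 * g 0 1 - -g 1 1 * g 0 0 = 1 := by linarith
    rw [this]; exact one_ne_zero
  · exact fun x hx => hom_indAct_aux h1 h2 h3 g x hx

theorem indAct_mul {d : ℕ} (g k : SL(2, ℝ)) {φ : ℝ → ℂ} (hφ : φ ∈ indSpace d) :
    indAct d (g * k) φ = indAct d g (indAct d k φ) := by
  obtain ⟨h1, ψ, h2, h3⟩ := hφ
  obtain ⟨k1, -⟩ := indAct_mem k ⟨h1, ψ, h2, h3⟩
  have hdet := det_eq k
  set ψ' : ℝ → ℂ := fun x => hom d φ ψ (k 0 0 * x + -k 1 0) (k 0 1 * x + -k 1 1) with hψ'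
  have k2 : ContDiff ℝ ∞ ψ' := by
    refine contDiff_hom h1 h2 h3 ?_
    have : -k 1 0 * k 0 1 - -k 1 1 * k 0 0 = 1 := by linarith
    rw [this]; exact one_ne_zero
  have k3 := hom_indAct_aux h1 h2 h3 k
  have key : ∀ a b : ℝ, (a ≠ 0 ∨ b ≠ 0) → hom d (indAct d k φ) ψ' a b =
      hom d φ ψ (a * k 0 0 + b * k 1 0) (a * k 0 1 + b * k 1 1) := by
    intro a b hab
    by_cases ha : a = 0
    · have hb : -b ≠ 0 := neg_ne_zero.2 (hab.resolve_left (not_not.2 ha))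
      conv_lhs => rw [hom, if_pos ha, hψ']
      rw [← hom_smul hb]
      congr 1 <;> rw [ha] <;> ring
    · conv_lhs => rw [hom, if_neg ha, indAct_eq_hom h1 h2 h3, ← hom_smul ha]
      congr 1 <;> field_simp <;> ring
  funext x
  rw [indAct_eq_hom h1 h2 h3, indAct_eq_hom k1 k2 k3, key]
  · simp only [Matrix.SpecialLinearGroup.coe_mul, Matrix.mul_apply, Fin.sum_univ_two]
    congr 1 <;> ring
  · by_contra! hcon
    have hg := det_eq g
    obtain ⟨ha, hb⟩ := hcon
    have hp : g 0 0 = -(g 1 0 * x) := by linarith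
    have hq : g 0 1 = -(g 1 1 * x) := by linarith
    rw [hp, hq] at hg
    have : -(g 1 0 * x) * g 1 1 - -(g 1 1 * x) * g 1 0 = 0 := by ring
    linarith

theorem indAct_add {d : ℕ} (g : SL(2, ℝ)) {φ χ : ℝ → ℂ} (hφ : φ ∈ indSpace d)
    (hχ : χ ∈ indSpace d) : indAct d g (φ + χ) = indAct d g φ + indAct d g χ := by
  obtain ⟨h1, ψ, h2, h3⟩ := hφ
  obtain ⟨k1, ξ, k2, k3⟩ := hχ
  have e3 : ∀ x : ℝ, x ≠ 0 → (ψ + ξ) x = ((x : ℂ) ^ (d + 1))⁻¹ * (φ + χ) (-1 / x) := by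
    intro x hx; simp [h3 x hx, k3 x hx, mul_add]
  funext x
  rw [Pi.add_apply, indAct_eq_hom h1 h2 h3, indAct_eq_hom k1 k2 k3,
    indAct_eq_hom (φ := φ + χ) (h1.add k1) (h2.add k2) e3]
  unfold hom
  split_ifs <;> simp [mul_add]

theorem indAct_smul {d : ℕ} (g : SL(2, ℝ)) (c : ℂ) {φ : ℝ → ℂ} (hφ : φ ∈ indSpace d) :
    indAct d g (c • φ) = c • indAct d g φ := by
  obtain ⟨h1, ψ, h2, h3⟩ := hφ
  have e3 : ∀ x : ℝ, x ≠ 0 → (c • ψ) x = ((x : ℂ) ^ (d + 1))⁻¹ * (c • φ) (-1 / x) := by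
    intro x hx; simp [h3 x hx]; ring
  funext x
  rw [Pi.smul_apply, indAct_eq_hom h1 h2 h3,
    indAct_eq_hom (φ := c • φ) (h1.const_smul c) (h2.const_smul c) e3]
  unfold hom
  split_ifs <;> simp <;> ring

/-- The representation `π_d` of `SL(2, ℝ)` on `I_d`. As a subspace of `ℝ → ℂ`, the space `I_d` carries
the topology of pointwise convergence, in which the derivatives of `π_d(exp (t X)) φ` are the
left invariant differential operators. -/
def indRep (d : ℕ) : Representation ℂ SL(2, ℝ) (indSpace d) where
  toFun g :=
    { toFun := fun φ => ⟨indAct d g φ, indAct_mem g φ.2⟩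
      map_add' := fun φ χ => Subtype.ext (indAct_add g φ.2 χ.2)
      map_smul' := fun c φ => Subtype.ext (indAct_smul g c φ.2) }
  map_one' := by
    ext φ x
    simp [indAct, indFormula]
  map_mul' := by
    intro g k
    ext φ x
    exact congrFun (indAct_mul g k φ.2) x

/-! ## The Schwartz spaces, the map `T_d` and the subspace `I_d^+` -/

/-- The Schwartz space `S([0,∞))`: functions smooth on `[0,∞)` all of whose derivatives are rapidly
decreasing at `∞`. -/
def IsSchwartzHalfLine (f : ℝ → ℂ) : Prop :=
  ContDiffOn ℝ ∞ f (Ici 0) ∧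
    ∀ k n : ℕ, ∃ C : ℝ, ∀ x ∈ Ici (0 : ℝ), x ^ k * ‖iteratedDerivWithin n f (Ici 0) x‖ ≤ C

theorem IsSchwartzHalfLine.add {f g : ℝ → ℂ} (hf : IsSchwartzHalfLine f)
    (hg : IsSchwartzHalfLine g) : IsSchwartzHalfLine (f + g) := by
  refine ⟨hf.1.add hg.1, fun k n => ?_⟩
  obtain ⟨C, hC⟩ := hf.2 k n
  obtain ⟨D, hD⟩ := hg.2 k n
  refine ⟨C + D, fun x hx => ?_⟩
  have hle : ((n : ℕ∞) : WithTop ℕ∞) ≤ ∞ := by exact_mod_cast le_top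
  rw [iteratedDerivWithin_add hx (uniqueDiffOn_Ici 0) ((hf.1 x hx).of_le hle)
    ((hg.1 x hx).of_le hle)]
  have h0 : 0 ≤ x ^ k := pow_nonneg hx k
  calc _ ≤ x ^ k * (‖iteratedDerivWithin n f (Ici 0) x‖ + ‖iteratedDerivWithin n g (Ici 0) x‖) :=
        mul_le_mul_of_nonneg_left (norm_add_le _ _) h0
    _ ≤ C + D := by rw [mul_add]; exact add_le_add (hC x hx) (hD x hx)

theorem IsSchwartzHalfLine.const_smul {f : ℝ → ℂ} (c : ℂ) (hf : IsSchwartzHalfLine f) :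
    IsSchwartzHalfLine (c • f) := by
  refine ⟨hf.1.const_smul c, fun k n => ?_⟩
  obtain ⟨C, hC⟩ := hf.2 k n
  refine ⟨‖c‖ * C, fun x hx => ?_⟩
  have hle : ((n : ℕ∞) : WithTop ℕ∞) ≤ ∞ := by exact_mod_cast le_top
  rw [iteratedDerivWithin_const_smul hx (uniqueDiffOn_Ici 0) c ((hf.1 x hx).of_le hle), norm_smul]
  calc _ = ‖c‖ * (x ^ k * ‖iteratedDerivWithin n f (Ici 0) x‖) := by ring
    _ ≤ ‖c‖ * C := mul_le_mul_of_nonneg_left (hC x hx) (norm_nonneg c)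

/-- `S_d([0,∞))`: the functions `x^((d+1)/2) f₁(x)` with `f₁ ∈ S([0,∞))`, extended by zero to the
negative reals. -/
def schwartzD (d : ℕ) : Submodule ℂ (ℝ → ℂ) where
  carrier := {f | ∃ f₁ : ℝ → ℂ, IsSchwartzHalfLine f₁ ∧
    f = (Ici (0 : ℝ)).indicator fun x => ((x ^ (((d : ℝ) + 1) / 2) : ℝ) : ℂ) * f₁ x}
  zero_mem' := by
    refine ⟨0, ⟨contDiff_const.contDiffOn, fun k n => ⟨0, fun x _ => ?_⟩⟩, by ext; simp⟩
    simp
  add_mem' := by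
    rintro _ _ ⟨f, hf, rfl⟩ ⟨g, hg, rfl⟩
    refine ⟨f + g, hf.add hg, ?_⟩
    rw [← indicator_add']
    congr 1; ext x; simp [mul_add]
  smul_mem' := by
    rintro c _ ⟨f, hf, rfl⟩
    refine ⟨c • f, hf.const_smul c, ?_⟩
    ext x
    by_cases hx : x ∈ Ici (0 : ℝ)
    · simp only [Pi.smul_apply, indicator_of_mem hx, smul_eq_mul]; ring
    · simp only [Pi.smul_apply, indicator_of_notMem hx, smul_zero]

/-- `T_d(f)(z) = (2π)^(-1/2) ∫₀^∞ x^((d-1)/2) f(x) e^(i ε x z) dx`. For `ε = 1` this is the map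
`T_d` on `S_d([0,∞))`; for `ε = -1` it is `T_d` on `S_d((-∞,0])`, transported to the positive half
line by `x ↦ -x`. -/
def T (d : ℕ) (ε : ℤˣ) (f : ℝ → ℂ) (z : ℝ) : ℂ :=
  (((Real.sqrt (2 * Real.pi))⁻¹ : ℝ) : ℂ) * ∫ x in Ioi (0 : ℝ),
    ((x ^ (((d : ℝ) - 1) / 2) : ℝ) : ℂ) * f x * Complex.exp (Complex.I * ((ε : ℤ) : ℂ) * x * z)

/-- `M_d(φ)(y) = y^((1-d)/2) (2π)^(-1/2) ∫ φ(x) e^(-i ε x y) dx` for `y > 0`: for `ε = 1` this is the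
inverse `M_d` of `T_d` on the positive half line, for `ε = -1` it is `M_d(φ)(-y)`. -/
def M (d : ℕ) (ε : ℤˣ) (φ : ℝ → ℂ) (y : ℝ) : ℂ :=
  ((y ^ ((1 - (d : ℝ)) / 2) : ℝ) : ℂ) * (((Real.sqrt (2 * Real.pi))⁻¹ : ℝ) : ℂ) *
    ∫ x : ℝ, φ x * Complex.exp (-(Complex.I * ((ε : ℤ) : ℂ) * x * y))

theorem integrable_T {d : ℕ} (ε : ℤˣ) {f : ℝ → ℂ} (hf : f ∈ schwartzD d) (z : ℝ) :
    IntegrableOn (fun x : ℝ => ((x ^ (((d : ℝ) - 1) / 2) : ℝ) : ℂ) * f x *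
      Complex.exp (Complex.I * ((ε : ℤ) : ℂ) * x * z)) (Ioi 0) := by
  obtain ⟨f₁, hf₁, rfl⟩ := hf
  have hcont : ContinuousOn f₁ (Ioi 0) := hf₁.1.continuousOn.mono Ioi_subset_Ici_self
  obtain ⟨C, hC⟩ := hf₁.2 d 0
  obtain ⟨D, hD⟩ := hf₁.2 (d + 2) 0
  have heq : EqOn (fun x : ℝ => ((x ^ d : ℝ) : ℂ) * f₁ x *
      Complex.exp (Complex.I * ((ε : ℤ) : ℂ) * x * z))
      (fun x : ℝ => ((x ^ (((d : ℝ) - 1) / 2) : ℝ) : ℂ) *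
        (Ici (0 : ℝ)).indicator (fun x => ((x ^ (((d : ℝ) + 1) / 2) : ℝ) : ℂ) * f₁ x) x *
      Complex.exp (Complex.I * ((ε : ℤ) : ℂ) * x * z)) (Ioi 0) := by
    intro x hx
    have hx0 : (0 : ℝ) < x := hx
    have : x ^ d = x ^ (((d : ℝ) - 1) / 2) * x ^ (((d : ℝ) + 1) / 2) := by
      rw [← Real.rpow_add hx0, ← Real.rpow_natCast]
      congr 1; ring
    simp only [indicator_of_mem (show x ∈ Ici (0 : ℝ) from hx0.le), this]
    push_cast; ring
  refine IntegrableOn.congr_fun ?_ heq measurableSet_Ioi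
  have hbound : IntegrableOn (fun x : ℝ => (C + D) * (1 + x ^ 2)⁻¹) (Ioi 0) :=
    (integrable_inv_one_add_sq.const_mul _).integrableOn
  refine Integrable.mono' hbound ?_ ?_
  · refine ContinuousOn.aestronglyMeasurable ?_ measurableSet_Ioi
    refine ContinuousOn.mul (ContinuousOn.mul ?_ hcont) ?_
    · exact Continuous.continuousOn (by fun_prop)
    · exact Continuous.continuousOn (by fun_prop)
  · refine (ae_restrict_iff' measurableSet_Ioi).2 (ae_of_all _ fun x hx => ?_)
    have hx0 : (0 : ℝ) < x := hx
    have h1 := hC x hx0.le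
    have h2 := hD x hx0.le
    simp only [iteratedDerivWithin_zero] at h1 h2
    have hexp : ‖Complex.exp (Complex.I * ((ε : ℤ) : ℂ) * x * z)‖ = 1 := by
      rw [show Complex.I * ((ε : ℤ) : ℂ) * x * z = (((ε : ℤ) * x * z : ℝ) : ℂ) * Complex.I by
        push_cast; ring]
      exact Complex.norm_exp_ofReal_mul_I _
    rw [norm_mul, norm_mul, hexp, mul_one, Complex.norm_real, Real.norm_eq_abs,
      abs_of_pos (pow_pos hx0 d), ← div_eq_mul_inv, le_div_iff₀ (by positivity)]
    calc _ = x ^ d * ‖f₁ x‖ + x ^ (d + 2) * ‖f₁ x‖ := by ring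
      _ ≤ C + D := add_le_add h1 h2

/-- The subspace `I_d^+ = T_d(S_d([0,∞)))` of `I_d`. -/
def indPlus (d : ℕ) : Submodule ℂ (indSpace d) where
  carrier := {φ | ∃ f ∈ schwartzD d, (φ : ℝ → ℂ) = T d 1 f}
  zero_mem' := ⟨0, Submodule.zero_mem _, by ext z; simp [T]⟩
  add_mem' := by
    rintro φ χ ⟨f, hf, hφ⟩ ⟨g, hg, hχ⟩
    refine ⟨f + g, Submodule.add_mem _ hf hg, ?_⟩
    ext z
    rw [Submodule.coe_add, hφ, hχ, Pi.add_apply]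
    unfold T
    rw [← mul_add, ← integral_add (integrable_T 1 hf z) (integrable_T 1 hg z)]
    congr 2; ext x; simp only [Pi.add_apply]; ring
  smul_mem' := by
    rintro c φ ⟨f, hf, hφ⟩
    refine ⟨c • f, Submodule.smul_mem _ c hf, ?_⟩
    ext z
    rw [Submodule.coe_smul, hφ, Pi.smul_apply]
    unfold T
    rw [smul_eq_mul, mul_left_comm, ← integral_const_mul]
    congr 2; ext x; simp only [Pi.smul_apply, smul_eq_mul]; ring

/-! ## The Kirillov Hilbert representation -/

/-- The measure `dx/x` on `(0,∞)`. -/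
def mulMeasure : Measure ℝ :=
  (volume.restrict (Ioi 0)).withDensity fun x => ENNReal.ofReal x⁻¹

/-- The Hilbert space `L²((0,∞), dx/x)`. -/
abbrev KirillovSpace := Lp ℂ 2 mulMeasure

/-- `R` is the Kirillov Hilbert representation `R_d^+` (for `ε = 1`) or `R_d^-` (for `ε = -1`):
the extension by continuity to `L²((0,∞), dx/x)`, by unitary operators, of the action
`R(g) f = M_d(π_d(g) T_d(f))` of `SL(2, ℝ)` on `S_d([0,∞))`. -/
structure IsKirillovRep (d : ℕ) (ε : ℤˣ) (R : Representation ℂ SL(2, ℝ) KirillovSpace) :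
    Prop where
  isometry : ∀ g f, ‖R g f‖ = ‖f‖
  extends_action : ∀ (g : SL(2, ℝ)) (f : ℝ → ℂ), f ∈ schwartzD d → ∀ F : KirillovSpace,
    F =ᵐ[mulMeasure] f → R g F =ᵐ[mulMeasure] M d ε (indAct d g (T d ε f))

/-- The function `x ↦ x^((d+1)/2) e^(-x) p(x)`. -/
def polyExp (d : ℕ) (p : ℂ[X]) (x : ℝ) : ℂ :=
  ((x ^ (((d : ℝ) + 1) / 2) * Real.exp (-x) : ℝ) : ℂ) * p.eval (x : ℂ)

end Kirillov

end

open Kirillov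

noncomputable section

namespace Kirillov

attribute [local instance] LieRing.ofAssociativeRing

/-! ## Fourier inversion almost everywhere -/

/-! Everything is read off from the Laplace transform `laplace d F w`, the integral of x^((d-1)/2)
F(x) e^(-wx), on the right half plane. Its value at w is the inner product of F with `expVec d` at
the conjugate of w. By uniqueness for Fourier transforms on a vertical line these vectors span a
dense subspace (`denseRange_expComb`), and their Gram kernel d!/(v̄ + w)^(d+1) is covariant under
the Möbius action of SL(2, ℝ). Hence sending each such vector to its Möbius translate, divided by
the automorphy factor to the power d+1, preserves inner products and extends to a unitary operator;
the cocycle identities make these operators a representation, `kirillovRep`. On Laplace transforms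
it is the weight d+1 action `slash`.

The function T f is the boundary value of the Laplace transform on the imaginary axis, and π_d is
the boundary value of `slash`. Fourier inversion on the line Re w = y, followed by y → 0, therefore
identifies `kirillovRep` with M π_d(g) T on S_d (`kirillovRep_ae_eq`); the domination needs decay of
order |w|^(-2), which is where d ≥ 1 enters. An isometric extension is unique since the vectors
`expVec` lie in S_d. The sign -1 reduces to +1 by conjugation with diag(1, -1), which normalises K.

In the Cayley coordinate ζ = (1-w)/(1+w), the vectors x^((d+1)/2) e^(-x) p(x) have the Laplace
transforms (1+w)^(-d-1) P(ζ) with P a polynomial (`laplace_laguerre`). There K acts by rotating ζ,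
so ζ^m is a weight vector of weight d+1+2m. These vectors are complete (`eq_zero_of_inner_polyVec`),
and the rotation by one radian already separates the weights. A K-finite vector is annihilated by a
nonzero polynomial in this rotation, so only finitely many of its weight components are nonzero, and
it is a polynomial vector. For I_d^+ the same annihilating polynomial is carried to the Kirillov
space through M.

Both modules of K-finite vectors are thus copies of ℂ[ζ], on which 𝔤 acts by first order
differential operators (`discModule`). The copies are isomorphic by construction. They are
irreducible because the complexified Lie algebra contains ∂, which lowers any nonzero polynomial to
a nonzero constant, and ζ²∂ + (d+1)ζ, which raises 1 to every power of ζ with nonzero coefficients.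
For the norm derivative in the Kirillov space, derivatives of Laplace transforms are integrated
along the one-parameter group (`hasDerivAt_kirillovRep_discVec`). -/

open scoped FourierTransform in
/-- Fourier inversion holds almost everywhere for an integrable function with integrable Fourier
transform. -/
theorem ae_fourierInv_fourier_eq {u : ℝ → ℂ} (hu : Integrable u) (hU : Integrable (𝓕 u)) :
    𝓕⁻ (𝓕 u) =ᵐ[volume] u := by
  -- The multiplication formula moves both transforms from u onto a test function, for which
  -- inversion is known.
  have key : ∀ {a b : ℝ → ℂ}, Integrable a → Integrable b → ∫ x, 𝓕 a x * b x = ∫ x, a x * 𝓕 b x := by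
    intro a b ha hb
    simpa using! VectorFourier.integral_fourierIntegral_smul_eq_flip (L := innerₗ ℝ)
      Real.continuous_fourierChar continuous_inner ha hb
  have hinv : 𝓕⁻ (𝓕 u) = 𝓕 (fun x => 𝓕 u (-x)) := Real.fourierInv_eq_fourier_comp_neg _
  have hcont : Continuous (𝓕 (fun x => 𝓕 u (-x))) :=
    VectorFourier.fourierIntegral_continuous Real.continuous_fourierChar
      (by exact continuous_inner) hU.comp_neg
  refine ae_eq_of_integral_contDiff_smul_eq (by rw [hinv]; exact hcont.locallyIntegrable)
    hu.locallyIntegrable fun g hg hgc => ?_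
  set G0 : ℝ → ℂ := fun x => (g x : ℂ) with hG0
  have hG0c : HasCompactSupport G0 := hgc.comp_left (g := fun x : ℝ => (x : ℂ)) (by simp)
  have hG0s : ContDiff ℝ ∞ G0 := Complex.ofRealCLM.contDiff.comp hg
  set G : SchwartzMap ℝ ℂ := hG0c.toSchwartzMap hG0s with hG
  have hGc : ∀ x, G x = (g x : ℂ) := fun x => rfl
  have e1 : ∫ x, g x • 𝓕⁻ (𝓕 u) x = ∫ x, 𝓕 (fun x => 𝓕 u (-x)) x * G x := by
    congr 1; ext x; rw [hinv, hGc, Complex.real_smul, mul_comm]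
  have e2 : ∫ x, g x • u x = ∫ x, u x * 𝓕 (𝓕⁻ (G : ℝ → ℂ)) x := by
    congr 1; ext x
    rw [Continuous.fourier_fourierInv_eq G.continuous G.integrable, hGc, Complex.real_smul,
      mul_comm]
    rw [← SchwartzMap.fourier_coe]; exact (𝓕 G).integrable
  have hGi : Integrable (𝓕⁻ (G : ℝ → ℂ)) := by
    rw [← SchwartzMap.fourierInv_coe]; exact (𝓕⁻ G).integrable
  rw [e1, e2, key hU.comp_neg G.integrable, ← key hu hGi]
  rw [← integral_neg_eq_self (fun x => 𝓕 u x * 𝓕⁻ (G : ℝ → ℂ) x)]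
  congr 1; ext x
  rw [Real.fourierInv_eq_fourier_neg, neg_neg]

-- A rescaling by -2π passes from the kernel e^(ixξ) to the normalised transform with kernel
-- e^(-2πixξ); its Jacobian is the factor 2π on the right.
open scoped FourierTransform in
theorem ae_integral_fourier_eq {u U : ℝ → ℂ} (hu : Integrable u) (hU : Integrable U)
    (h : ∀ ξ : ℝ, U ξ = ∫ x : ℝ, u x * Complex.exp (Complex.I * x * ξ)) :
    ∀ᵐ x : ℝ, ∫ ξ : ℝ, U ξ * Complex.exp (-(Complex.I * ξ * x)) = 2 * Real.pi * u x := by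
  have hF : ∀ ξ, 𝓕 u ξ = U (-(2 * Real.pi) * ξ) := by
    intro ξ
    rw [Real.fourier_real_eq_integral_exp_smul, h]
    congr 1; ext x
    rw [smul_eq_mul, mul_comm]; push_cast; congr 2; ring
  have hpi : (-(2 * Real.pi)) ≠ 0 := by simp [Real.pi_ne_zero]
  have hi : Integrable (𝓕 u) := by
    rw [funext hF]
    exact hU.comp_mul_left' hpi
  filter_upwards [ae_fourierInv_fourier_eq hu hi] with x hx
  rw [← hx, Real.fourierInv_eq']
  have := Measure.integral_comp_mul_left
    (fun ξ : ℝ => U ξ * Complex.exp (-(Complex.I * ξ * x))) (-(2 * Real.pi))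
  have e : ∫ v : ℝ, Complex.exp (↑(2 * Real.pi * inner ℝ v x) * Complex.I) • 𝓕 u v =
      ∫ ξ : ℝ, U (-(2 * Real.pi) * ξ) *
        Complex.exp (-(Complex.I * ((-(2 * Real.pi) * ξ : ℝ) : ℂ) * x)) := by
    congr 1; ext ξ
    rw [hF, smul_eq_mul, mul_comm]
    congr 2
    simp; ring
  rw [e, this, abs_inv, abs_neg, abs_of_pos Real.two_pi_pos, Complex.real_smul]
  push_cast
  field_simp
  congr 1; ext ξ
  ring_nf

theorem ae_eq_zero_of_integral_exp_eq_zero {u : ℝ → ℂ} (hu : Integrable u)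
    (h : ∀ ξ : ℝ, ∫ x : ℝ, u x * Complex.exp (Complex.I * x * ξ) = 0) : u =ᵐ[volume] 0 := by
  filter_upwards [ae_integral_fourier_eq hu (integrable_zero ℝ ℂ volume) (fun ξ => (h ξ).symm)]
    with x hx
  simpa [Real.pi_ne_zero] using hx.symm

/-! ## Schwartz functions on the half line and the space `L²((0,∞), dx/x)` -/

theorem exists_bound_eval_mul_exp (p : ℂ[X]) {w : ℂ} (hw : 0 < w.re) :
    ∃ C : ℝ, ∀ x ∈ Ici (0 : ℝ), ‖p.eval (x : ℂ) * Complex.exp (-(w * x))‖ ≤ C := by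
  have hexp : ∀ x : ℝ, ‖Complex.exp (-(w * x))‖ = Real.exp (-(w.re * x)) := by
    intro x; rw [Complex.norm_exp]; simp
  induction p using Polynomial.induction_on' with
  | add p q hp hq =>
    obtain ⟨C, hC⟩ := hp
    obtain ⟨D, hD⟩ := hq
    refine ⟨C + D, fun x hx => ?_⟩
    rw [eval_add, add_mul]
    exact (norm_add_le _ _).trans (add_le_add (hC x hx) (hD x hx))
  | monomial n a =>
    -- With r = re w, the constant comes from (r x)^n / n! ≤ e^(r x), a single term of the
    -- exponential series.
    refine ⟨‖a‖ * (n.factorial / w.re ^ n), fun x hx => ?_⟩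
    have hx0 : (0 : ℝ) ≤ x := hx
    have h := Real.pow_div_factorial_le_exp (w.re * x) (by positivity) n
    rw [eval_monomial, norm_mul, norm_mul, hexp, mul_assoc]
    gcongr
    rw [norm_pow, Complex.norm_real, Real.norm_of_nonneg hx0, Real.exp_neg,
      ← div_eq_mul_inv, div_le_div_iff₀ (Real.exp_pos _) (by positivity)]
    rw [div_le_iff₀ (by positivity), mul_pow] at h
    linarith

/-- Differentiation replaces p by p' - w p, so all derivatives stay in the class of polynomials
times e^(-wx), and boundedness of that class suffices. -/
theorem isSchwartzHalfLine_eval_mul_exp (p : ℂ[X]) {w : ℂ} (hw : 0 < w.re) :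
    IsSchwartzHalfLine fun x : ℝ => p.eval (x : ℂ) * Complex.exp (-(w * x)) := by
  have hsm : ∀ q : ℂ[X], ContDiff ℝ ∞ fun x : ℝ => q.eval (x : ℂ) * Complex.exp (-(w * x)) := by
    intro q
    have h1 : ContDiff ℝ ∞ fun x : ℝ => (x : ℂ) := Complex.ofRealCLM.contDiff
    have h2 : ContDiff ℝ ∞ fun z : ℂ => q.eval z :=
      q.differentiable.contDiff.restrict_scalars ℝ
    exact (h2.comp h1).mul (contDiff_const.mul h1).neg.cexp
  have hder : ∀ q : ℂ[X], deriv (fun x : ℝ => q.eval (x : ℂ) * Complex.exp (-(w * x))) =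
      fun x : ℝ => (derivative q - C w * q).eval (x : ℂ) * Complex.exp (-(w * x)) := by
    intro q
    ext x
    have h1 : HasDerivAt (fun x : ℝ => q.eval (x : ℂ)) ((derivative q).eval (x : ℂ)) x :=
      (q.hasDerivAt (x : ℂ)).comp_ofReal
    have h2 : HasDerivAt (fun x : ℝ => Complex.exp (-(w * x)))
        (Complex.exp (-(w * x)) * (-(w * 1))) x :=
      (((Complex.ofRealCLM.hasDerivAt (x := x)).const_mul w).neg).cexp
    refine (h1.mul h2).deriv.trans ?_
    simp only [eval_sub, eval_mul, eval_C]
    ring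
  have hit : ∀ (n : ℕ) (q : ℂ[X]), ∃ r : ℂ[X],
      iteratedDeriv n (fun x : ℝ => q.eval (x : ℂ) * Complex.exp (-(w * x))) =
      fun x : ℝ => r.eval (x : ℂ) * Complex.exp (-(w * x)) := by
    intro n
    induction n with
    | zero => exact fun q => ⟨q, iteratedDeriv_zero⟩
    | succ n ih =>
      intro q
      rw [iteratedDeriv_succ', hder]
      exact ih _
  refine ⟨(hsm p).contDiffOn, fun k n => ?_⟩
  obtain ⟨r, hr⟩ := hit n p
  obtain ⟨C, hC⟩ := exists_bound_eval_mul_exp (X ^ k * r) hw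
  refine ⟨C, fun x hx => ?_⟩
  have hle : ((n : ℕ∞) : WithTop ℕ∞) ≤ ∞ := by exact_mod_cast le_top
  rw [iteratedDerivWithin_eq_iteratedDeriv (uniqueDiffOn_Ici 0)
    ((hsm p).contDiffAt.of_le hle) hx, hr]
  refine le_trans (le_of_eq ?_) (hC x hx)
  have hx0 : (0 : ℝ) ≤ x := hx
  simp only [eval_mul, eval_pow, eval_X, norm_mul, norm_pow, Complex.norm_real,
    Real.norm_of_nonneg hx0]
  ring

/-- The function `x^((d+1)/2) f(x)` on `[0,∞)`, extended by zero. -/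
def weighted (d : ℕ) (f : ℝ → ℂ) : ℝ → ℂ :=
  (Ici (0 : ℝ)).indicator fun x => ((x ^ (((d : ℝ) + 1) / 2) : ℝ) : ℂ) * f x

theorem weighted_mem {d : ℕ} {f : ℝ → ℂ} (hf : IsSchwartzHalfLine f) :
    weighted d f ∈ schwartzD d := ⟨f, hf, rfl⟩

theorem weighted_of_pos {d : ℕ} {f : ℝ → ℂ} {x : ℝ} (hx : 0 < x) :
    weighted d f x = ((x ^ (((d : ℝ) + 1) / 2) : ℝ) : ℂ) * f x :=
  indicator_of_mem (show x ∈ Ici (0 : ℝ) from hx.le) _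

theorem restrict_absolutelyContinuous_mulMeasure :
    volume.restrict (Ioi (0 : ℝ)) ≪ mulMeasure := by
  refine withDensity_absolutelyContinuous' (by fun_prop) ?_
  refine (ae_restrict_iff' measurableSet_Ioi).2 (ae_of_all _ fun x hx => ?_)
  simpa using hx

theorem ae_mulMeasure_iff {P : ℝ → Prop} :
    (∀ᵐ x ∂mulMeasure, P x) ↔ ∀ᵐ x ∂volume.restrict (Ioi (0 : ℝ)), P x := by
  have h1 : mulMeasure ≪ volume.restrict (Ioi (0 : ℝ)) := withDensity_absolutelyContinuous _ _
  exact ⟨fun h => restrict_absolutelyContinuous_mulMeasure.ae_le h, fun h => h1.ae_le h⟩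

theorem ae_mulMeasure_iff' {P : ℝ → Prop} :
    (∀ᵐ x ∂mulMeasure, P x) ↔ ∀ᵐ x : ℝ, 0 < x → P x := by
  rw [ae_mulMeasure_iff, ae_restrict_iff' measurableSet_Ioi]; rfl

theorem integral_mulMeasure (f : ℝ → ℂ) :
    ∫ x, f x ∂mulMeasure = ∫ x in Ioi (0 : ℝ), ((x⁻¹ : ℝ) : ℂ) * f x := by
  rw [mulMeasure, integral_withDensity_eq_integral_toReal_smul (by fun_prop)
    (ae_of_all _ fun x => ENNReal.ofReal_lt_top)]
  refine setIntegral_congr_fun measurableSet_Ioi fun x hx => ?_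
  have hx0 : (0 : ℝ) < x := hx
  simp only [ENNReal.toReal_ofReal (inv_nonneg.2 hx0.le), Complex.real_smul]

theorem integrable_mulMeasure_iff {E : Type*} [NormedAddCommGroup E] [NormedSpace ℝ E]
    (f : ℝ → E) :
    Integrable f mulMeasure ↔ IntegrableOn (fun x => x⁻¹ • f x) (Ioi (0 : ℝ)) := by
  rw [mulMeasure, integrable_withDensity_iff_integrable_smul' (by fun_prop)
    (ae_of_all _ fun x => ENNReal.ofReal_lt_top)]
  refine integrableOn_congr_fun (fun x hx => ?_) measurableSet_Ioi
  have hx0 : (0 : ℝ) < x := hx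
  simp only [ENNReal.toReal_ofReal (inv_nonneg.2 hx0.le)]

theorem rpow_half_add {d : ℕ} {x : ℝ} (hx : 0 < x) :
    x ^ (((d : ℝ) + 1) / 2) = x * x ^ (((d : ℝ) - 1) / 2) := by
  rw [← Real.rpow_one_add' hx.le]
  · congr 1; ring
  · intro h
    have : (0 : ℝ) < (d : ℝ) + 1 := by positivity
    linarith

theorem rpow_half_mul {d : ℕ} {x : ℝ} (hx : 0 < x) :
    x ^ (((d : ℝ) - 1) / 2) * x ^ (((d : ℝ) + 1) / 2) = x ^ d := by
  rw [← Real.rpow_add hx, ← Real.rpow_natCast]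
  congr 1; ring

/-- The weight absorbs the measure: |x^((d+1)/2) f|² / x = x^d |f|². One factor |f| is bounded, and
the other supplies the decay 1/(1+x²). -/
theorem memLp_weighted {d : ℕ} {f : ℝ → ℂ} (hf : IsSchwartzHalfLine f) :
    MemLp (weighted d f) 2 mulMeasure := by
  have hcont : ContinuousOn f (Ioi 0) := hf.1.continuousOn.mono Ioi_subset_Ici_self
  obtain ⟨A, hA⟩ := hf.2 0 0
  obtain ⟨C, hC⟩ := hf.2 d 0
  obtain ⟨D, hD⟩ := hf.2 (d + 2) 0
  simp only [iteratedDerivWithin_zero, pow_zero, one_mul] at hA hC hD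
  have hmeas : AEStronglyMeasurable (weighted d f) mulMeasure := by
    refine AEStronglyMeasurable.mono_ac (withDensity_absolutelyContinuous _ _) ?_
    have : ContinuousOn (fun x : ℝ => ((x ^ (((d : ℝ) + 1) / 2) : ℝ) : ℂ) * f x) (Ioi 0) := by
      refine ContinuousOn.mul ?_ hcont
      exact Complex.continuous_ofReal.comp_continuousOn
        (continuousOn_id.rpow_const fun x hx => Or.inl (ne_of_gt hx))
    refine (this.aestronglyMeasurable measurableSet_Ioi).congr ?_
    refine (ae_restrict_iff' measurableSet_Ioi).2 (ae_of_all _ fun x hx => ?_)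
    exact (weighted_of_pos hx).symm
  rw [memLp_two_iff_integrable_sq_norm hmeas, integrable_mulMeasure_iff]
  have hbound : IntegrableOn (fun x : ℝ => A * (C + D) * (1 + x ^ 2)⁻¹) (Ioi 0) :=
    (integrable_inv_one_add_sq.const_mul _).integrableOn
  refine Integrable.mono' hbound ?_ ?_
  · have hinv : AEStronglyMeasurable (fun x : ℝ => x⁻¹) (volume.restrict (Ioi 0)) :=
      Measurable.aestronglyMeasurable (by fun_prop)
    refine hinv.smul (AEStronglyMeasurable.pow (AEStronglyMeasurable.norm ?_) 2)
    exact hmeas.mono_ac restrict_absolutelyContinuous_mulMeasure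
  · refine (ae_restrict_iff' measurableSet_Ioi).2 (ae_of_all _ fun x hx => ?_)
    have hx0 : (0 : ℝ) < x := hx
    have h1 := hC x hx0.le
    have h2 := hD x hx0.le
    have h0 := hA x hx0.le
    have e : x⁻¹ * (x ^ (((d : ℝ) + 1) / 2)) ^ 2 = x ^ d := by
      rw [← rpow_half_mul hx0, rpow_half_add hx0]; field_simp
    rw [weighted_of_pos hx0, smul_eq_mul, norm_mul, norm_mul, norm_pow, norm_mul, norm_norm,
      norm_norm, Complex.norm_real, Real.norm_of_nonneg (Real.rpow_nonneg hx0.le _),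
      Real.norm_of_nonneg (inv_nonneg.2 hx0.le), mul_pow, ← mul_assoc, e,
      ← div_eq_mul_inv, le_div_iff₀ (by positivity)]
    calc _ = ‖f x‖ * (x ^ d * ‖f x‖ + x ^ (d + 2) * ‖f x‖) := by ring
      _ ≤ A * (C + D) := by
        gcongr
        exact (norm_nonneg _).trans h0

theorem memLp_of_mem_schwartzD {d : ℕ} {f : ℝ → ℂ} (hf : f ∈ schwartzD d) :
    MemLp f 2 mulMeasure := by
  obtain ⟨f₁, hf₁, rfl⟩ := hf
  exact memLp_weighted hf₁

/-- Pairing with `x^((d+1)/2) f(x)` in `L²((0,∞), dx/x)`. -/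
theorem integrable_weighted_pairing {d : ℕ} {f : ℝ → ℂ} (hf : IsSchwartzHalfLine f)
    (F : KirillovSpace) : IntegrableOn (fun x : ℝ => ((x ^ (((d : ℝ) - 1) / 2) : ℝ) : ℂ) * F x *
      (starRingEnd ℂ) (f x)) (Ioi 0) := by
  have h := L2.integrable_inner (𝕜 := ℂ) ((memLp_weighted (d := d) hf).toLp _) F
  rw [integrable_mulMeasure_iff] at h
  refine h.congr ?_
  have h1 := ae_mulMeasure_iff.1 (memLp_weighted (d := d) hf).coeFn_toLp
  filter_upwards [h1, ae_restrict_mem measurableSet_Ioi] with x hx hx0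
  have hx0 : (0 : ℝ) < x := hx0
  rw [hx, weighted_of_pos hx0, rpow_half_add hx0]
  simp only [RCLike.inner_apply, Complex.real_smul, map_mul, Complex.conj_ofReal]
  have : (x : ℂ) ≠ 0 := by exact_mod_cast hx0.ne'
  push_cast
  field_simp

theorem inner_weighted {d : ℕ} {f : ℝ → ℂ} (hf : IsSchwartzHalfLine f) (F : KirillovSpace) :
    inner ℂ ((memLp_weighted (d := d) hf).toLp _) F =
      ∫ x in Ioi (0 : ℝ), ((x ^ (((d : ℝ) - 1) / 2) : ℝ) : ℂ) * F x * (starRingEnd ℂ) (f x) := by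
  rw [L2.inner_def, integral_mulMeasure]
  refine integral_congr_ae ?_
  have h1 := ae_mulMeasure_iff.1 (memLp_weighted (d := d) hf).coeFn_toLp
  filter_upwards [h1, ae_restrict_mem measurableSet_Ioi] with x hx hx0
  have hx0 : (0 : ℝ) < x := hx0
  rw [hx, weighted_of_pos hx0, rpow_half_add hx0]
  simp only [RCLike.inner_apply, map_mul, Complex.conj_ofReal]
  have : (x : ℂ) ≠ 0 := by exact_mod_cast hx0.ne'
  push_cast
  field_simp

/-! ## Integration by parts on the half line -/

theorem IsSchwartzHalfLine.derivWithin {f : ℝ → ℂ} (hf : IsSchwartzHalfLine f) :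
    IsSchwartzHalfLine (derivWithin f (Ici 0)) := by
  refine ⟨hf.1.derivWithin (uniqueDiffOn_Ici 0) (by simp), fun k n => ?_⟩
  obtain ⟨C, hC⟩ := hf.2 k (n + 1)
  refine ⟨C, fun x hx => ?_⟩
  rw [← iteratedDerivWithin_succ']
  exact hC x hx

theorem IsSchwartzHalfLine.hasDerivWithinAt {f : ℝ → ℂ} (hf : IsSchwartzHalfLine f) {x : ℝ}
    (hx : x ∈ Ici (0 : ℝ)) :
    HasDerivWithinAt f (_root_.derivWithin f (Ici 0) x) (Ici 0) x :=
  ((hf.1 x hx).differentiableWithinAt (by simp)).hasDerivWithinAt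

theorem IsSchwartzHalfLine.hasDerivAt {f : ℝ → ℂ} (hf : IsSchwartzHalfLine f) {x : ℝ}
    (hx : 0 < x) : HasDerivAt f (_root_.derivWithin f (Ici 0) x) x :=
  (hf.hasDerivWithinAt hx.le).hasDerivAt (Ici_mem_nhds hx)

theorem derivWithin_id_mul {f : ℝ → ℂ} (hf : IsSchwartzHalfLine f) {x : ℝ}
    (hx : x ∈ Ici (0 : ℝ)) : _root_.derivWithin (fun x : ℝ => (x : ℂ) * f x) (Ici 0) x =
      f x + x * _root_.derivWithin f (Ici 0) x := by
  have h := ((Complex.ofRealCLM.hasDerivAt (x := x)).hasDerivWithinAt (s := Ici 0)).mul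
    (hf.hasDerivWithinAt hx)
  refine (h.derivWithin (uniqueDiffOn_Ici 0 x hx)).trans ?_
  simp

theorem contDiffOn_id_mul {f : ℝ → ℂ} (hf : ContDiffOn ℝ ∞ f (Ici 0)) :
    ContDiffOn ℝ ∞ (fun x : ℝ => (x : ℂ) * f x) (Ici 0) :=
  Complex.ofRealCLM.contDiff.contDiffOn.mul hf

theorem IsSchwartzHalfLine.id_mul {f : ℝ → ℂ} (hf : IsSchwartzHalfLine f) :
    IsSchwartzHalfLine (fun x : ℝ => (x : ℂ) * f x) := by
  refine ⟨contDiffOn_id_mul hf.1, fun k n => ?_⟩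
  induction n generalizing f with
  | zero =>
    obtain ⟨C, hC⟩ := hf.2 (k + 1) 0
    refine ⟨C, fun x hx => (le_of_eq ?_).trans (hC x hx)⟩
    have hx0 : (0 : ℝ) ≤ x := hx
    simp only [iteratedDerivWithin_zero, norm_mul, Complex.norm_real, Real.norm_of_nonneg hx0]
    ring
  | succ n ih =>
    obtain ⟨C, hC⟩ := hf.2 k n
    obtain ⟨D, hD⟩ := ih hf.derivWithin
    refine ⟨C + D, fun x hx => ?_⟩
    have hle : ((n : ℕ∞) : WithTop ℕ∞) ≤ ∞ := by exact_mod_cast le_top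
    have hx0 : (0 : ℝ) ≤ x := hx
    rw [iteratedDerivWithin_succ', iteratedDerivWithin_congr (fun y hy => derivWithin_id_mul hf hy) hx,
      iteratedDerivWithin_fun_add hx (uniqueDiffOn_Ici 0) ((hf.1 x hx).of_le hle)
        ((contDiffOn_id_mul hf.derivWithin.1 x hx).of_le hle)]
    calc _ ≤ x ^ k * (_ + _) := mul_le_mul_of_nonneg_left (norm_add_le _ _) (by positivity)
      _ ≤ C + D := by rw [mul_add]; exact add_le_add (hC x hx) (hD x hx)

theorem IsSchwartzHalfLine.pow_mul {f : ℝ → ℂ} (hf : IsSchwartzHalfLine f) (n : ℕ) :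
    IsSchwartzHalfLine (fun x : ℝ => (x : ℂ) ^ n * f x) := by
  induction n with
  | zero => simpa using hf
  | succ n ih => simpa only [pow_succ', mul_assoc] using ih.id_mul

theorem norm_exp_neg_mul_le_one {w : ℂ} (hw : 0 ≤ w.re) {x : ℝ} (hx : 0 ≤ x) :
    ‖Complex.exp (-(w * x))‖ ≤ 1 := by
  rw [Complex.norm_exp, Real.exp_le_one_iff]
  simpa using mul_nonneg hw hx

theorem IsSchwartzHalfLine.exists_bound {f : ℝ → ℂ} (hf : IsSchwartzHalfLine f) :
    ∃ C : ℝ, ∀ x ∈ Ici (0 : ℝ), ‖f x‖ ≤ C * (1 + x ^ 2)⁻¹ := by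
  obtain ⟨C, hC⟩ := hf.2 0 0
  obtain ⟨D, hD⟩ := hf.2 2 0
  simp only [iteratedDerivWithin_zero, pow_zero, one_mul] at hC hD
  refine ⟨C + D, fun x hx => ?_⟩
  rw [← div_eq_mul_inv, le_div_iff₀ (by positivity)]
  linarith [hC x hx, hD x hx]

theorem IsSchwartzHalfLine.integrableOn {f : ℝ → ℂ} (hf : IsSchwartzHalfLine f) :
    IntegrableOn f (Ioi 0) := by
  obtain ⟨C, hC⟩ := hf.exists_bound
  refine Integrable.mono' (integrable_inv_one_add_sq.const_mul C).integrableOn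
    ((hf.1.continuousOn.mono Ioi_subset_Ici_self).aestronglyMeasurable measurableSet_Ioi) ?_
  filter_upwards [ae_restrict_mem measurableSet_Ioi] with x hx
  exact hC x (Ioi_subset_Ici_self hx)

theorem IsSchwartzHalfLine.integrableOn_mul_exp {f : ℝ → ℂ} (hf : IsSchwartzHalfLine f) {w : ℂ}
    (hw : 0 ≤ w.re) : IntegrableOn (fun x : ℝ => f x * Complex.exp (-(w * x))) (Ioi 0) := by
  refine Integrable.mono hf.integrableOn ?_ ?_
  · exact hf.integrableOn.aestronglyMeasurable.mul
      (Continuous.aestronglyMeasurable (by fun_prop))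
  · filter_upwards [ae_restrict_mem measurableSet_Ioi] with x hx
    rw [norm_mul]
    exact mul_le_of_le_one_right (norm_nonneg _) (norm_exp_neg_mul_le_one hw (le_of_lt hx))

theorem IsSchwartzHalfLine.norm_integral_mul_exp_le {f : ℝ → ℂ} (hf : IsSchwartzHalfLine f)
    {w : ℂ} (hw : 0 ≤ w.re) :
    ‖∫ x in Ioi (0 : ℝ), f x * Complex.exp (-(w * x))‖ ≤ ∫ x in Ioi (0 : ℝ), ‖f x‖ := by
  refine (norm_integral_le_integral_norm _).trans ?_
  refine integral_mono_ae (hf.integrableOn_mul_exp hw).norm hf.integrableOn.norm ?_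
  filter_upwards [ae_restrict_mem measurableSet_Ioi] with x hx
  rw [norm_mul]
  exact mul_le_of_le_one_right (norm_nonneg _) (norm_exp_neg_mul_le_one hw (le_of_lt hx))

theorem IsSchwartzHalfLine.tendsto_zero {f : ℝ → ℂ} (hf : IsSchwartzHalfLine f) :
    Tendsto f atTop (𝓝 0) := by
  obtain ⟨C, hC⟩ := hf.2 1 0
  simp only [iteratedDerivWithin_zero, pow_one] at hC
  have h : Tendsto (fun x : ℝ => C * x⁻¹) atTop (𝓝 0) := by
    simpa using tendsto_inv_atTop_zero.const_mul C
  refine squeeze_zero_norm' ?_ h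
  filter_upwards [eventually_gt_atTop 0] with x hx
  rw [← div_eq_mul_inv, le_div_iff₀ hx, mul_comm]
  exact hC x hx.le

/-- Integration by parts. The case w = 0 is kept: it says that the integral of f' is -f(0), and
gives the recursion for the Gamma integrals. -/
theorem IsSchwartzHalfLine.mul_integral_mul_exp {f : ℝ → ℂ} (hf : IsSchwartzHalfLine f) {w : ℂ}
    (hw : 0 ≤ w.re) :
    w * ∫ x in Ioi (0 : ℝ), f x * Complex.exp (-(w * x)) =
      f 0 + ∫ x in Ioi (0 : ℝ), _root_.derivWithin f (Ici 0) x * Complex.exp (-(w * x)) := by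
  have h1 := hf.integrableOn_mul_exp hw
  have h2 := hf.derivWithin.integrableOn_mul_exp hw
  have hexp : ∀ x : ℝ, HasDerivAt (fun x : ℝ => Complex.exp (-(w * x)))
      (Complex.exp (-(w * x)) * (-(w * 1))) x := fun x =>
    (((Complex.ofRealCLM.hasDerivAt (x := x)).const_mul w).neg).cexp
  have key := integral_Ioi_of_hasDerivAt_of_tendsto (a := (0 : ℝ)) (m := 0)
    (f := fun x : ℝ => f x * Complex.exp (-(w * x)))
    (f' := fun x : ℝ => _root_.derivWithin f (Ici 0) x * Complex.exp (-(w * x)) -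
      w * (f x * Complex.exp (-(w * x)))) ?_ ?_ (h2.sub (h1.const_mul w)) ?_
  · rw [integral_sub h2 (h1.const_mul w), integral_const_mul] at key
    simp only [Complex.ofReal_zero, mul_zero, neg_zero, Complex.exp_zero, mul_one] at key
    linear_combination -key
  · exact (hf.1.continuousOn 0 (by simp)).mul (by fun_prop)
  · intro x hx
    convert! (hf.hasDerivAt hx).mul (hexp x) using 1
    ring
  · refine squeeze_zero_norm' ?_ (tendsto_zero_iff_norm_tendsto_zero.1 hf.tendsto_zero)
    filter_upwards [eventually_gt_atTop 0] with x hx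
    rw [norm_mul]
    exact mul_le_of_le_one_right (norm_nonneg _) (norm_exp_neg_mul_le_one hw hx.le)

theorem derivWithin_pow_mul {f : ℝ → ℂ} (hf : IsSchwartzHalfLine f) (n : ℕ) {x : ℝ}
    (hx : x ∈ Ici (0 : ℝ)) :
    _root_.derivWithin (fun x : ℝ => (x : ℂ) ^ (n + 1) * f x) (Ici 0) x =
      (x : ℂ) ^ n * ((n + 1) * f x + x * _root_.derivWithin f (Ici 0) x) := by
  have h := (((Complex.ofRealCLM.hasDerivAt (x := x)).pow (n + 1)).hasDerivWithinAt
    (s := Ici 0)).mul (hf.hasDerivWithinAt hx)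
  refine (h.derivWithin (uniqueDiffOn_Ici 0 x hx)).trans ?_
  simp; ring

/-- The Laplace transform of `x^n f(x)`, for `f` a Schwartz function on `[0,∞)`, is `O(|w|^(-n-1))`
on the closed right half plane. -/
theorem exists_pow_mul_norm_integral_le {f : ℝ → ℂ} (hf : IsSchwartzHalfLine f) (n : ℕ) :
    ∃ C : ℝ, ∀ w : ℂ, 0 ≤ w.re → ‖w‖ ^ (n + 1) *
      ‖∫ x in Ioi (0 : ℝ), (x : ℂ) ^ n * f x * Complex.exp (-(w * x))‖ ≤ C := by
  induction n generalizing f with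
  | zero =>
    refine ⟨‖f 0‖ + ∫ x in Ioi (0 : ℝ), ‖_root_.derivWithin f (Ici 0) x‖, fun w hw => ?_⟩
    simp only [zero_add, pow_one, pow_zero, one_mul]
    rw [← norm_mul, hf.mul_integral_mul_exp hw]
    exact (norm_add_le _ _).trans
      (add_le_add le_rfl (hf.derivWithin.norm_integral_mul_exp_le hw))
  | succ n ih =>
    -- The function x^(n+1) f vanishes at 0 and has derivative x^n times this g, so one integration
    -- by parts trades a power of x for a factor w without a boundary term.
    have hg : IsSchwartzHalfLine
        (fun x : ℝ => ((n : ℂ) + 1) * f x + x * _root_.derivWithin f (Ici 0) x) :=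
      (hf.const_smul ((n : ℂ) + 1)).add hf.derivWithin.id_mul
    obtain ⟨C, hC⟩ := ih hg
    refine ⟨C, fun w hw => (le_of_eq ?_).trans (hC w hw)⟩
    rw [pow_succ, mul_assoc, ← norm_mul, (hf.pow_mul (n + 1)).mul_integral_mul_exp hw]
    congr 2
    simp only [Complex.ofReal_zero, ne_eq, Nat.succ_ne_zero, not_false_eq_true, zero_pow, zero_mul,
      zero_add]
    refine setIntegral_congr_fun measurableSet_Ioi fun x hx => ?_
    simp only [derivWithin_pow_mul hf n (Ioi_subset_Ici_self hx)]

theorem isSchwartzHalfLine_exp {w : ℂ} (hw : 0 < w.re) :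
    IsSchwartzHalfLine fun x : ℝ => Complex.exp (-(w * x)) := by
  simpa using isSchwartzHalfLine_eval_mul_exp 1 hw

theorem integral_pow_mul_exp (n : ℕ) {w : ℂ} (hw : 0 < w.re) :
    ∫ x in Ioi (0 : ℝ), (x : ℂ) ^ n * Complex.exp (-(w * x)) = n.factorial / w ^ (n + 1) := by
  have hw0 : w ≠ 0 := by rintro rfl; simp at hw
  have hder : ∀ x ∈ Ici (0 : ℝ), _root_.derivWithin (fun x : ℝ => Complex.exp (-(w * x))) (Ici 0) x =
      Complex.exp (-(w * x)) * (-(w * 1)) := fun x hx =>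
    (((Complex.ofRealCLM.hasDerivAt (x := x)).const_mul w).neg).cexp.hasDerivWithinAt.derivWithin
      (uniqueDiffOn_Ici 0 x hx)
  have hs := isSchwartzHalfLine_exp hw
  induction n with
  | zero =>
    -- The exponential is part of the Schwartz function here; the parameter of the integration by
    -- parts is 0.
    have := hs.mul_integral_mul_exp (w := 0) (by simp)
    simp only [zero_mul, Complex.ofReal_zero, mul_zero, neg_zero, Complex.exp_zero, mul_one] at this
    rw [setIntegral_congr_fun measurableSet_Ioi
      (fun x hx => hder x (Ioi_subset_Ici_self hx)), integral_mul_const] at this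
    simp only [pow_zero, one_mul, Nat.factorial_zero, Nat.cast_one, zero_add, pow_one]
    field_simp
    linear_combination this
  | succ n ih =>
    have := (hs.pow_mul (n + 1)).mul_integral_mul_exp (w := 0) (by simp)
    simp only [zero_mul, Complex.ofReal_zero, mul_zero, neg_zero, Complex.exp_zero, mul_one,
      ne_eq, Nat.succ_ne_zero, not_false_eq_true, zero_pow, zero_add] at this
    have e : ∫ x in Ioi (0 : ℝ), _root_.derivWithin
        (fun x : ℝ => (x : ℂ) ^ (n + 1) * Complex.exp (-(w * x))) (Ici 0) x =
        ∫ x in Ioi (0 : ℝ), ((n + 1) * ((x : ℂ) ^ n * Complex.exp (-(w * x))) -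
          w * ((x : ℂ) ^ (n + 1) * Complex.exp (-(w * x)))) := by
      refine setIntegral_congr_fun measurableSet_Ioi fun x hx => ?_
      have hx' : x ∈ Ici (0 : ℝ) := Ioi_subset_Ici_self hx
      simp only [derivWithin_pow_mul hs n hx', hder x hx']
      ring
    rw [e, integral_sub ((hs.pow_mul n).integrableOn.const_mul _)
      ((hs.pow_mul (n + 1)).integrableOn.const_mul _), integral_const_mul, integral_const_mul,
      ih] at this
    rw [eq_div_iff (pow_ne_zero _ hw0), Nat.factorial_succ]
    push_cast
    have h2 : ((n : ℂ) + 1) * (n.factorial / w ^ (n + 1)) * w ^ (n + 1) =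
        (n + 1) * n.factorial := by
      field_simp
    rw [← h2]
    linear_combination w ^ (n + 1) * this

/-! ## The vectors `x^((d+1)/2) e^(-w x)` and the Laplace transform -/

/-- The class of `x^((d+1)/2) e^(-w x)` in `L²((0,∞), dx/x)`, for `0 < re w`. -/
def expVec (d : ℕ) (w : ℂ) : KirillovSpace :=
  if h : 0 < w.re then (memLp_weighted (d := d) (isSchwartzHalfLine_exp h)).toLp _ else 0

/-- The Laplace transform `∫₀^∞ x^((d-1)/2) F(x) e^(-w x) dx`. -/
def laplace (d : ℕ) (F : ℝ → ℂ) (w : ℂ) : ℂ :=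
  ∫ x in Ioi (0 : ℝ), ((x ^ (((d : ℝ) - 1) / 2) : ℝ) : ℂ) * F x * Complex.exp (-(w * x))

theorem expVec_ae {d : ℕ} {w : ℂ} (hw : 0 < w.re) :
    expVec d w =ᵐ[mulMeasure] weighted d fun x : ℝ => Complex.exp (-(w * x)) := by
  rw [expVec, dif_pos hw]
  exact MemLp.coeFn_toLp _

theorem conj_exp (w : ℂ) (x : ℝ) : (starRingEnd ℂ) (Complex.exp (-((starRingEnd ℂ) w * x))) =
    Complex.exp (-(w * x)) := by
  rw [← Complex.exp_conj]; simp

theorem integrable_laplace {d : ℕ} {w : ℂ} (hw : 0 < w.re) (F : KirillovSpace) :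
    IntegrableOn (fun x : ℝ => ((x ^ (((d : ℝ) - 1) / 2) : ℝ) : ℂ) * F x *
      Complex.exp (-(w * x))) (Ioi 0) := by
  have hw' : 0 < ((starRingEnd ℂ) w).re := by simpa using hw
  simpa only [conj_exp] using integrable_weighted_pairing (d := d) (isSchwartzHalfLine_exp hw') F

/-- Makes evaluation of the Laplace transform a bounded functional. The conjugate appears because
the inner product is conjugate linear in its first argument. -/
theorem inner_expVec {d : ℕ} {w : ℂ} (hw : 0 < w.re) (F : KirillovSpace) :
    inner ℂ (expVec d ((starRingEnd ℂ) w)) F = laplace d F w := by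
  have hw' : 0 < ((starRingEnd ℂ) w).re := by simpa using hw
  rw [expVec, dif_pos hw', inner_weighted (isSchwartzHalfLine_exp hw')]
  simp only [conj_exp, laplace]

theorem laplace_congr {d : ℕ} {F G : ℝ → ℂ} (h : F =ᵐ[mulMeasure] G) (w : ℂ) :
    laplace d F w = laplace d G w := by
  refine integral_congr_ae ?_
  filter_upwards [ae_mulMeasure_iff.1 h] with x hx
  rw [hx]

theorem laplace_weighted {d : ℕ} (f : ℝ → ℂ) (w : ℂ) :
    laplace d (weighted d f) w =
      ∫ x in Ioi (0 : ℝ), (x : ℂ) ^ d * f x * Complex.exp (-(w * x)) := by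
  refine setIntegral_congr_fun measurableSet_Ioi fun x hx => ?_
  have hx0 : (0 : ℝ) < x := hx
  simp only [weighted_of_pos hx0, ← mul_assoc]
  rw [← Complex.ofReal_mul, rpow_half_mul hx0, Complex.ofReal_pow]

theorem laplace_expVec {d : ℕ} {v w : ℂ} (hv : 0 < v.re) (hw : 0 < w.re) :
    laplace d (expVec d v) w = d.factorial / (v + w) ^ (d + 1) := by
  rw [laplace_congr (expVec_ae hv), laplace_weighted,
    ← integral_pow_mul_exp d (show 0 < (v + w).re by simp; linarith)]
  refine setIntegral_congr_fun measurableSet_Ioi fun x hx => ?_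
  simp only [mul_assoc, ← Complex.exp_add]
  congr 2; ring

/-- This reproducing kernel, of Bergman type, is the only information on the vectors `expVec` needed
to construct the unitary action. -/
theorem inner_expVec_expVec {d : ℕ} {v w : ℂ} (hv : 0 < v.re) (hw : 0 < w.re) :
    inner ℂ (expVec d v) (expVec d w) = d.factorial / ((starRingEnd ℂ) v + w) ^ (d + 1) := by
  have := inner_expVec (d := d) (w := (starRingEnd ℂ) v) (by simpa using hv) (expVec d w)
  rw [Complex.conj_conj] at this
  rw [this, laplace_expVec hw (by simpa using hv), add_comm]

/-- On the single line Re w = 1 the Laplace transform is the Fourier transform of the integrable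
function x^((d-1)/2) F(x) e^(-x), which determines F. -/
theorem eq_zero_of_laplace_eq_zero {d : ℕ} {F : KirillovSpace}
    (h : ∀ w : ℂ, w.re = 1 → laplace d F w = 0) : F = 0 := by
  set u : ℝ → ℂ := (Ioi (0 : ℝ)).indicator fun x =>
    ((x ^ (((d : ℝ) - 1) / 2) : ℝ) : ℂ) * F x * Complex.exp (-((1 : ℂ) * x)) with hu
  have hi : Integrable u :=
    (integrable_indicator_iff measurableSet_Ioi).2 (integrable_laplace (by simp) F)
  have h0 : u =ᵐ[volume] 0 := by
    refine ae_eq_zero_of_integral_exp_eq_zero hi fun ξ => ?_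
    rw [← h (1 - Complex.I * ξ) (by simp), laplace, ← integral_indicator measurableSet_Ioi]
    congr 1; ext x
    by_cases hx : x ∈ Ioi (0 : ℝ)
    · simp only [hu, indicator_of_mem hx, mul_assoc, ← Complex.exp_add]
      congr 3; ring
    · simp only [hu, indicator_of_notMem hx, zero_mul]
  rw [Lp.eq_zero_iff_ae_eq_zero]
  refine ae_mulMeasure_iff'.2 ?_
  filter_upwards [h0] with x hx hx0
  simp only [hu, indicator_of_mem (show x ∈ Ioi (0 : ℝ) from hx0), Pi.zero_apply, mul_eq_zero,
    Complex.exp_ne_zero, or_false, Complex.ofReal_eq_zero] at hx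
  exact hx.resolve_left (Real.rpow_pos_of_pos hx0 _).ne'

theorem ext_laplace {d : ℕ} {F G : KirillovSpace}
    (h : ∀ w : ℂ, 0 < w.re → laplace d F w = laplace d G w) : F = G := by
  rw [← sub_eq_zero]
  refine eq_zero_of_laplace_eq_zero (d := d) fun w hw => ?_
  have hw' : 0 < w.re := by rw [hw]; exact one_pos
  rw [← inner_expVec hw', inner_sub_right, inner_expVec hw', inner_expVec hw', h w hw', sub_self]

/-- The open right half plane. -/
abbrev RightHalfPlane := {w : ℂ // 0 < w.re}

/-- Finite linear combinations of the vectors `expVec d w`. -/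
def expComb (d : ℕ) : (RightHalfPlane →₀ ℂ) →ₗ[ℂ] KirillovSpace :=
  Finsupp.linearCombination ℂ fun w : RightHalfPlane => expVec d w

/-- A vector orthogonal to all `expVec` has vanishing Laplace transform. -/
theorem denseRange_expComb (d : ℕ) : DenseRange (expComb d) := by
  have h : (LinearMap.range (expComb d)).topologicalClosure = ⊤ := by
    rw [Submodule.topologicalClosure_eq_top_iff, Submodule.eq_bot_iff]
    intro F hF
    refine ext_laplace (d := d) fun w hw => ?_
    rw [← inner_expVec hw, ← inner_expVec hw, inner_zero_right]
    have hw' : 0 < ((starRingEnd ℂ) w).re := by simpa using hw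
    refine (Submodule.mem_orthogonal _ _).1 hF _ ⟨Finsupp.single ⟨_, hw'⟩ 1, ?_⟩
    simp [expComb]
  rw [DenseRange, dense_iff_closure_eq]
  have := congrArg (fun S : Submodule ℂ KirillovSpace => (S : Set KirillovSpace)) h
  rwa [Submodule.topologicalClosure_coe, LinearMap.coe_range, Submodule.top_coe] at this

theorem eq_of_expVec {d : ℕ} {A B : KirillovSpace → KirillovSpace} (hA : Continuous A)
    (hB : Continuous B) (hA' : IsLinearMap ℂ A) (hB' : IsLinearMap ℂ B)
    (h : ∀ w : ℂ, 0 < w.re → A (expVec d w) = B (expVec d w)) : A = B := by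
  refine (denseRange_expComb d).equalizer hA hB ?_
  have : (hA'.mk' A).comp (expComb d) = (hB'.mk' B).comp (expComb d) := by
    refine Finsupp.lhom_ext' fun w => LinearMap.ext_ring ?_
    simpa [expComb] using h w w.2
  exact congrArg DFunLike.coe this

/-! ## The unitary operators attached to the elements of `SL(2, ℝ)` -/

/-- The automorphy factor of the action of `SL(2, ℝ)` on the right half plane. -/
def autFactor (g : SL(2, ℝ)) (v : ℂ) : ℂ := g 1 1 + Complex.I * g 1 0 * v

/-- The action of `SL(2, ℝ)` on the right half plane by fractional linear transformations. -/
def moeb (g : SL(2, ℝ)) (v : ℂ) : ℂ := (g 0 0 * v - Complex.I * g 0 1) / autFactor g v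

theorem det_eq_complex (g : SL(2, ℝ)) : (g 0 0 : ℂ) * g 1 1 - g 0 1 * g 1 0 = 1 := by
  exact_mod_cast det_eq g

theorem autFactor_ne_zero (g : SL(2, ℝ)) {v : ℂ} (hv : 0 < v.re) : autFactor g v ≠ 0 := by
  intro h
  have h1 := congrArg Complex.im h
  have h2 := congrArg Complex.re h
  simp [autFactor] at h1 h2
  have h3 := det_eq g
  rcases h1 with h1 | h1
  · rw [h1] at h2 h3
    simp at h2
    rw [h2] at h3
    simp at h3
  · exact hv.ne' h1

/-- In the upper half plane coordinate z = i v the factor is r z + s and the action is z ↦ (p z +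
q)/(r z + s); this is the usual cocycle identity. -/
theorem autFactor_mul (g k : SL(2, ℝ)) {v : ℂ} (hv : 0 < v.re) :
    autFactor (g * k) v = autFactor g (moeb k v) * autFactor k v := by
  have h := autFactor_ne_zero k hv
  have e : autFactor g (moeb k v) * autFactor k v =
      g 1 1 * autFactor k v + Complex.I * g 1 0 * (k 0 0 * v - Complex.I * k 0 1) := by
    rw [moeb]; conv_lhs => rw [autFactor]
    field_simp
  rw [e]
  simp only [autFactor, Matrix.SpecialLinearGroup.coe_mul, Matrix.mul_apply, Fin.sum_univ_two]
  push_cast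
  linear_combination ((g 1 0 : ℂ) * k 0 1) * Complex.I_sq

/-- A consequence of det g = 1. It gives the covariance of the Gram kernel, and for v = w it shows
that the half plane is preserved. -/
theorem moeb_add (g : SL(2, ℝ)) {v w : ℂ} (hv : 0 < v.re) (hw : 0 < w.re) :
    (starRingEnd ℂ) (moeb g v) + moeb g w =
      ((starRingEnd ℂ) v + w) / ((starRingEnd ℂ) (autFactor g v) * autFactor g w) := by
  have h1 := autFactor_ne_zero g hv
  have h2 := autFactor_ne_zero g hw
  have h3 : (starRingEnd ℂ) (autFactor g v) ≠ 0 := by simpa using h1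
  rw [moeb, moeb, map_div₀, div_add_div _ _ h3 h2]
  congr 1
  simp only [autFactor, map_add, map_sub, map_mul, Complex.conj_ofReal, Complex.conj_I]
  linear_combination ((starRingEnd ℂ) v + w) * det_eq_complex g
    + (g 0 1 * g 1 0 * ((starRingEnd ℂ) v + w)) * Complex.I_sq

theorem moeb_re_pos (g : SL(2, ℝ)) {v : ℂ} (hv : 0 < v.re) : 0 < (moeb g v).re := by
  have h := moeb_add g hv hv
  have h1 := autFactor_ne_zero g hv
  rw [add_comm, Complex.add_conj, add_comm, Complex.add_conj, ← Complex.normSq_eq_conj_mul_self,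
    ← Complex.ofReal_div, Complex.ofReal_inj] at h
  have : 0 < Complex.normSq (autFactor g v) := Complex.normSq_pos.2 h1
  have h2 : 0 < 2 * v.re / Complex.normSq (autFactor g v) := by positivity
  linarith

theorem moeb_mul (g k : SL(2, ℝ)) {v : ℂ} (hv : 0 < v.re) :
    moeb (g * k) v = moeb g (moeb k v) := by
  have h := autFactor_ne_zero k hv
  have h' := autFactor_ne_zero g (moeb_re_pos k hv)
  rw [moeb, autFactor_mul g k hv, div_eq_iff (mul_ne_zero h' h)]
  conv_rhs => rw [moeb, ← mul_assoc, div_mul_cancel₀ _ h', moeb]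
  rw [sub_mul, mul_assoc, div_mul_cancel₀ _ h]
  simp only [autFactor, Matrix.SpecialLinearGroup.coe_mul, Matrix.mul_apply, Fin.sum_univ_two]
  push_cast
  linear_combination (g 0 1 * k 1 0 * v : ℂ) * Complex.I_sq

/-- The norm of a finite combination depends only on the Gram matrix, so matching Gram matrices
define an isometry even when the vectors are linearly dependent. -/
theorem norm_linearCombination_eq {ι H : Type*} [NormedAddCommGroup H] [InnerProductSpace ℂ H]
    {a b : ι → H} (h : ∀ i j, inner ℂ (a i) (a j) = inner ℂ (b i) (b j)) (c : ι →₀ ℂ) :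
    ‖Finsupp.linearCombination ℂ a c‖ = ‖Finsupp.linearCombination ℂ b c‖ := by
  have : inner ℂ (Finsupp.linearCombination ℂ a c) (Finsupp.linearCombination ℂ a c) =
      inner ℂ (Finsupp.linearCombination ℂ b c) (Finsupp.linearCombination ℂ b c) := by
    simp only [Finsupp.linearCombination_apply, Finsupp.sum, sum_inner, inner_sum, inner_smul_left,
      inner_smul_right, h]
  rw [@norm_eq_sqrt_re_inner ℂ, @norm_eq_sqrt_re_inner ℂ, this]

/-- The image of `expVec d v` under `g`. -/
def actExp (d : ℕ) (g : SL(2, ℝ)) (v : ℂ) : KirillovSpace :=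
  (autFactor g v ^ (d + 1))⁻¹ • expVec d (moeb g v)

/-- The two automorphy factors produced by `moeb_add` cancel against those in `actExp`. -/
theorem inner_actExp {d : ℕ} (g : SL(2, ℝ)) {v w : ℂ} (hv : 0 < v.re) (hw : 0 < w.re) :
    inner ℂ (actExp d g v) (actExp d g w) = inner ℂ (expVec d v) (expVec d w) := by
  have h1 := autFactor_ne_zero g hv
  have h2 := autFactor_ne_zero g hw
  have h3 : (starRingEnd ℂ) (autFactor g v) ≠ 0 := by simpa using h1
  rw [actExp, actExp, inner_smul_left, inner_smul_right,
    inner_expVec_expVec (moeb_re_pos g hv) (moeb_re_pos g hw), inner_expVec_expVec hv hw,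
    moeb_add g hv hw, map_inv₀, map_pow, div_pow, mul_pow]
  field_simp

/-- The unitary operator on `L²((0,∞), dx/x)` defined by `g`. -/
def kirillovOp (d : ℕ) (g : SL(2, ℝ)) : KirillovSpace →L[ℂ] KirillovSpace :=
  (Finsupp.linearCombination ℂ fun w : RightHalfPlane => actExp d g w).extendOfNorm (expComb d)

theorem norm_actExp_comb (d : ℕ) (g : SL(2, ℝ)) (c : RightHalfPlane →₀ ℂ) :
    ‖Finsupp.linearCombination ℂ (fun w : RightHalfPlane => actExp d g w) c‖ =
      ‖expComb d c‖ :=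
  norm_linearCombination_eq (fun v w => inner_actExp g v.2 w.2) c

/-- The norm identity provides the bound, with constant 1, under which `extendOfNorm` really extends
the map. -/
theorem kirillovOp_expComb (d : ℕ) (g : SL(2, ℝ)) (c : RightHalfPlane →₀ ℂ) :
    kirillovOp d g (expComb d c) =
      Finsupp.linearCombination ℂ (fun w : RightHalfPlane => actExp d g w) c :=
  LinearMap.extendOfNorm_eq (denseRange_expComb d)
    ⟨1, fun c => by rw [norm_actExp_comb, one_mul]⟩ c

theorem kirillovOp_expVec (d : ℕ) (g : SL(2, ℝ)) {w : ℂ} (hw : 0 < w.re) :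
    kirillovOp d g (expVec d w) = actExp d g w := by
  simpa [expComb] using kirillovOp_expComb d g (Finsupp.single ⟨w, hw⟩ 1)

theorem norm_kirillovOp (d : ℕ) (g : SL(2, ℝ)) (F : KirillovSpace) :
    ‖kirillovOp d g F‖ = ‖F‖ := by
  have : (fun F => ‖kirillovOp d g F‖) = fun F => ‖F‖ := by
    refine (denseRange_expComb d).equalizer (by fun_prop) (by fun_prop) ?_
    ext c
    simp only [Function.comp_apply, kirillovOp_expComb, norm_actExp_comb]
  exact congrFun this F

theorem kirillovOp_one (d : ℕ) : kirillovOp d 1 = 1 := by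
  refine DFunLike.coe_injective (eq_of_expVec (d := d) (kirillovOp d 1).continuous continuous_id
    (kirillovOp d 1).toLinearMap.isLinear LinearMap.id.isLinear fun w hw => ?_)
  rw [kirillovOp_expVec d 1 hw]
  simp [actExp, autFactor, moeb]

theorem kirillovOp_mul (d : ℕ) (g k : SL(2, ℝ)) :
    kirillovOp d (g * k) = kirillovOp d g * kirillovOp d k := by
  refine DFunLike.coe_injective (eq_of_expVec (d := d) (kirillovOp d _).continuous
    (kirillovOp d g * kirillovOp d k).continuous
    (kirillovOp d _).toLinearMap.isLinear
    (kirillovOp d g * kirillovOp d k).toLinearMap.isLinear fun w hw => ?_)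
  rw [kirillovOp_expVec d _ hw, mul_apply_eq_comp, kirillovOp_expVec d _ hw]
  simp only [actExp, map_smul, kirillovOp_expVec d _ (moeb_re_pos k hw), smul_smul]
  rw [autFactor_mul g k hw, moeb_mul g k hw, mul_pow, mul_inv, mul_comm]

/-- The representation of `SL(2, ℝ)` on `L²((0,∞), dx/x)` by the operators `kirillovOp d g`. -/
def kirillovRep (d : ℕ) : Representation ℂ SL(2, ℝ) KirillovSpace where
  toFun g := (kirillovOp d g).toLinearMap
  map_one' := by rw [kirillovOp_one]; rfl
  map_mul' g k := by rw [kirillovOp_mul]; rfl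

theorem kirillovRep_apply (d : ℕ) (g : SL(2, ℝ)) (F : KirillovSpace) :
    kirillovRep d g F = kirillovOp d g F := rfl

theorem norm_kirillovRep (d : ℕ) (g : SL(2, ℝ)) (F : KirillovSpace) :
    ‖kirillovRep d g F‖ = ‖F‖ := norm_kirillovOp d g F

theorem inner_kirillovRep (d : ℕ) (g : SL(2, ℝ)) (F G : KirillovSpace) :
    inner ℂ (kirillovRep d g F) (kirillovRep d g G) = inner ℂ F G :=
  (⟨kirillovRep d g, norm_kirillovRep d g⟩ : KirillovSpace →ₗᵢ[ℂ] KirillovSpace).inner_map_map F G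

/-- The Möbius transformation `w ↦ (s w - i q) / (p + i r w)` and its denominator describe the action
of `g` on Laplace transforms. -/
theorem laplace_kirillovRep {d : ℕ} (g : SL(2, ℝ)) (F : KirillovSpace) {w : ℂ} (hw : 0 < w.re) :
    laplace d (kirillovRep d g F) w =
      ((g 0 0 + Complex.I * g 1 0 * w) ^ (d + 1))⁻¹ *
        laplace d F ((g 1 1 * w - Complex.I * g 0 1) / (g 0 0 + Complex.I * g 1 0 * w)) := by
  have hw' : 0 < ((starRingEnd ℂ) w).re := by simpa using hw
  -- Unitarity moves g to the other side of the pairing as g⁻¹, which acts explicitly on `expVec`.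
  have e : kirillovRep d g (kirillovRep d g⁻¹ (expVec d ((starRingEnd ℂ) w))) =
      expVec d ((starRingEnd ℂ) w) := by
    rw [← Module.End.mul_apply, ← map_mul]; simp
  have ha : (starRingEnd ℂ) (autFactor g⁻¹ ((starRingEnd ℂ) w)) =
      g 0 0 + Complex.I * g 1 0 * w := by
    simp [autFactor, Matrix.SpecialLinearGroup.coe_inv, Matrix.adjugate_fin_two]
  have hm : (starRingEnd ℂ) (moeb g⁻¹ ((starRingEnd ℂ) w)) =
      (g 1 1 * w - Complex.I * g 0 1) / (g 0 0 + Complex.I * g 1 0 * w) := by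
    rw [moeb, map_div₀, ha]
    simp [sub_eq_add_neg, Matrix.SpecialLinearGroup.coe_inv, Matrix.adjugate_fin_two]
  have hp := moeb_re_pos g⁻¹ hw'
  rw [← inner_expVec hw, ← e, inner_kirillovRep, kirillovRep_apply, kirillovOp_expVec d _ hw',
    actExp, inner_smul_left, map_inv₀, map_pow, ha, ← hm, ← inner_expVec (by simpa using hp),
    Complex.conj_conj]

/-! ## The operators `kirillovOp` extend the action on `S_d([0,∞))` -/

/-- For f in S_d the integrand carries the full power x^d, whence decay of order |w|^(-d-1) up to
the imaginary axis. -/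
theorem exists_laplace_bound {d : ℕ} {f : ℝ → ℂ} (hf : f ∈ schwartzD d) :
    ∃ C : ℝ, ∀ w : ℂ, 0 ≤ w.re → ‖laplace d f w‖ ≤ C ∧ ‖w‖ ^ (d + 1) * ‖laplace d f w‖ ≤ C := by
  obtain ⟨f₁, hf₁, rfl⟩ := hf
  obtain ⟨C, hC⟩ := exists_pow_mul_norm_integral_le hf₁ d
  refine ⟨max C (∫ x in Ioi (0 : ℝ), ‖(x : ℂ) ^ d * f₁ x‖), fun w hw => ?_⟩
  have e : laplace d ((Ici (0 : ℝ)).indicator fun x =>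
      ((x ^ (((d : ℝ) + 1) / 2) : ℝ) : ℂ) * f₁ x) w = _ := laplace_weighted f₁ w
  rw [e]
  exact ⟨((hf₁.pow_mul d).norm_integral_mul_exp_le hw).trans (le_max_right _ _),
    (hC w hw).trans (le_max_left _ _)⟩

theorem continuousOn_laplace {d : ℕ} {f : ℝ → ℂ} (hf : f ∈ schwartzD d) :
    ContinuousOn (laplace d f) {w | 0 ≤ w.re} := by
  obtain ⟨f₁, hf₁, rfl⟩ := hf
  have e : laplace d ((Ici (0 : ℝ)).indicator fun x =>
      ((x ^ (((d : ℝ) + 1) / 2) : ℝ) : ℂ) * f₁ x) = _ := funext (laplace_weighted f₁)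
  rw [e]
  have hi := (hf₁.pow_mul d).integrableOn
  refine continuousOn_of_dominated (bound := fun x : ℝ => ‖(x : ℂ) ^ d * f₁ x‖) ?_ ?_ hi.norm ?_
  · intro w hw
    exact ((hf₁.pow_mul d).integrableOn_mul_exp hw).aestronglyMeasurable
  · intro w hw
    filter_upwards [ae_restrict_mem measurableSet_Ioi] with x hx
    rw [norm_mul]
    exact mul_le_of_le_one_right (norm_nonneg _) (norm_exp_neg_mul_le_one hw (le_of_lt hx))
  · exact ae_of_all _ fun x => Continuous.continuousOn (by fun_prop)

/-- The action of `g` on functions on the right half plane. -/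
def slash (d : ℕ) (g : SL(2, ℝ)) (h : ℂ → ℂ) (w : ℂ) : ℂ :=
  ((g 0 0 + Complex.I * g 1 0 * w) ^ (d + 1))⁻¹ *
    h ((g 1 1 * w - Complex.I * g 0 1) / (g 0 0 + Complex.I * g 1 0 * w))

/-- The numerator is simplified by det g = 1. No condition on the denominator is needed, since both
sides are 0 when it vanishes. -/
theorem mobius_re (g : SL(2, ℝ)) (w : ℂ) :
    ((g 1 1 * w - Complex.I * g 0 1) / (g 0 0 + Complex.I * g 1 0 * w)).re =
      w.re / Complex.normSq (g 0 0 + Complex.I * g 1 0 * w) := by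
  rw [Complex.div_re, ← add_div]
  congr 1
  simp
  linear_combination w.re * det_eq g

theorem mobius_re_nonneg (g : SL(2, ℝ)) {w : ℂ} (hw : 0 ≤ w.re) :
    0 ≤ ((g 1 1 * w - Complex.I * g 0 1) / (g 0 0 + Complex.I * g 1 0 * w)).re := by
  rw [mobius_re]
  exact div_nonneg hw (Complex.normSq_nonneg _)

/-- Let a and b be the denominator and numerator of the Möbius transform. The two bounds on h
control max(|a|, |b|)^(d+1) times the translate, and (a, b) is an invertible linear image of (1, w),
so this maximum is at least a multiple of max(1, |w|). -/
theorem exists_slash_bound {d : ℕ} (hd : 0 < d) (g : SL(2, ℝ)) {h : ℂ → ℂ} {C : ℝ}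
    (hC : ∀ w : ℂ, 0 ≤ w.re → ‖h w‖ ≤ C ∧ ‖w‖ ^ (d + 1) * ‖h w‖ ≤ C) :
    ∃ B : ℝ, ∀ w : ℂ, 0 ≤ w.re → ‖slash d g h w‖ ≤ B * (1 + ‖w‖ ^ 2)⁻¹ := by
  set κ : ℝ := ‖(g 0 0 : ℂ)‖ + ‖(g 0 1 : ℂ)‖ + ‖(g 1 0 : ℂ)‖ + ‖(g 1 1 : ℂ)‖ with hκ
  have hC0 : 0 ≤ C := (norm_nonneg _).trans (hC 0 (by simp)).1
  refine ⟨2 * (κ ^ (d + 1) * C), fun w hw => ?_⟩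
  set a : ℂ := g 0 0 + Complex.I * g 1 0 * w with ha
  set b : ℂ := g 1 1 * w - Complex.I * g 0 1 with hb
  have hs : slash d g h w = (a ^ (d + 1))⁻¹ * h (b / a) := rfl
  have hκ0 : 0 ≤ κ := by positivity
  -- At a pole of the Möbius transform `slash` takes the default value 0.
  rcases eq_or_ne a 0 with ha0 | ha0
  · rw [hs, ha0]
    simp; positivity
  obtain ⟨h1, h2⟩ := hC (b / a) (mobius_re_nonneg g hw)
  have k1 : ‖a‖ ^ (d + 1) * ‖slash d g h w‖ ≤ C := by
    rw [hs, norm_mul, norm_inv, norm_pow]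
    have : ‖a‖ ≠ 0 := by simpa using ha0
    field_simp
    exact h1
  have k2 : ‖b‖ ^ (d + 1) * ‖slash d g h w‖ ≤ C := by
    rw [hs, norm_mul, norm_inv, norm_pow]
    rw [norm_div, div_pow] at h2
    refine (le_of_eq ?_).trans h2
    ring
  -- Inverting the linear map (1, w) ↦ (a, b) by det g = 1.
  have e1 : g 1 1 * a - Complex.I * g 1 0 * b = 1 := by
    rw [ha, hb]
    linear_combination det_eq_complex g + (g 0 1 * g 1 0 : ℂ) * Complex.I_sq
  have e2 : g 0 0 * b + Complex.I * g 0 1 * a = w := by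
    rw [ha, hb]
    linear_combination w * det_eq_complex g + (g 0 1 * g 1 0 * w : ℂ) * Complex.I_sq
  set m : ℝ := max ‖a‖ ‖b‖ with hm
  have hm0 : 0 ≤ m := (norm_nonneg a).trans (le_max_left _ _)
  have k3 : m ^ (d + 1) * ‖slash d g h w‖ ≤ C := by
    rcases max_choice ‖a‖ ‖b‖ with h | h <;> rw [hm, h] <;> assumption
  have l1 : 1 ≤ κ * m := by
    have : ‖(1 : ℂ)‖ ≤ ‖(g 1 1 : ℂ)‖ * ‖a‖ + ‖(g 1 0 : ℂ)‖ * ‖b‖ := by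
      rw [← e1]
      refine (norm_sub_le _ _).trans ?_
      simp
    rw [norm_one] at this
    refine this.trans ?_
    calc _ ≤ ‖(g 1 1 : ℂ)‖ * m + ‖(g 1 0 : ℂ)‖ * m := by
          gcongr
          · exact le_max_left _ _
          · exact le_max_right _ _
      _ ≤ κ * m := by
          rw [← add_mul]; gcongr; rw [hκ]
          linarith [norm_nonneg (g 0 0 : ℂ), norm_nonneg (g 0 1 : ℂ)]
  have l2 : ‖w‖ ≤ κ * m := by
    have : ‖w‖ ≤ ‖(g 0 0 : ℂ)‖ * ‖b‖ + ‖(g 0 1 : ℂ)‖ * ‖a‖ := by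
      conv_lhs => rw [← e2]
      refine (norm_add_le _ _).trans ?_
      simp
    refine this.trans ?_
    calc _ ≤ ‖(g 0 0 : ℂ)‖ * m + ‖(g 0 1 : ℂ)‖ * m := by
          gcongr
          · exact le_max_right _ _
          · exact le_max_left _ _
      _ ≤ κ * m := by
          rw [← add_mul]; gcongr; rw [hκ]
          linarith [norm_nonneg (g 1 0 : ℂ), norm_nonneg (g 1 1 : ℂ)]
  -- Since κ m ≥ 1 and d + 1 ≥ 2, the square is at most the power d+1.
  have l3 : 1 + ‖w‖ ^ 2 ≤ 2 * (κ * m) ^ (d + 1) := by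
    have h3 : (κ * m) ^ 2 ≤ (κ * m) ^ (d + 1) := pow_le_pow_right₀ l1 (by omega)
    have h4 : ‖w‖ ^ 2 ≤ (κ * m) ^ 2 := by gcongr
    have h5 : 1 ≤ (κ * m) ^ 2 := one_le_pow₀ l1
    linarith
  rw [← div_eq_mul_inv, le_div_iff₀ (by positivity)]
  calc ‖slash d g h w‖ * (1 + ‖w‖ ^ 2) ≤ ‖slash d g h w‖ * (2 * (κ * m) ^ (d + 1)) := by gcongr
    _ = 2 * (κ ^ (d + 1) * (m ^ (d + 1) * ‖slash d g h w‖)) := by rw [mul_pow]; ring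
    _ ≤ 2 * (κ ^ (d + 1) * C) := by gcongr

theorem continuousWithinAt_slash {d : ℕ} (g : SL(2, ℝ)) {h : ℂ → ℂ}
    (hh : ContinuousOn h {w | 0 ≤ w.re}) {w : ℂ} (hw : 0 ≤ w.re)
    (hw0 : (g 0 0 + Complex.I * g 1 0 * w : ℂ) ≠ 0) :
    ContinuousWithinAt (slash d g h) {w | 0 ≤ w.re} w := by
  refine ContinuousWithinAt.mul (ContinuousWithinAt.inv₀ (by fun_prop) (pow_ne_zero _ hw0)) ?_
  refine ContinuousWithinAt.comp (t := {w | 0 ≤ w.re}) (hh _ (mobius_re_nonneg g hw)) ?_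
    fun v hv => mobius_re_nonneg g hv
  exact ContinuousWithinAt.div (by fun_prop) (by fun_prop) hw0

/-! ### Boundary values on the imaginary axis and Fourier inversion -/

theorem ae_denominator_ne_zero (g : SL(2, ℝ)) : ∀ᵐ x : ℝ, g 1 0 * x + g 0 0 ≠ 0 := by
  have : {x : ℝ | g 1 0 * x + g 0 0 = 0}.Subsingleton := by
    intro x hx y hy
    have hx' : g 1 0 * x + g 0 0 = 0 := hx
    have hy' : g 1 0 * y + g 0 0 = 0 := hy
    have hr : g 1 0 ≠ 0 := by
      intro hr
      have := det_eq g
      rw [hr] at hx' this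
      simp only [zero_mul, zero_add] at hx'
      simp [hx'] at this
    exact mul_left_cancel₀ hr (by linarith)
  exact compl_mem_ae_iff.2 (this.measure_zero volume)

theorem T_one_eq (d : ℕ) (f : ℝ → ℂ) (z : ℝ) :
    T d 1 f z = (((Real.sqrt (2 * Real.pi))⁻¹ : ℝ) : ℂ) * laplace d f (-(Complex.I * z)) := by
  rw [T, laplace]
  congr 2; ext x
  congr 2
  push_cast; ring

/-- At w = -iz the denominator p + i r w becomes r z + p, so π_d on the real line is the half plane
action restricted to the boundary. -/
theorem indFormula_T (d : ℕ) (g : SL(2, ℝ)) (f : ℝ → ℂ) (z : ℝ) :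
    indFormula d g (T d 1 f) z =
      (((Real.sqrt (2 * Real.pi))⁻¹ : ℝ) : ℂ) * slash d g (laplace d f) (-(Complex.I * z)) := by
  have e : (g 0 0 + Complex.I * g 1 0 * -(Complex.I * z) : ℂ) =
      ((g 1 0 * z + g 0 0 : ℝ) : ℂ) := by
    push_cast
    linear_combination (-(g 1 0 : ℂ) * z) * Complex.I_sq
  rw [indFormula, T_one_eq, slash, e, mul_left_comm]
  congr 3
  rw [Complex.ofReal_div]
  push_cast
  ring

theorem indAct_ae_eq (d : ℕ) (g : SL(2, ℝ)) (φ : ℝ → ℂ) :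
    indAct d g φ =ᵐ[volume] indFormula d g φ := by
  filter_upwards [ae_denominator_ne_zero g] with x hx
  rw [indAct, if_neg hx]

theorem denominator_ne_zero {g : SL(2, ℝ)} {x : ℝ} (hx : g 1 0 * x + g 0 0 ≠ 0) (y : ℝ) :
    (g 0 0 + Complex.I * g 1 0 * (y - Complex.I * x) : ℂ) ≠ 0 := by
  intro h
  apply hx
  have := congrArg Complex.re h
  simp at this
  linarith

theorem norm_sub_I_mul_sq (y ξ : ℝ) : ξ ^ 2 ≤ ‖(y - Complex.I * ξ : ℂ)‖ ^ 2 := by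
  rw [Complex.sq_norm, Complex.normSq_apply]
  simp
  nlinarith [sq_nonneg y]

/-- The bound is uniform in y ≥ 0 and serves as the dominating function when y → 0. -/
theorem exists_slash_line_bound {d : ℕ} (hd : 0 < d) (g : SL(2, ℝ)) {f : ℝ → ℂ}
    (hf : f ∈ schwartzD d) : ∃ B : ℝ, ∀ y ξ : ℝ, 0 ≤ y →
      ‖slash d g (laplace d f) (y - Complex.I * ξ)‖ ≤ B * (1 + ξ ^ 2)⁻¹ := by
  obtain ⟨C, hC⟩ := exists_laplace_bound hf
  obtain ⟨B, hB⟩ := exists_slash_bound hd g hC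
  have hB0 : 0 ≤ B := by simpa using (norm_nonneg _).trans (hB 0 (by simp))
  refine ⟨B, fun y ξ hy => (hB _ (by simpa using hy)).trans ?_⟩
  exact mul_le_mul_of_nonneg_left (inv_anti₀ (by positivity)
    (by linarith [norm_sub_I_mul_sq y ξ])) hB0

theorem aestronglyMeasurable_slash_line {d : ℕ} (g : SL(2, ℝ)) {f : ℝ → ℂ}
    (hf : f ∈ schwartzD d) {y : ℝ} (hy : 0 ≤ y) :
    AEStronglyMeasurable (fun ξ : ℝ => slash d g (laplace d f) (y - Complex.I * ξ)) volume := by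
  set S : Set ℝ := {x | g 1 0 * x + g 0 0 ≠ 0} with hS
  have hSo : IsOpen S := isOpen_ne_fun (by fun_prop) (by fun_prop)
  have hc : ContinuousOn (fun ξ : ℝ => slash d g (laplace d f) (y - Complex.I * ξ)) S := by
    intro ξ hξ
    have h1 : ContinuousWithinAt (slash d g (laplace d f)) {w | 0 ≤ w.re}
        ((y : ℂ) - Complex.I * ξ) := continuousWithinAt_slash g (continuousOn_laplace hf)
      (by simpa using hy) (denominator_ne_zero hξ y)
    have h2 : ContinuousWithinAt (fun ξ : ℝ => (y : ℂ) - Complex.I * ξ) S ξ :=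
      Continuous.continuousWithinAt (by fun_prop)
    exact ContinuousWithinAt.comp (f := fun ξ : ℝ => (y : ℂ) - Complex.I * ξ) h1 h2
      fun v _ => by simpa using hy
  have h := hc.aestronglyMeasurable (μ := volume) hSo.measurableSet
  have hS' : ∀ᵐ x : ℝ, x ∈ S := ae_denominator_ne_zero g
  rwa [Measure.restrict_eq_self_of_ae_mem hS'] at h

theorem integrable_slash_line {d : ℕ} (hd : 0 < d) (g : SL(2, ℝ)) {f : ℝ → ℂ}
    (hf : f ∈ schwartzD d) {y : ℝ} (hy : 0 ≤ y) :
    Integrable (fun ξ : ℝ => slash d g (laplace d f) (y - Complex.I * ξ)) := by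
  obtain ⟨B, hB⟩ := exists_slash_line_bound hd g hf
  exact Integrable.mono' (integrable_inv_one_add_sq.const_mul B)
    (aestronglyMeasurable_slash_line g hf hy) (ae_of_all _ fun ξ => hB y ξ hy)

theorem indAct_T_ae_eq (d : ℕ) (g : SL(2, ℝ)) (f : ℝ → ℂ) :
    indAct d g (T d 1 f) =ᵐ[volume] fun ξ : ℝ => (((Real.sqrt (2 * Real.pi))⁻¹ : ℝ) : ℂ) *
      slash d g (laplace d f) (((0 : ℝ) : ℂ) - Complex.I * ξ) := by
  filter_upwards [indAct_ae_eq d g (T d 1 f)] with ξ hξ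
  rw [hξ, indFormula_T]; simp

theorem integrable_indAct_T {d : ℕ} (hd : 0 < d) (g : SL(2, ℝ)) {f : ℝ → ℂ}
    (hf : f ∈ schwartzD d) : Integrable (indAct d g (T d 1 f)) :=
  ((integrable_slash_line hd g hf le_rfl).const_mul _).congr (indAct_T_ae_eq d g f).symm

theorem laplace_kirillovRep_eq_slash {d : ℕ} (g : SL(2, ℝ)) (F : KirillovSpace) {f : ℝ → ℂ}
    (hF : F =ᵐ[mulMeasure] f) {w : ℂ} (hw : 0 < w.re) :
    laplace d (kirillovRep d g F) w = slash d g (laplace d f) w := by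
  rw [laplace_kirillovRep g F hw, slash, laplace_congr hF]

/-- On the line Re w = y > 0 the translated Laplace transform is the Fourier transform of
x^((d-1)/2) F'(x) e^(-yx), where F' is the image of F. Inversion recovers this function, and
dominated convergence as y → 0 replaces the line by the imaginary axis, where π_d(g) T f appears. -/
theorem kirillovRep_ae_eq {d : ℕ} (hd : 0 < d) (g : SL(2, ℝ)) {f : ℝ → ℂ} (hf : f ∈ schwartzD d)
    {F : KirillovSpace} (hF : F =ᵐ[mulMeasure] f) :
    kirillovRep d g F =ᵐ[mulMeasure] M d 1 (indAct d g (T d 1 f)) := by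
  set F' := kirillovRep d g F with hF'
  set Φ := slash d g (laplace d f) with hΦ
  obtain ⟨B, hB⟩ := exists_slash_line_bound hd g hf
  have hinv : ∀ y : ℝ, 0 < y → ∀ᵐ x : ℝ, 0 < x →
      ∫ ξ : ℝ, Φ (y - Complex.I * ξ) * Complex.exp (-(Complex.I * ξ * x)) =
        2 * Real.pi * (((x ^ (((d : ℝ) - 1) / 2) : ℝ) : ℂ) * F' x * Complex.exp (-(y * x))) := by
    intro y hy
    set u : ℝ → ℂ := (Ioi (0 : ℝ)).indicator fun x =>
      ((x ^ (((d : ℝ) - 1) / 2) : ℝ) : ℂ) * F' x * Complex.exp (-(y * x)) with hu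
    have hi : Integrable u := (integrable_indicator_iff measurableSet_Ioi).2
      (integrable_laplace (by simpa using hy) F')
    have := ae_integral_fourier_eq hi (integrable_slash_line hd g hf hy.le) fun ξ => ?_
    · filter_upwards [this] with x hx hx0
      rw [hx, hu, indicator_of_mem (show x ∈ Ioi (0 : ℝ) from hx0)]
    · rw [← laplace_kirillovRep_eq_slash g F hF (by simpa using hy), laplace,
        ← integral_indicator measurableSet_Ioi]
      congr 1; ext x
      by_cases hx : x ∈ Ioi (0 : ℝ)
      · simp only [hu, indicator_of_mem hx, mul_assoc, ← Complex.exp_add, hF']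
        congr 3; ring
      · simp only [hu, indicator_of_notMem hx, zero_mul]
  -- The exceptional null set of the inversion depends on y, so y runs through a sequence and
  -- countably many null sets are discarded.
  set y : ℕ → ℝ := fun n => 1 / ((n : ℝ) + 1) with hy
  have hy0 : ∀ n, 0 < y n := fun n => by positivity
  have hylim : Tendsto y atTop (𝓝 0) := tendsto_one_div_add_atTop_nhds_zero_nat
  have hylim' : Tendsto (fun n => (y n : ℂ)) atTop (𝓝 ((0 : ℝ) : ℂ)) :=
    (Complex.continuous_ofReal.tendsto 0).comp hylim
  rw [EventuallyEq, ae_mulMeasure_iff']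
  filter_upwards [ae_all_iff.2 fun n => hinv (y n) (hy0 n)] with x hx hx0
  have lim1 : Tendsto (fun n => ∫ ξ : ℝ, Φ (y n - Complex.I * ξ) *
      Complex.exp (-(Complex.I * ξ * x))) atTop
      (𝓝 (2 * Real.pi * (((x ^ (((d : ℝ) - 1) / 2) : ℝ) : ℂ) * F' x))) := by
    have : Tendsto (fun n => 2 * Real.pi * (((x ^ (((d : ℝ) - 1) / 2) : ℝ) : ℂ) * F' x *
        Complex.exp (-(y n * x)))) atTop (𝓝 (2 * Real.pi * (((x ^ (((d : ℝ) - 1) / 2) : ℝ) : ℂ) *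
          F' x * Complex.exp (-(((0 : ℝ) : ℂ) * x))))) :=
      ((((hylim'.mul_const _).neg).cexp).const_mul _).const_mul _
    simp only [Complex.ofReal_zero, zero_mul, neg_zero, Complex.exp_zero, mul_one] at this
    exact this.congr fun n => (hx n hx0).symm
  have hexp : ∀ ξ : ℝ, ‖Complex.exp (-(Complex.I * ξ * x))‖ = 1 := by
    intro ξ; rw [Complex.norm_exp]; simp
  have lim2 : Tendsto (fun n => ∫ ξ : ℝ, Φ (y n - Complex.I * ξ) *
      Complex.exp (-(Complex.I * ξ * x))) atTop
      (𝓝 (∫ ξ : ℝ, Φ (((0 : ℝ) : ℂ) - Complex.I * ξ) * Complex.exp (-(Complex.I * ξ * x)))) := by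
    refine tendsto_integral_of_dominated_convergence (fun ξ => B * (1 + ξ ^ 2)⁻¹) (fun n => ?_)
      (integrable_inv_one_add_sq.const_mul B) (fun n => ae_of_all _ fun ξ => ?_) ?_
    · exact (aestronglyMeasurable_slash_line g hf (hy0 n).le).mul
        (Continuous.aestronglyMeasurable (by fun_prop))
    · rw [norm_mul, hexp, mul_one]
      exact hB _ ξ (hy0 n).le
    · filter_upwards [ae_denominator_ne_zero g] with ξ hξ
      refine Tendsto.mul_const _ ?_
      have hc := continuousWithinAt_slash (d := d) g (continuousOn_laplace hf)
        (w := ((0 : ℝ) : ℂ) - Complex.I * ξ) (by simp) (denominator_ne_zero hξ 0)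
      refine hc.tendsto.comp (tendsto_nhdsWithin_iff.2 ⟨hylim'.sub_const _, ?_⟩)
      exact Eventually.of_forall fun n => by simpa using (hy0 n).le
  have key := tendsto_nhds_unique lim1 lim2
  have e : ∫ ξ : ℝ, indAct d g (T d 1 f) ξ *
      Complex.exp (-(Complex.I * (((1 : ℤˣ) : ℤ) : ℂ) * ξ * x)) =
      (((Real.sqrt (2 * Real.pi))⁻¹ : ℝ) : ℂ) *
        ∫ ξ : ℝ, Φ (((0 : ℝ) : ℂ) - Complex.I * ξ) * Complex.exp (-(Complex.I * ξ * x)) := by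
    rw [← integral_const_mul]
    refine integral_congr_ae ?_
    filter_upwards [indAct_T_ae_eq d g f] with ξ hξ
    rw [hξ, mul_assoc]
    simp [hΦ]
  rw [M, e, ← key]
  -- The normalisations of T and M together cancel the 2π of the inversion formula; the powers of x
  -- cancel in the next step.
  have h2 : (((Real.sqrt (2 * Real.pi))⁻¹ : ℝ) : ℂ) * (((Real.sqrt (2 * Real.pi))⁻¹ : ℝ) : ℂ) *
      (2 * Real.pi) = 1 := by
    have : (Real.sqrt (2 * Real.pi))⁻¹ * (Real.sqrt (2 * Real.pi))⁻¹ * (2 * Real.pi) = 1 := by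
      rw [← mul_inv, Real.mul_self_sqrt Real.two_pi_pos.le, inv_mul_cancel₀ Real.two_pi_pos.ne']
    exact_mod_cast this
  have h3 : ((x ^ ((1 - (d : ℝ)) / 2) : ℝ) : ℂ) * ((x ^ (((d : ℝ) - 1) / 2) : ℝ) : ℂ) = 1 := by
    rw [← Complex.ofReal_mul, ← Real.rpow_add hx0]
    rw [show (1 - (d : ℝ)) / 2 + ((d : ℝ) - 1) / 2 = 0 by ring]
    simp
  linear_combination (-F' x) * h2 -
    F' x * (((Real.sqrt (2 * Real.pi))⁻¹ : ℝ) : ℂ) * (((Real.sqrt (2 * Real.pi))⁻¹ : ℝ) : ℂ) *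
      (2 * Real.pi) * h3

theorem isKirillovRep_kirillovRep {d : ℕ} (hd : 0 < d) : IsKirillovRep d 1 (kirillovRep d) :=
  ⟨norm_kirillovRep d, fun g _ hf _ hF => kirillovRep_ae_eq hd g hf hF⟩

/-! ### Uniqueness of the isometric extension -/

theorem IsKirillovRep.continuous {d : ℕ} {ε : ℤˣ} {R : Representation ℂ SL(2, ℝ) KirillovSpace}
    (h : IsKirillovRep d ε R) (g : SL(2, ℝ)) : Continuous (R g) :=
  (⟨R g, h.isometry g⟩ : KirillovSpace →ₗᵢ[ℂ] KirillovSpace).continuous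

/-- The vectors `expVec` have representatives in S_d, so the operators agree on a set with dense
span; isometries are continuous. -/
theorem IsKirillovRep.unique {d : ℕ} {ε : ℤˣ} {R S : Representation ℂ SL(2, ℝ) KirillovSpace}
    (hR : IsKirillovRep d ε R) (hS : IsKirillovRep d ε S) : R = S := by
  refine MonoidHom.ext fun g => DFunLike.coe_injective ?_
  refine eq_of_expVec (d := d) (hR.continuous g) (hS.continuous g) (R g).isLinear (S g).isLinear
    fun w hw => Lp.ext ?_
  have h := weighted_mem (d := d) (isSchwartzHalfLine_exp hw)
  exact (hR.extends_action g _ h _ (expVec_ae hw)).trans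
    (hS.extends_action g _ h _ (expVec_ae hw)).symm

/-! ## The sign `ε = -1` -/

/-- Conjugation of a matrix by `diag(1, -1)`. -/
def flipFun (g : SL(2, ℝ)) : SL(2, ℝ) :=
  ⟨!![g 0 0, -g 0 1; -g 1 0, g 1 1], by rw [Matrix.det_fin_two]; simpa using det_eq g⟩

theorem flipFun_zero_zero (g : SL(2, ℝ)) : flipFun g 0 0 = g 0 0 := rfl

theorem flipFun_zero_one (g : SL(2, ℝ)) : flipFun g 0 1 = -g 0 1 := rfl

theorem flipFun_one_zero (g : SL(2, ℝ)) : flipFun g 1 0 = -g 1 0 := rfl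

theorem flipFun_one_one (g : SL(2, ℝ)) : flipFun g 1 1 = g 1 1 := rfl

/-- Conjugation by `diag(1, -1)`, as an endomorphism of `SL(2, ℝ)`. -/
def flip : SL(2, ℝ) →* SL(2, ℝ) where
  toFun := flipFun
  map_one' := by
    ext i j
    fin_cases i <;> fin_cases j <;>
      simp [flipFun_zero_zero, flipFun_zero_one, flipFun_one_zero, flipFun_one_one]
  map_mul' g k := by
    ext i j
    fin_cases i <;> fin_cases j <;>
      simp [flipFun_zero_zero, flipFun_zero_one, flipFun_one_zero, flipFun_one_one,
        Matrix.mul_apply, Fin.sum_univ_two] <;> ring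

theorem flip_apply (g : SL(2, ℝ)) : flip g = flipFun g := rfl

theorem flip_flip (g : SL(2, ℝ)) : flip (flip g) = g := by
  ext i j
  fin_cases i <;> fin_cases j <;>
    simp [flip_apply, flipFun_zero_zero, flipFun_zero_one, flipFun_one_zero, flipFun_one_one]

theorem flip_mem_SO2 {g : SL(2, ℝ)} (hg : g ∈ SO2) : flip g ∈ SO2 := by
  have h : (g : Matrix (Fin 2) (Fin 2) ℝ) * star (g : Matrix (Fin 2) (Fin 2) ℝ) = 1 :=
    (Matrix.mem_orthogonalGroup_iff _ _).1 hg
  refine (Matrix.mem_orthogonalGroup_iff _ _).2 ?_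
  have h00 := congrFun (congrFun h 0) 0
  have h01 := congrFun (congrFun h 0) 1
  have h10 := congrFun (congrFun h 1) 0
  have h11 := congrFun (congrFun h 1) 1
  simp [Matrix.mul_apply, Fin.sum_univ_two, Matrix.star_apply] at h00 h01 h10 h11
  ext i j
  fin_cases i <;> fin_cases j <;>
    simp [flip_apply, flipFun_zero_zero, flipFun_zero_one, flipFun_one_zero, flipFun_one_one,
      Matrix.mul_apply, Fin.sum_univ_two] <;> linarith

theorem T_neg_one (d : ℕ) (f : ℝ → ℂ) (z : ℝ) : T d (-1) f z = T d 1 f (-z) := by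
  simp only [T]
  congr 2; ext x
  congr 2
  push_cast; ring

/-- The substitution x ↦ -x changes the sign in both kernels and conjugates g by diag(1, -1). -/
theorem M_neg_one_indAct (d : ℕ) (g : SL(2, ℝ)) (f : ℝ → ℂ) (y : ℝ) :
    M d (-1) (indAct d g (T d (-1) f)) y = M d 1 (indAct d (flip g) (T d 1 f)) y := by
  simp only [M]
  congr 1
  -- Under the integral the action may be replaced by its formula, so the limits at the exceptional
  -- points need not be compared.
  have e1 : ∫ x : ℝ, indAct d g (T d (-1) f) x *
      Complex.exp (-(Complex.I * (((-1 : ℤˣ) : ℤ) : ℂ) * x * y)) =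
      ∫ x : ℝ, indFormula d g (T d (-1) f) x *
      Complex.exp (-(Complex.I * (((-1 : ℤˣ) : ℤ) : ℂ) * x * y)) := by
    refine integral_congr_ae ?_
    filter_upwards [indAct_ae_eq d g (T d (-1) f)] with x hx
    rw [hx]
  have e2 : ∫ x : ℝ, indAct d (flip g) (T d 1 f) x *
      Complex.exp (-(Complex.I * (((1 : ℤˣ) : ℤ) : ℂ) * x * y)) =
      ∫ x : ℝ, indFormula d (flip g) (T d 1 f) x *
      Complex.exp (-(Complex.I * (((1 : ℤˣ) : ℤ) : ℂ) * x * y)) := by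
    refine integral_congr_ae ?_
    filter_upwards [indAct_ae_eq d (flip g) (T d 1 f)] with x hx
    rw [hx]
  rw [e1, e2, ← integral_neg_eq_self]
  congr 1; ext x
  congr 1
  · simp only [indFormula, T_neg_one]
    simp only [flip_apply, flipFun_zero_zero, flipFun_zero_one, flipFun_one_zero, flipFun_one_one]
    rw [show g 1 0 * -x + g 0 0 = -g 1 0 * x + g 0 0 by ring, ← neg_div,
      show -(g 1 1 * -x + g 0 1) = g 1 1 * x + -g 0 1 by ring]
  · congr 1; push_cast; ring

theorem IsKirillovRep.comp_flip {d : ℕ} {R : Representation ℂ SL(2, ℝ) KirillovSpace}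
    (h : IsKirillovRep d 1 R) : IsKirillovRep d (-1) (R.comp flip) :=
  ⟨fun g F => h.isometry _ F, fun g f hf F hF => by
    rw [funext (M_neg_one_indAct d g f)]
    exact h.extends_action (flip g) f hf F hF⟩

theorem exists_isKirillovRep {d : ℕ} (hd : 0 < d) (ε : ℤˣ) :
    ∃ R, IsKirillovRep d ε R ∧ (R = kirillovRep d ∨ R = (kirillovRep d).comp flip) := by
  rcases Int.units_eq_one_or ε with rfl | rfl
  · exact ⟨_, isKirillovRep_kirillovRep hd, Or.inl rfl⟩
  · exact ⟨_, (isKirillovRep_kirillovRep hd).comp_flip, Or.inr rfl⟩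

/-- Conjugation by diag(1, -1) permutes K, so each vector has the same K-orbit under both
representations. -/
theorem kFinite_comp_flip (R : Representation ℂ SL(2, ℝ) KirillovSpace) :
    kFinite (R.comp flip : Representation ℂ SL(2, ℝ) KirillovSpace) = kFinite R := by
  ext F
  have : (Set.range fun k : SO2 => (R.comp flip) k F) = Set.range fun k : SO2 => R k F := by
    ext G
    constructor
    · rintro ⟨k, rfl⟩
      exact ⟨⟨flip k, flip_mem_SO2 k.2⟩, rfl⟩
    · rintro ⟨k, rfl⟩
      refine ⟨⟨flip k, flip_mem_SO2 k.2⟩, ?_⟩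
      simp [flip_flip]
  change FiniteDimensional ℂ (Submodule.span ℂ (Set.range fun k : SO2 => (R.comp flip) k F)) ↔
    FiniteDimensional ℂ (Submodule.span ℂ (Set.range fun k : SO2 => R k F))
  rw [this]

/-! ## Polynomials in the coordinate of the unit disc -/

/-- The Laplace transform at `w` as a linear functional on `L²((0,∞), dx/x)`. -/
def laplaceFunctional (d : ℕ) (w : ℂ) : KirillovSpace →L[ℂ] ℂ :=
  innerSL ℂ (expVec d ((starRingEnd ℂ) w))

theorem laplaceFunctional_apply {d : ℕ} {w : ℂ} (hw : 0 < w.re) (F : KirillovSpace) :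
    laplaceFunctional d w F = laplace d F w := inner_expVec hw F

theorem isSchwartzHalfLine_poly (p : ℂ[X]) :
    IsSchwartzHalfLine fun x : ℝ => p.eval (x : ℂ) * Complex.exp (-((1 : ℂ) * x)) :=
  isSchwartzHalfLine_eval_mul_exp p (by simp)

/-- The class of `x^((d+1)/2) e^(-x) p(x)` in `L²((0,∞), dx/x)`. -/
def polyVec (d : ℕ) : ℂ[X] →ₗ[ℂ] KirillovSpace where
  toFun p := (memLp_weighted (d := d) (isSchwartzHalfLine_poly p)).toLp _
  map_add' p q := by
    rw [← MemLp.toLp_add]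
    refine MemLp.toLp_congr _ _ (ae_of_all _ fun x => ?_)
    by_cases hx : x ∈ Ici (0 : ℝ)
    · simp only [weighted, Pi.add_apply, indicator_of_mem hx, eval_add]; ring
    · simp only [weighted, Pi.add_apply, indicator_of_notMem hx, add_zero]
  map_smul' c p := by
    rw [RingHom.id_apply, ← MemLp.toLp_const_smul]
    refine MemLp.toLp_congr _ _ (ae_of_all _ fun x => ?_)
    by_cases hx : x ∈ Ici (0 : ℝ)
    · simp only [weighted, Pi.smul_apply, indicator_of_mem hx, eval_smul, smul_eq_mul]; ring
    · simp only [weighted, Pi.smul_apply, indicator_of_notMem hx, smul_zero]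

theorem polyVec_ae (d : ℕ) (p : ℂ[X]) : polyVec d p =ᵐ[mulMeasure]
    weighted d fun x : ℝ => p.eval (x : ℂ) * Complex.exp (-((1 : ℂ) * x)) :=
  MemLp.coeFn_toLp (memLp_weighted (isSchwartzHalfLine_poly p))

theorem polyVec_ae_polyExp (d : ℕ) (p : ℂ[X]) : polyVec d p =ᵐ[mulMeasure] polyExp d p := by
  refine (polyVec_ae d p).trans (ae_mulMeasure_iff'.2 (ae_of_all _ fun x hx => ?_))
  rw [weighted_of_pos hx, polyExp]
  push_cast
  rw [one_mul]; ring

theorem laplace_polyVec_monomial (d n : ℕ) (a : ℂ) {w : ℂ} (hw : 0 ≤ w.re) :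
    laplace d (weighted d fun x : ℝ => (monomial n a).eval (x : ℂ) *
      Complex.exp (-((1 : ℂ) * x))) w = a * ((d + n).factorial / (1 + w) ^ (d + n + 1)) := by
  rw [laplace_weighted,
    ← integral_pow_mul_exp (d + n) (show 0 < (1 + w).re by simp; linarith), ← integral_const_mul]
  refine setIntegral_congr_fun measurableSet_Ioi fun x hx => ?_
  simp only [eval_monomial]
  rw [show -((1 + w) * (x : ℂ)) = -(1 * x) + -(w * x) by ring, Complex.exp_add]
  ring

/-- Rescaling of the coefficients, `X ^ n ↦ X ^ n / (d + n)!`. -/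
def factScale (d : ℕ) : ℂ[X] →ₗ[ℂ] ℂ[X] :=
  (basisMonomials ℂ).constr ℂ fun n => monomial n (((d + n).factorial : ℂ)⁻¹)

theorem factScale_monomial (d n : ℕ) (a : ℂ) :
    factScale d (monomial n a) = monomial n (a * ((d + n).factorial : ℂ)⁻¹) := by
  have h : factScale d (monomial n 1) = monomial n (((d + n).factorial : ℂ)⁻¹) := by
    have := (basisMonomials ℂ).constr_basis ℂ
      (fun n => monomial n (((d + n).factorial : ℂ)⁻¹)) n
    rwa [coe_basisMonomials] at this
  rw [← mul_one a, ← smul_eq_mul, ← smul_monomial, map_smul, h, smul_monomial]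
  simp

/-- The polynomial `p` such that `P` in the disc coordinate corresponds to
`x^((d+1)/2) e^(-x) p(x)`. -/
def laguerre (d : ℕ) : ℂ[X] →ₗ[ℂ] ℂ[X] :=
  (factScale d).comp (aeval (C 2 * X - 1 : ℂ[X])).toLinearMap

theorem laguerre_surjective (d : ℕ) : Function.Surjective (laguerre d) := by
  intro p
  induction p using Polynomial.induction_on' with
  | add p q hp hq =>
    obtain ⟨P, rfl⟩ := hp
    obtain ⟨Q, rfl⟩ := hq
    exact ⟨P + Q, map_add _ _ _⟩
  | monomial n a =>
    -- The inverse of the substitution X ↦ 2X - 1, with the factorial that `factScale` divides out.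
    refine ⟨C (a * (d + n).factorial) * (C (2⁻¹) * (X + 1)) ^ n, ?_⟩
    have e : aeval (C 2 * X - 1 : ℂ[X])
        (C (a * (d + n).factorial) * (C (2⁻¹) * (X + 1)) ^ n : ℂ[X]) =
        monomial n (a * (d + n).factorial) := by
      have h2 : (C (2⁻¹) * (C 2 * X - 1 + 1) : ℂ[X]) = X := by
        rw [sub_add_cancel, ← mul_assoc, ← C_mul]; norm_num
      simp only [map_mul, map_pow, map_add, aeval_X, aeval_C, map_one, algebraMap_eq]
      rw [h2, ← C_mul, C_mul_X_pow_eq_monomial]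
    rw [laguerre, LinearMap.comp_apply, AlgHom.toLinearMap_apply, e, factScale_monomial]
    congr 1
    have : ((d + n).factorial : ℂ) ≠ 0 := by exact_mod_cast Nat.factorial_ne_zero _
    field_simp

/-- The function `v^(-d-1) P(u/v)` of `(u, v)`. -/
def homEval (d : ℕ) (P : ℂ[X]) (u v : ℂ) : ℂ := (v ^ (d + 1))⁻¹ * P.eval (u / v)

theorem homEval_add (d : ℕ) (P Q : ℂ[X]) (u v : ℂ) :
    homEval d (P + Q) u v = homEval d P u v + homEval d Q u v := by
  simp [homEval, mul_add]

theorem homEval_smul (d : ℕ) (c : ℂ) (P : ℂ[X]) (u v : ℂ) :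
    homEval d (c • P) u v = c * homEval d P u v := by
  simp [homEval]; ring

theorem weighted_add_eval (d : ℕ) (p q : ℂ[X]) {w : ℂ} (hw : 0 ≤ w.re) :
    laplace d (weighted d fun x : ℝ => (p + q).eval (x : ℂ) * Complex.exp (-((1 : ℂ) * x))) w =
      laplace d (weighted d fun x : ℝ => p.eval (x : ℂ) * Complex.exp (-((1 : ℂ) * x))) w +
      laplace d (weighted d fun x : ℝ => q.eval (x : ℂ) * Complex.exp (-((1 : ℂ) * x))) w := by
  rw [laplace_weighted, laplace_weighted, laplace_weighted, ← integral_add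
    (((isSchwartzHalfLine_poly p).pow_mul d).integrableOn_mul_exp hw)
    (((isSchwartzHalfLine_poly q).pow_mul d).integrableOn_mul_exp hw)]
  congr 1; ext x
  rw [eval_add]; ring

/-- With u = 1/(1+w), the term x^n contributes (d+n)! (1+w)^(-d-1) u^n, and the disc coordinate is
(1-w)/(1+w) = 2u - 1. The closed half plane is included because T uses the imaginary axis. -/
theorem laplace_laguerre (d : ℕ) (P : ℂ[X]) {w : ℂ} (hw : 0 ≤ w.re) :
    laplace d (weighted d fun x : ℝ => (laguerre d P).eval (x : ℂ) *
      Complex.exp (-((1 : ℂ) * x))) w = homEval d P (1 - w) (1 + w) := by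
  have hw0 : 1 + w ≠ 0 := by
    intro h
    have := congrArg Complex.re h
    simp at this
    linarith
  have key : ∀ Q : ℂ[X], laplace d (weighted d fun x : ℝ => (factScale d Q).eval (x : ℂ) *
      Complex.exp (-((1 : ℂ) * x))) w = ((1 + w) ^ (d + 1))⁻¹ * Q.eval (1 / (1 + w)) := by
    intro Q
    induction Q using Polynomial.induction_on' with
    | add p q hp hq => rw [map_add, weighted_add_eval d _ _ hw, hp, hq, eval_add, mul_add]
    | monomial n a =>
      rw [factScale_monomial, laplace_polyVec_monomial d n _ hw, eval_monomial, one_div_pow]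
      have : ((d + n).factorial : ℂ) ≠ 0 := by exact_mod_cast Nat.factorial_ne_zero _
      field_simp
      ring
  have e : aeval (C 2 * X - 1 : ℂ[X]) P = P.comp (C 2 * X - 1) := by
    rw [comp, aeval_def, algebraMap_eq]
  rw [laguerre, LinearMap.comp_apply, key, homEval, AlgHom.toLinearMap_apply, e, eval_comp]
  congr 2
  simp only [eval_sub, eval_mul, eval_C, eval_X, eval_one]
  field_simp
  ring

/-- The vector of `L²((0,∞), dx/x)` attached to a polynomial in the coordinate of the disc. -/
def discVec (d : ℕ) : ℂ[X] →ₗ[ℂ] KirillovSpace := (polyVec d).comp (laguerre d)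

theorem laplace_discVec (d : ℕ) (P : ℂ[X]) {w : ℂ} (hw : 0 ≤ w.re) :
    laplace d (discVec d P) w = homEval d P (1 - w) (1 + w) := by
  rw [discVec, LinearMap.comp_apply, laplace_congr (polyVec_ae d _), laplace_laguerre d P hw]

theorem range_discVec (d : ℕ) : LinearMap.range (discVec d) = LinearMap.range (polyVec d) := by
  rw [discVec, LinearMap.range_comp_of_range_eq_top _
    (LinearMap.range_eq_top.2 (laguerre_surjective d))]

/-- The disc coordinate takes infinitely many values on the positive reals, each a root of P. -/
theorem infinite_of_homEval_eq_zero {d : ℕ} {P : ℂ[X]}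
    (h : ∀ y : ℝ, 0 < y → homEval d P (1 - y) (1 + y) = 0) : P = 0 := by
  refine P.eq_zero_of_infinite_isRoot ?_
  have hinj : InjOn (fun y : ℝ => ((1 - y) / (1 + y) : ℂ)) (Ioi 0) := by
    intro x hx y hy hxy
    have hx0 : (0 : ℝ) < x := hx
    have hy0 : (0 : ℝ) < y := hy
    have h1 : (1 + x : ℂ) ≠ 0 := by norm_cast; positivity
    have h2 : (1 + y : ℂ) ≠ 0 := by norm_cast; positivity
    have h3 : (1 - x : ℂ) / (1 + x) = (1 - y) / (1 + y) := hxy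
    rw [div_eq_div_iff h1 h2] at h3
    have h4 : (x : ℂ) = y := by linear_combination (-1 / 2 : ℂ) * h3
    exact_mod_cast h4
  refine ((Ioi_infinite (0 : ℝ)).image hinj).mono ?_
  rintro _ ⟨y, hy, rfl⟩
  have hy0 : (0 : ℝ) < y := hy
  have h1 : (1 + y : ℂ) ≠ 0 := by norm_cast; positivity
  have := h y hy
  rw [homEval, mul_eq_zero] at this
  exact this.resolve_left (inv_ne_zero (pow_ne_zero _ h1))

theorem discVec_injective (d : ℕ) : Function.Injective (discVec d) := by
  rw [injective_iff_map_eq_zero]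
  intro P hP
  refine infinite_of_homEval_eq_zero (d := d) fun y hy => ?_
  rw [← laplace_discVec d P (w := y) (by simpa using hy.le), hP,
    laplace_congr (Lp.coeFn_zero ℂ 2 mulMeasure)]
  simp [laplace]

/-! ### Polynomials in the disc coordinate as elements of I_d^+ -/

theorem one_sub_I_mul_ne_zero (z : ℝ) : (1 - Complex.I * z : ℂ) ≠ 0 := by
  intro h
  have := congrArg Complex.re h
  simp at this

/-- The function on the line attached to a polynomial in the coordinate of the disc. -/
def lineFun (d : ℕ) (P : ℂ[X]) (z : ℝ) : ℂ :=
  (((Real.sqrt (2 * Real.pi))⁻¹ : ℝ) : ℂ) * homEval d P (1 + Complex.I * z) (1 - Complex.I * z)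

theorem contDiff_homEval {d : ℕ} (P : ℂ[X]) {u v : ℝ → ℂ} (hu : ContDiff ℝ ∞ u)
    (hv : ContDiff ℝ ∞ v) (h0 : ∀ x, v x ≠ 0) : ContDiff ℝ ∞ fun x => homEval d P (u x) (v x) := by
  have hP : ContDiff ℝ ∞ fun z : ℂ => P.eval z := P.differentiable.contDiff.restrict_scalars ℝ
  simp only [homEval, div_eq_mul_inv]
  exact ((hv.pow _).inv fun x => pow_ne_zero _ (h0 x)).mul (hP.comp (hu.mul (hv.inv h0)))

theorem lineFun_mem (d : ℕ) (P : ℂ[X]) : lineFun d P ∈ indSpace d := by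
  have h1 : ContDiff ℝ ∞ fun x : ℝ => (x : ℂ) := Complex.ofRealCLM.contDiff
  have hne : ∀ x : ℝ, (x + Complex.I : ℂ) ≠ 0 := by
    intro x h
    have := congrArg Complex.im h
    simp at this
  -- Replacing x by -1/x turns 1 ± i x into (x ∓ i)/x; by homogeneity the factor x^(-d-1) cancels,
  -- and the extension has denominator x + i, which never vanishes.
  refine ⟨contDiff_const.mul (contDiff_homEval P (contDiff_const.add (contDiff_const.mul h1))
    (contDiff_const.sub (contDiff_const.mul h1)) one_sub_I_mul_ne_zero), fun x : ℝ =>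
    (((Real.sqrt (2 * Real.pi))⁻¹ : ℝ) : ℂ) * homEval d P (x - Complex.I) (x + Complex.I),
    contDiff_const.mul (contDiff_homEval P (h1.sub contDiff_const) (h1.add contDiff_const) hne),
    fun x hx => ?_⟩
  have hx0 : (x : ℂ) ≠ 0 := by exact_mod_cast hx
  have hd : (1 - Complex.I * ((-1 / x : ℝ) : ℂ)) = (x + Complex.I) / x := by
    push_cast; field_simp; ring
  have hn : (1 + Complex.I * ((-1 / x : ℝ) : ℂ)) = (x - Complex.I) / x := by
    push_cast; field_simp; ring
  have := hne x
  rw [lineFun, hd, hn]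
  simp only [homEval, div_div_div_cancel_right₀ hx0, div_pow]
  field_simp

/-- The element of `I_d` attached to a polynomial in the coordinate of the disc. -/
def discFun (d : ℕ) : ℂ[X] →ₗ[ℂ] indSpace d where
  toFun P := ⟨lineFun d P, lineFun_mem d P⟩
  map_add' P Q := by
    ext z; simp [lineFun, homEval_add, mul_add]
  map_smul' c P := by
    ext z; simp [lineFun, homEval_smul]; ring

theorem discFun_apply (d : ℕ) (P : ℂ[X]) (z : ℝ) : (discFun d P : ℝ → ℂ) z =
    (((Real.sqrt (2 * Real.pi))⁻¹ : ℝ) : ℂ) *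
      homEval d P (1 + Complex.I * z) (1 - Complex.I * z) := rfl

theorem discFun_eq_T (d : ℕ) (P : ℂ[X]) : (discFun d P : ℝ → ℂ) =
    T d 1 (weighted d fun x : ℝ => (laguerre d P).eval (x : ℂ) *
      Complex.exp (-((1 : ℂ) * x))) := by
  ext z
  rw [T_one_eq, laplace_laguerre d P (by simp), discFun_apply, sub_neg_eq_add, ← sub_eq_add_neg]

theorem discFun_mem_indPlus (d : ℕ) (P : ℂ[X]) : discFun d P ∈ indPlus d :=
  ⟨_, weighted_mem (isSchwartzHalfLine_poly _), discFun_eq_T d P⟩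

theorem discFun_eq_of_laplace {d : ℕ} {f : ℝ → ℂ} {P : ℂ[X]} {φ : indSpace d}
    (hφ : (φ : ℝ → ℂ) = T d 1 f) (h : f =ᵐ[mulMeasure] discVec d P) : φ = discFun d P := by
  ext z
  rw [hφ, T_one_eq, laplace_congr h, laplace_discVec d P (by simp), discFun_apply, sub_neg_eq_add,
    ← sub_eq_add_neg]

theorem discFun_injective (d : ℕ) : Function.Injective (discFun d) := by
  rw [injective_iff_map_eq_zero]
  intro P hP
  refine P.eq_zero_of_infinite_isRoot ?_
  have hinj : InjOn (fun y : ℝ => ((1 + Complex.I * y) / (1 - Complex.I * y) : ℂ)) univ := by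
    intro x _ y _ hxy
    have h3 : (1 + Complex.I * x : ℂ) / (1 - Complex.I * x) =
      (1 + Complex.I * y) / (1 - Complex.I * y) := hxy
    rw [div_eq_div_iff (one_sub_I_mul_ne_zero x) (one_sub_I_mul_ne_zero y)] at h3
    have h4 : (x : ℂ) = y := by
      linear_combination (-Complex.I / 2 : ℂ) * h3 + (x - y : ℂ) * Complex.I_sq
    exact_mod_cast h4
  refine (infinite_univ.image hinj).mono ?_
  rintro _ ⟨y, -, rfl⟩
  have h1 := discFun_apply d P y
  rw [hP, homEval] at h1
  have h2 : (((Real.sqrt (2 * Real.pi))⁻¹ : ℝ) : ℂ) ≠ 0 := by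
    have : (Real.sqrt (2 * Real.pi))⁻¹ ≠ 0 := by positivity
    exact_mod_cast this
  have h3 := (mul_eq_zero.1 h1.symm).resolve_left h2
  exact (mul_eq_zero.1 h3).resolve_left (inv_ne_zero (pow_ne_zero _ (one_sub_I_mul_ne_zero y)))

/-! ## The group action in the coordinate of the disc -/

/-- The numerator of the disc coordinate of the image of `w`. -/
def discNum (g : SL(2, ℝ)) (w : ℂ) : ℂ :=
  (g 0 0 + Complex.I * g 0 1) + (Complex.I * g 1 0 - g 1 1) * w

/-- The denominator of the disc coordinate of the image of `w`. -/
def discDen (g : SL(2, ℝ)) (w : ℂ) : ℂ :=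
  (g 0 0 - Complex.I * g 0 1) + (Complex.I * g 1 0 + g 1 1) * w

theorem denominator_ne_zero_of_re_pos (g : SL(2, ℝ)) {w : ℂ} (hw : 0 < w.re) :
    (g 0 0 + Complex.I * g 1 0 * w : ℂ) ≠ 0 := by
  have := autFactor_ne_zero g⁻¹ (v := (starRingEnd ℂ) w) (by simpa using hw)
  intro h
  apply this
  have h' := congrArg (starRingEnd ℂ) h
  simpa [autFactor, Matrix.SpecialLinearGroup.coe_inv, Matrix.adjugate_fin_two] using h'

/-- By homogeneity the Möbius denominator cancels against the automorphy factor. What remains is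
linear in w, with no singularity where p + i r w vanishes. -/
theorem slash_homEval {d : ℕ} (g : SL(2, ℝ)) (P : ℂ[X]) {w : ℂ}
    (hw0 : (g 0 0 + Complex.I * g 1 0 * w : ℂ) ≠ 0) :
    slash d g (fun w => homEval d P (1 - w) (1 + w)) w = homEval d P (discNum g w) (discDen g w) := by
  set a : ℂ := g 0 0 + Complex.I * g 1 0 * w with ha
  set b : ℂ := g 1 1 * w - Complex.I * g 0 1 with hb
  have e1 : discNum g w = a - b := by rw [discNum, ha, hb]; ring
  have e2 : discDen g w = a + b := by rw [discDen, ha, hb]; ring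
  have e3 : 1 - b / a = (a - b) / a := by field_simp
  have e4 : 1 + b / a = (a + b) / a := by field_simp
  change (a ^ (d + 1))⁻¹ * homEval d P (1 - b / a) (1 + b / a) = _
  rw [e1, e2, e3, e4, homEval, homEval, div_div_div_cancel_right₀ hw0, div_pow, inv_div]
  field_simp

theorem laplace_kirillovRep_discVec (d : ℕ) (g : SL(2, ℝ)) (P : ℂ[X]) {w : ℂ} (hw : 0 < w.re) :
    laplace d (kirillovRep d g (discVec d P)) w =
      homEval d P (discNum g w) (discDen g w) := by
  rw [← slash_homEval g P (denominator_ne_zero_of_re_pos g hw),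
    laplace_kirillovRep_eq_slash g _ (EventuallyEq.refl _ _) hw, slash, slash,
    laplace_discVec d P (mobius_re_nonneg g hw.le)]

theorem discDen_line_ne_zero (g : SL(2, ℝ)) (z : ℝ) : discDen g (-(Complex.I * z)) ≠ 0 := by
  intro h
  have h1 := congrArg Complex.re h
  have h2 := congrArg Complex.im h
  simp [discDen] at h1 h2
  have h3 := det_eq g
  have e1 : g 0 0 = -(g 1 0 * z) := by linarith
  have e2 : g 0 1 = -(g 1 1 * z) := by linarith
  rw [e1, e2] at h3
  ring_nf at h3
  norm_num at h3

/-- Both sides are continuous and agree almost everywhere, so the formula also holds at the point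
where π_d is defined by a limit. -/
theorem indAct_discFun (d : ℕ) (g : SL(2, ℝ)) (P : ℂ[X]) (z : ℝ) :
    indAct d g (discFun d P) z = (((Real.sqrt (2 * Real.pi))⁻¹ : ℝ) : ℂ) *
      homEval d P (discNum g (-(Complex.I * z))) (discDen g (-(Complex.I * z))) := by
  have h1 : ContDiff ℝ ∞ fun x : ℝ => (x : ℂ) := Complex.ofRealCLM.contDiff
  have hc1 : Continuous (indAct d g (discFun d P)) := (indAct_mem g (discFun d P).2).1.continuous
  have hc2 : Continuous fun z : ℝ => (((Real.sqrt (2 * Real.pi))⁻¹ : ℝ) : ℂ) *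
      homEval d P (discNum g (-(Complex.I * z))) (discDen g (-(Complex.I * z))) :=
    (contDiff_const.mul (contDiff_homEval P
      (contDiff_const.add (contDiff_const.mul (contDiff_const.mul h1).neg))
      (contDiff_const.add (contDiff_const.mul (contDiff_const.mul h1).neg))
      (discDen_line_ne_zero g))).continuous
  have hae : indAct d g (discFun d P) =ᵐ[volume] fun z : ℝ =>
      (((Real.sqrt (2 * Real.pi))⁻¹ : ℝ) : ℂ) *
        homEval d P (discNum g (-(Complex.I * z))) (discDen g (-(Complex.I * z))) := by
    filter_upwards [indAct_ae_eq d g (discFun d P), ae_denominator_ne_zero g] with x hx hx0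
    have h2 := denominator_ne_zero hx0 0
    rw [Complex.ofReal_zero, zero_sub] at h2
    have h3 := mobius_re_nonneg g (w := -(Complex.I * x)) (by simp)
    rw [hx, discFun_eq_T, indFormula_T, ← slash_homEval g P h2, slash, slash,
      laplace_laguerre d P h3]
  exact congrFun ((hc1.ae_eq_iff_eq volume hc2).1 hae) z

/-- The complex number `p + i q` attached to the matrix with first row `(p, q)`. -/
def rotNum (g : SL(2, ℝ)) : ℂ := g 0 0 + Complex.I * g 0 1

theorem SO2_entries {k : SL(2, ℝ)} (hk : k ∈ SO2) :
    k 1 1 = k 0 0 ∧ k 1 0 = -k 0 1 ∧ k 0 0 ^ 2 + k 0 1 ^ 2 = 1 := by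
  have h : (k : Matrix (Fin 2) (Fin 2) ℝ) * star (k : Matrix (Fin 2) (Fin 2) ℝ) = 1 :=
    (Matrix.mem_orthogonalGroup_iff _ _).1 hk
  have h00 := congrFun (congrFun h 0) 0
  have h01 := congrFun (congrFun h 0) 1
  simp [Matrix.mul_apply, Fin.sum_univ_two, Matrix.star_apply] at h00 h01
  have hdet := det_eq k
  refine ⟨?_, ?_, by linarith⟩
  · linear_combination k 1 1 * (-h00) + k 0 1 * h01 + k 0 0 * hdet
  · linear_combination k 1 0 * (-h00) + k 0 0 * h01 - k 0 1 * hdet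

theorem rotNum_mul_conj (k : SO2) : rotNum k * (starRingEnd ℂ) (rotNum k) = 1 := by
  obtain ⟨-, -, h⟩ := SO2_entries k.2
  have : ((k : SL(2, ℝ)) 0 0 : ℂ) ^ 2 + ((k : SL(2, ℝ)) 0 1 : ℂ) ^ 2 = 1 := by exact_mod_cast h
  simp only [rotNum, map_add, map_mul, Complex.conj_ofReal, Complex.conj_I]
  linear_combination this - ((k : SL(2, ℝ)) 0 1 : ℂ) ^ 2 * Complex.I_sq

theorem rotNum_ne_zero (k : SO2) : rotNum k ≠ 0 := by
  intro h
  have := rotNum_mul_conj k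
  simp [h] at this

theorem rotNum_mul (k l : SO2) : rotNum ((k * l : SO2) : SL(2, ℝ)) = rotNum k * rotNum l := by
  obtain ⟨h1, h2, -⟩ := SO2_entries l.2
  simp only [rotNum, Subgroup.coe_mul, Matrix.SpecialLinearGroup.coe_mul, Matrix.mul_apply,
    Fin.sum_univ_two, h1, h2]
  push_cast
  linear_combination (-((k : SL(2, ℝ)) 0 1 : ℂ) * ((l : SL(2, ℝ)) 0 1 : ℂ)) * Complex.I_sq

/-- The action of `K` on polynomials in the coordinate of the disc. -/
def rotAct (d : ℕ) (a : ℂ) : Module.End ℂ ℂ[X] :=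
  a ^ (d + 1) • (aeval (C (a ^ 2) * X : ℂ[X])).toLinearMap

theorem rotAct_apply (d : ℕ) (a : ℂ) (P : ℂ[X]) :
    rotAct d a P = a ^ (d + 1) • P.comp (C (a ^ 2) * X) := by
  rw [rotAct, LinearMap.smul_apply, AlgHom.toLinearMap_apply, comp, aeval_def, algebraMap_eq]

/-- The group K fixes w = 1, the centre of the disc. For a = p + i q of modulus 1, numerator and
denominator become a(1-w) and a⁻¹(1+w), so ζ is multiplied by a² and the factor a^(d+1) comes out.
-/
theorem homEval_discNum_SO2 (d : ℕ) (k : SO2) (P : ℂ[X]) (w : ℂ) :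
    homEval d P (discNum k w) (discDen k w) =
      homEval d (rotAct d (rotNum k) P) (1 - w) (1 + w) := by
  obtain ⟨h1, h2, -⟩ := SO2_entries k.2
  have h3 := rotNum_mul_conj k
  have h0 := rotNum_ne_zero k
  have e1 : discNum k w = rotNum k * (1 - w) := by
    rw [discNum, rotNum, h1, h2]; push_cast; ring
  have e2 : discDen k w = (rotNum k)⁻¹ * (1 + w) := by
    rw [← eq_inv_of_mul_eq_one_right h3, discDen, rotNum, h1, h2]
    simp only [map_add, map_mul, Complex.conj_ofReal, Complex.conj_I]
    push_cast; ring
  rw [e1, e2, rotAct_apply, homEval_smul, homEval, homEval, eval_comp, mul_pow, mul_inv, inv_pow,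
    inv_inv, mul_assoc]
  congr 3
  simp only [eval_mul, eval_C, eval_X]
  rw [mul_div_mul_comm, div_inv_eq_mul, sq]

theorem kirillovRep_discVec (d : ℕ) (k : SO2) (P : ℂ[X]) :
    kirillovRep d k (discVec d P) = discVec d (rotAct d (rotNum k) P) := by
  refine ext_laplace (d := d) fun w hw => ?_
  rw [laplace_kirillovRep_discVec d _ P hw, homEval_discNum_SO2, laplace_discVec d _ hw.le]

theorem indRep_discFun (d : ℕ) (k : SO2) (P : ℂ[X]) :
    indRep d k (discFun d P) = discFun d (rotAct d (rotNum k) P) := by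
  ext z
  change indAct d k (discFun d P) z = _
  rw [indAct_discFun, homEval_discNum_SO2, discFun_apply, sub_neg_eq_add, ← sub_eq_add_neg]

/-! ## Completeness of the functions `x^((d+1)/2) e^(-x) p(x)` -/

theorem integrable_pow_mul_laplace {d : ℕ} (F : KirillovSpace) (n : ℕ) {w : ℂ} (hw : 0 < w.re) :
    IntegrableOn (fun x : ℝ => ((x ^ (((d : ℝ) - 1) / 2) : ℝ) : ℂ) * F x *
      ((x : ℂ) ^ n * Complex.exp (-(w * x)))) (Ioi 0) := by
  have h := integrable_weighted_pairing (d := d)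
    ((isSchwartzHalfLine_exp (w := (starRingEnd ℂ) w) (by simpa using hw)).pow_mul n) F
  simpa only [map_mul, map_pow, Complex.conj_ofReal, conj_exp] using h

/-- The vanishing of all `∫ x^((d-1)/2) F(x) x^n e^(-w x) dx` propagates along vertical lines. -/
theorem moments_step {d : ℕ} {F : KirillovSpace} {w : ℂ} (hw : w.re = 1)
    (h : ∀ n : ℕ, ∫ x in Ioi (0 : ℝ), ((x ^ (((d : ℝ) - 1) / 2) : ℝ) : ℂ) * F x *
      ((x : ℂ) ^ n * Complex.exp (-(w * x))) = 0) {t : ℝ} (ht : |t| ≤ 1 / 2) (n : ℕ) :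
    ∫ x in Ioi (0 : ℝ), ((x ^ (((d : ℝ) - 1) / 2) : ℝ) : ℂ) * F x *
      ((x : ℂ) ^ n * Complex.exp (-((w + Complex.I * t) * x))) = 0 := by
  set u : ℝ → ℂ := fun x => ((x ^ (((d : ℝ) - 1) / 2) : ℝ) : ℂ) * F x with hu
  -- The terms of the power series of e^(-itx), integrated one by one; each integral is a vanishing
  -- moment.
  set G : ℕ → ℝ → ℂ := fun k x => (-(Complex.I * t)) ^ k / k.factorial *
    (u x * ((x : ℂ) ^ (n + k) * Complex.exp (-(w * x)))) with hG
  have hw0 : 0 < w.re := by rw [hw]; exact one_pos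
  have hG0 : ∀ k, ∫ x in Ioi (0 : ℝ), G k x = 0 := by
    intro k
    rw [hG]
    simp only
    rw [integral_const_mul, h (n + k), mul_zero]
  set b : ℕ → ℝ → ℝ := fun k x =>
    ‖u x‖ * (x ^ n * Real.exp (-x)) * ((|t| * x) ^ k / k.factorial) with hb
  have hbsum : ∀ x, HasSum (fun k => b k x)
      (‖u x‖ * (x ^ n * Real.exp (-x)) * Real.exp (|t| * x)) := by
    intro x
    have h1 := (NormedSpace.expSeries_div_hasSum_exp (|t| * x)).mul_left
      (‖u x‖ * (x ^ n * Real.exp (-x)))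
    rwa [← Real.exp_eq_exp_ℝ] at h1
  have hGsum : ∀ x : ℝ, HasSum (fun k => G k x)
      (u x * ((x : ℂ) ^ n * Complex.exp (-((w + Complex.I * t) * x)))) := by
    intro x
    have h1 := (NormedSpace.expSeries_div_hasSum_exp (-(Complex.I * t) * x)).mul_left
      (u x * ((x : ℂ) ^ n * Complex.exp (-(w * x))))
    rw [← Complex.exp_eq_exp_ℂ] at h1
    have e : u x * ((x : ℂ) ^ n * Complex.exp (-((w + Complex.I * t) * x))) =
        u x * ((x : ℂ) ^ n * Complex.exp (-(w * x))) * Complex.exp (-(Complex.I * t) * x) := by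
      rw [show -((w + Complex.I * t) * (x : ℂ)) = -(w * x) + -(Complex.I * t) * x by ring,
        Complex.exp_add]
      ring
    rw [e]
    refine h1.congr_fun ?_
    intro k
    simp only [hG]
    ring
  have key := hasSum_integral_of_dominated_convergence (μ := volume.restrict (Ioi (0 : ℝ))) b
    (F := G) (f := fun x => u x * ((x : ℂ) ^ n * Complex.exp (-((w + Complex.I * t) * x))))
    (fun k => ((integrable_pow_mul_laplace F (n + k) hw0).const_mul _).aestronglyMeasurable)
    (fun k => ?_) (ae_of_all _ fun x => (hbsum x).summable) ?_ (ae_of_all _ hGsum)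
  · simp only [hG0] at key
    exact key.unique hasSum_zero
  · filter_upwards [ae_restrict_mem measurableSet_Ioi] with x hx
    have hx0 : (0 : ℝ) < x := hx
    refine le_of_eq ?_
    simp only [hG, hb, norm_mul, norm_div, norm_pow, norm_neg, Complex.norm_I, one_mul,
      Complex.norm_real, Real.norm_eq_abs, abs_of_pos hx0, Complex.norm_natCast, Complex.norm_exp]
    simp only [Complex.neg_re, Complex.mul_re, hw, Complex.ofReal_re, Complex.ofReal_im, mul_zero,
      sub_zero, one_mul]
    ring
  · simp only [fun x => (hbsum x).tsum_eq]
    -- The majorants sum to the absolute value of the integrand at the real point 1 - |t|, which is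
    -- positive.
    have h2 := (integrable_pow_mul_laplace (d := d) F n (w := ((1 - |t| : ℝ) : ℂ))
      (by rw [Complex.ofReal_re]; linarith)).norm
    refine h2.congr ?_
    filter_upwards [ae_restrict_mem measurableSet_Ioi] with x hx
    have hx0 : (0 : ℝ) < x := hx
    have e : Real.exp (-((1 - |t|) * x)) = Real.exp (-x) * Real.exp (|t| * x) := by
      rw [← Real.exp_add]; congr 1; ring
    rw [norm_mul, norm_mul ((x : ℂ) ^ n), norm_pow, Complex.norm_real, Real.norm_of_nonneg hx0.le,
      Complex.norm_exp, ← Complex.ofReal_mul, ← Complex.ofReal_neg, Complex.ofReal_re, e]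
    ring

/-- Orthogonality to the polynomial vectors kills all moments at w = 1. Steps of length at most 1/2
carry this along the whole line Re w = 1, where the Laplace transform determines F. -/
theorem eq_zero_of_inner_polyVec {d : ℕ} {F : KirillovSpace}
    (h : ∀ p : ℂ[X], inner ℂ (polyVec d p) F = 0) : F = 0 := by
  have h0 : ∀ n : ℕ, ∫ x in Ioi (0 : ℝ), ((x ^ (((d : ℝ) - 1) / 2) : ℝ) : ℂ) * F x *
      ((x : ℂ) ^ n * Complex.exp (-((1 : ℂ) * x))) = 0 := by
    intro n
    have h1 := h (X ^ n)
    have h2 := inner_weighted (d := d) (isSchwartzHalfLine_poly (X ^ n)) F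
    have h3 : inner ℂ (polyVec d (X ^ n)) F = _ := h2
    rw [h1] at h3
    rw [h3]
    congr 1; ext x
    have := conj_exp 1 x
    rw [map_one] at this
    simp only [eval_pow, eval_X, map_mul, map_pow, Complex.conj_ofReal, this]
  have hline : ∀ (t : ℝ), |t| ≤ 1 / 2 → ∀ j n : ℕ,
      ∫ x in Ioi (0 : ℝ), ((x ^ (((d : ℝ) - 1) / 2) : ℝ) : ℂ) * F x *
      ((x : ℂ) ^ n * Complex.exp (-((1 + j * (Complex.I * t)) * x))) = 0 := by
    intro t ht j
    induction j with
    | zero => simpa using h0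
    | succ j ih =>
      intro n
      have := moments_step (w := 1 + j * (Complex.I * t)) (by simp) ih ht n
      rw [← this]
      push_cast
      congr 1; ext x
      ring_nf
  refine eq_zero_of_laplace_eq_zero (d := d) fun w hw => ?_
  -- With m steps from 1 to w, each has length |Im w|/m < 1/2.
  obtain ⟨m, hm⟩ := exists_nat_gt (2 * |w.im|)
  have hm0 : (0 : ℝ) < m := lt_of_le_of_lt (by positivity) hm
  have ht : |w.im / m| ≤ 1 / 2 := by
    rw [abs_div, Nat.abs_cast, div_le_iff₀ hm0]
    linarith
  have key := hline (w.im / m) ht m 0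
  have e : (1 + m * (Complex.I * ((w.im / m : ℝ) : ℂ))) = w := by
    have hmc : (m : ℂ) ≠ 0 := by exact_mod_cast hm0.ne'
    push_cast
    field_simp
    apply Complex.ext <;> simp [hw]
  rw [e] at key
  simpa [laplace] using key

/-! ## The `K`-finite vectors -/

/-- The map q ↦ q(ρ(k)) v goes from the infinite-dimensional ℂ[X] to the finite-dimensional span of
K v, so it has a kernel. -/
theorem exists_aeval_eq_zero_of_mem_kFinite {E : Type*} [AddCommGroup E] [Module ℂ E]
    {ρ : Representation ℂ SL(2, ℝ) E} {v : E} (hv : v ∈ kFinite ρ) (k : SO2) :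
    ∃ q : ℂ[X], q ≠ 0 ∧ aeval (ρ k) q v = 0 := by
  have hv' : FiniteDimensional ℂ (Submodule.span ℂ (Set.range fun k : SO2 => ρ k v)) := hv
  set L : ℂ[X] →ₗ[ℂ] E :=
    (LinearMap.applyₗ v).comp (aeval (ρ (k : SL(2, ℝ)))).toLinearMap with hL
  have hmem : ∀ q, L q ∈ Submodule.span ℂ (Set.range fun k : SO2 => ρ k v) := by
    intro q
    induction q using Polynomial.induction_on' with
    | add p q hp hq => rw [map_add]; exact Submodule.add_mem _ hp hq
    | monomial n a =>
      have e : L (monomial n a) = a • ρ ((k ^ n : SO2) : SL(2, ℝ)) v := by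
        simp [hL, aeval_monomial]
      rw [e]
      exact Submodule.smul_mem _ _ (Submodule.subset_span ⟨k ^ n, rfl⟩)
  by_contra! hcon
  have hinj : Function.Injective (L.codRestrict _ hmem) := by
    rw [injective_iff_map_eq_zero]
    intro q hq
    by_contra hq0
    exact hcon q hq0 (congrArg Subtype.val hq)
  exact Polynomial.not_finite (R := ℂ) (Module.Finite.of_injective _ hinj)

theorem finiteDimensional_degreeLT (n : ℕ) : FiniteDimensional ℂ (degreeLT ℂ n) :=
  Module.Finite.equiv (degreeLTEquiv ℂ n).symm

theorem rotAct_mem_degreeLT (d : ℕ) (a : ℂ) {n : ℕ} {P : ℂ[X]} (hP : P ∈ degreeLT ℂ n) :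
    rotAct d a P ∈ degreeLT ℂ n := by
  rw [rotAct_apply]
  refine Submodule.smul_mem _ _ ?_
  rw [mem_degreeLT, degree_lt_iff_coeff_zero] at hP ⊢
  intro m hm
  rw [comp_C_mul_X_coeff, hP m hm, zero_mul]

theorem rotAct_orbit_finite (d : ℕ) (P : ℂ[X]) : FiniteDimensional ℂ
    (Submodule.span ℂ (Set.range fun k : SO2 => rotAct d (rotNum k) P)) := by
  have := finiteDimensional_degreeLT (P.natDegree + 1)
  refine Submodule.finiteDimensional_of_le (S₂ := degreeLT ℂ (P.natDegree + 1))
    (Submodule.span_le.2 ?_)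
  rintro _ ⟨k, rfl⟩
  refine rotAct_mem_degreeLT d _ (mem_degreeLT.2 ?_)
  exact (degree_le_natDegree).trans_lt (by exact_mod_cast Nat.lt_succ_self _)

theorem mem_kFinite_of_intertwining {d : ℕ} {E : Type*} [AddCommGroup E] [Module ℂ E]
    {ρ : Representation ℂ SL(2, ℝ) E} {A : ℂ[X] →ₗ[ℂ] E}
    (hA : ∀ (k : SO2) (P : ℂ[X]), ρ k (A P) = A (rotAct d (rotNum k) P)) (P : ℂ[X]) :
    A P ∈ kFinite ρ := by
  have := rotAct_orbit_finite d P
  change FiniteDimensional ℂ (Submodule.span ℂ (Set.range fun k : SO2 => ρ k (A P)))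
  have e : (Set.range fun k : SO2 => ρ k (A P)) =
      A '' Set.range fun k : SO2 => rotAct d (rotNum k) P := by
    rw [← range_comp]
    congr 1; ext k
    exact hA k P
  rw [e, ← Submodule.map_span]
  infer_instance

/-- The rotation by one radian. -/
def unitRotation : SO2 :=
  ⟨⟨!![Real.cos 1, Real.sin 1; -Real.sin 1, Real.cos 1], by
    rw [Matrix.det_fin_two]; simp [← sq]⟩, by
    refine (Matrix.mem_orthogonalGroup_iff _ _).2 ?_
    ext i j
    fin_cases i <;> fin_cases j <;>
      simp [Matrix.mul_apply, Fin.sum_univ_two, ← sq] <;> ring⟩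

theorem rotNum_unitRotation : rotNum unitRotation = Complex.exp Complex.I := by
  have e : rotNum unitRotation = (Real.cos 1 : ℂ) + Complex.I * (Real.sin 1 : ℂ) := rfl
  rw [e, ← one_mul Complex.I, Complex.exp_mul_I]
  push_cast; ring

/-- The eigenvalue of the rotation by one radian on the `m`-th weight vector. -/
def weightChar (d m : ℕ) : ℂ := Complex.exp Complex.I ^ (d + 1 + 2 * m)

/-- Equality of two characters would make π rational. Thus one rotation separates all weights, and
no integration over K is needed. -/
theorem weightChar_injective (d : ℕ) : Function.Injective (weightChar d) := by
  intro m n hmn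
  simp only [weightChar, ← Complex.exp_nat_mul] at hmn
  obtain ⟨j, hj⟩ := Complex.exp_eq_exp_iff_exists_int.1 hmn
  have h1 : ((m : ℝ) - n) = j * Real.pi := by
    have := congrArg Complex.im hj
    simp at this
    linarith
  by_contra hne
  have hj0 : j ≠ 0 := by
    rintro rfl
    apply hne
    have : (m : ℝ) = n := by simpa [sub_eq_zero] using h1
    exact_mod_cast this
  refine irrational_pi ⟨((m : ℚ) - n) / j, ?_⟩
  have : (j : ℝ) ≠ 0 := by exact_mod_cast hj0
  push_cast
  rw [h1]
  field_simp

theorem rotAct_X_pow (d : ℕ) (a : ℂ) (m : ℕ) :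
    rotAct d a (X ^ m) = a ^ (d + 1 + 2 * m) • X ^ m := by
  rw [rotAct_apply, X_pow_comp, mul_pow, ← C_pow, ← smul_eq_C_mul, smul_smul, ← pow_mul, ← pow_add]

/-- The functional `⟨v_m, ·⟩` for the `m`-th weight vector `v_m`. -/
def weightFunctional (d m : ℕ) : KirillovSpace →L[ℂ] ℂ := innerSL ℂ (discVec d (X ^ m))

theorem norm_weightChar (d m : ℕ) : (starRingEnd ℂ) (weightChar d m) * weightChar d m = 1 := by
  rw [← Complex.normSq_eq_conj_mul_self, Complex.normSq_eq_norm_sq, weightChar, norm_pow,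
    Complex.norm_exp]
  simp

theorem kirillovRep_weight (d m : ℕ) : kirillovRep d unitRotation (discVec d (X ^ m)) =
    weightChar d m • discVec d (X ^ m) := by
  rw [kirillovRep_discVec, rotNum_unitRotation, rotAct_X_pow, map_smul]; rfl

theorem weightFunctional_kirillovRep (d m : ℕ) (F : KirillovSpace) :
    weightFunctional d m (kirillovRep d unitRotation F) =
      weightChar d m * weightFunctional d m F := by
  have h := inner_kirillovRep d unitRotation (discVec d (X ^ m)) F
  rw [kirillovRep_weight, inner_smul_left] at h
  change inner ℂ (discVec d (X ^ m)) _ = _ * inner ℂ (discVec d (X ^ m)) F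
  rw [← h, ← mul_assoc, mul_comm (weightChar d m), norm_weightChar, one_mul]

theorem weightFunctional_aeval (d m : ℕ) (q : ℂ[X]) (F : KirillovSpace) :
    weightFunctional d m (aeval (kirillovRep d (unitRotation : SL(2, ℝ))) q F) =
      q.eval (weightChar d m) * weightFunctional d m F := by
  induction q using Polynomial.induction_on' with
  | add p q hp hq => rw [map_add, LinearMap.add_apply, map_add, hp, hq, eval_add, add_mul]
  | monomial n a =>
    have h : ∀ n : ℕ, weightFunctional d m
        ((kirillovRep d (unitRotation : SL(2, ℝ)) ^ n : Module.End ℂ KirillovSpace) F) =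
        weightChar d m ^ n * weightFunctional d m F := by
      intro n
      induction n with
      | zero => simp
      | succ n ih =>
        rw [pow_succ', Module.End.mul_apply, weightFunctional_kirillovRep, ih, pow_succ']
        ring
    rw [aeval_monomial, eval_monomial, Module.End.mul_apply, Module.algebraMap_end_apply, map_smul,
      h, smul_eq_mul, mul_assoc]

theorem weightFunctional_weight {d m n : ℕ} (hmn : m ≠ n) :
    weightFunctional d m (discVec d (X ^ n)) = 0 := by
  have h := weightFunctional_kirillovRep d m (discVec d (X ^ n))
  rw [kirillovRep_weight, map_smul, smul_eq_mul] at h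
  have h2 : (weightChar d n - weightChar d m) * weightFunctional d m (discVec d (X ^ n)) = 0 := by
    rw [sub_mul, h, sub_self]
  refine (mul_eq_zero.1 h2).resolve_left (sub_ne_zero.2 fun h3 => hmn ?_)
  exact (weightChar_injective d h3).symm

theorem eq_zero_of_weightFunctional {d : ℕ} {F : KirillovSpace}
    (h : ∀ m, weightFunctional d m F = 0) : F = 0 := by
  refine eq_zero_of_inner_polyVec (d := d) fun p => ?_
  obtain ⟨P, rfl⟩ := laguerre_surjective d p
  change inner ℂ (discVec d P) F = 0
  induction P using Polynomial.induction_on' with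
  | add p q hp hq => rw [map_add, inner_add_left, hp, hq, add_zero]
  | monomial n a =>
    rw [← mul_one a, ← smul_eq_mul, ← smul_monomial, map_smul, inner_smul_left,
      monomial_one_right_eq_X_pow]
    exact mul_eq_zero_of_right _ (h n)

/-- Each nonzero weight component forces its character to be a root of q, so only finitely many
occur. Subtracting the projection onto the span of these weight vectors leaves a vector orthogonal
to all weight vectors, which is 0 by completeness. -/
theorem mem_range_discVec_of_aeval {d : ℕ} {F : KirillovSpace} {q : ℂ[X]} (hq : q ≠ 0)
    (h : aeval (kirillovRep d (unitRotation : SL(2, ℝ))) q F = 0) :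
    F ∈ LinearMap.range (discVec d) := by
  have hfin : {m | weightFunctional d m F ≠ 0}.Finite := by
    refine ((q.rootSet_finite ℂ).preimage (weightChar_injective d).injOn).subset fun m hm => ?_
    have h1 := weightFunctional_aeval d m q F
    rw [h, map_zero] at h1
    rw [mem_preimage, mem_rootSet]
    refine ⟨hq, ?_⟩
    rw [coe_aeval_eq_eval]
    exact (mul_eq_zero.1 h1.symm).resolve_right hm
  set W : Submodule ℂ KirillovSpace :=
    Submodule.span ℂ ((fun m => discVec d (X ^ m)) '' {m | weightFunctional d m F ≠ 0}) with hW
  have : FiniteDimensional ℂ W := FiniteDimensional.span_of_finite ℂ (hfin.image _)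
  have hWle : W ≤ LinearMap.range (discVec d) := by
    refine Submodule.span_le.2 ?_
    rintro _ ⟨m, -, rfl⟩
    exact ⟨_, rfl⟩
  have key : F - W.starProjection F = 0 := by
    refine eq_zero_of_weightFunctional (d := d) fun m => ?_
    by_cases hm : weightFunctional d m F = 0
    · have hker : W ≤ LinearMap.ker (weightFunctional d m).toLinearMap := by
        refine Submodule.span_le.2 ?_
        rintro _ ⟨n, hn, rfl⟩
        refine weightFunctional_weight ?_
        rintro rfl
        exact hn hm
      rw [map_sub, hm, zero_sub, neg_eq_zero]
      exact hker (W.starProjection_apply_mem F)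
    · have hmem : discVec d (X ^ m) ∈ W := Submodule.subset_span ⟨m, hm, rfl⟩
      exact (Submodule.mem_orthogonal _ _).1 (W.sub_starProjection_mem_orthogonal F) _ hmem
  rw [sub_eq_zero.1 key]
  exact hWle (W.starProjection_apply_mem F)

theorem kFinite_kirillovRep (d : ℕ) : kFinite (kirillovRep d) = LinearMap.range (discVec d) := by
  refine le_antisymm (fun F hF => ?_) ?_
  · obtain ⟨q, hq, h⟩ := exists_aeval_eq_zero_of_mem_kFinite hF unitRotation
    exact mem_range_discVec_of_aeval hq h
  · rintro _ ⟨P, rfl⟩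
    exact mem_kFinite_of_intertwining (kirillovRep_discVec d) P

/-! ### The `K`-finite vectors of I_d^+ -/

theorem integrable_M {φ : ℝ → ℂ} (hφ : Integrable φ) (y : ℝ) : Integrable fun x : ℝ =>
    φ x * Complex.exp (-(Complex.I * (((1 : ℤˣ) : ℤ) : ℂ) * x * y)) := by
  refine Integrable.mono hφ (hφ.aestronglyMeasurable.mul
    (Continuous.aestronglyMeasurable (by fun_prop))) (ae_of_all _ fun x => ?_)
  rw [norm_mul, Complex.norm_exp]
  simp

theorem M_add {d : ℕ} {φ χ : ℝ → ℂ} (hφ : Integrable φ) (hχ : Integrable χ) (y : ℝ) :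
    M d 1 (φ + χ) y = M d 1 φ y + M d 1 χ y := by
  simp only [M, ← mul_add]
  rw [← integral_add (integrable_M hφ y) (integrable_M hχ y)]
  congr 2; ext x
  rw [Pi.add_apply]; ring

theorem M_smul (d : ℕ) (c : ℂ) (φ : ℝ → ℂ) (y : ℝ) : M d 1 (c • φ) y = c * M d 1 φ y := by
  simp only [M]
  rw [mul_left_comm, ← integral_const_mul c]
  congr 1
  refine integral_congr_ae (ae_of_all _ fun x => ?_)
  simp only [Pi.smul_apply, smul_eq_mul]; ring

/-- Carries polynomial relations from I_d to the Kirillov space. Integrability is proved along with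
the identity because M is additive only on integrable functions. -/
theorem aeval_indRep_ae {d : ℕ} (hd : 0 < d) {f : ℝ → ℂ} (hf : f ∈ schwartzD d)
    {F : KirillovSpace} (hF : F =ᵐ[mulMeasure] f) {φ : indSpace d}
    (hφ : (φ : ℝ → ℂ) = T d 1 f) (k : SL(2, ℝ)) (q : ℂ[X]) :
    Integrable (aeval (indRep d k) q φ : ℝ → ℂ) ∧
      aeval (kirillovRep d k) q F =ᵐ[mulMeasure] M d 1 (aeval (indRep d k) q φ : ℝ → ℂ) := by
  induction q using Polynomial.induction_on' with
  | add p q hp hq =>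
    rw [map_add, map_add, LinearMap.add_apply, LinearMap.add_apply, Submodule.coe_add]
    refine ⟨hp.1.add hq.1, ?_⟩
    filter_upwards [Lp.coeFn_add (aeval (kirillovRep d k) p F) (aeval (kirillovRep d k) q F),
      hp.2, hq.2] with y h1 h2 h3
    rw [h1, M_add hp.1 hq.1, Pi.add_apply, h2, h3]
  | monomial n a =>
    have e1 : aeval (indRep d k) (monomial n a) φ = a • indRep d (k ^ n) φ := by
      simp [aeval_monomial]
    have e2 : aeval (kirillovRep d k) (monomial n a) F = a • kirillovRep d (k ^ n) F := by
      simp [aeval_monomial]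
    have e3 : (indRep d (k ^ n) φ : ℝ → ℂ) = indAct d (k ^ n) (T d 1 f) := by
      rw [← hφ]; rfl
    rw [e1, e2, Submodule.coe_smul, e3]
    refine ⟨(integrable_indAct_T hd _ hf).smul a, ?_⟩
    filter_upwards [Lp.coeFn_smul a (kirillovRep d (k ^ n) F), kirillovRep_ae_eq hd (k ^ n) hf hF]
      with y h1 h2
    rw [h1, M_smul, Pi.smul_apply, h2, smul_eq_mul]

/-- An annihilating polynomial for φ = T f also annihilates the class of f, which is then a
polynomial vector; T depends on f only up to null sets. -/
theorem kFinite_indRep_inf_indPlus {d : ℕ} (hd : 0 < d) :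
    kFinite (indRep d) ⊓ indPlus d = LinearMap.range (discFun d) := by
  refine le_antisymm ?_ ?_
  · rintro φ ⟨hφ, f, hf, hφf⟩
    obtain ⟨q, hq, h⟩ := exists_aeval_eq_zero_of_mem_kFinite hφ unitRotation
    set F : KirillovSpace := (memLp_of_mem_schwartzD hf).toLp f with hFdef
    have hF : F =ᵐ[mulMeasure] f := MemLp.coeFn_toLp _
    have h0 : aeval (kirillovRep d (unitRotation : SL(2, ℝ))) q F = 0 := by
      refine Lp.ext (((aeval_indRep_ae hd hf hF hφf unitRotation q).2).trans ?_)
      refine EventuallyEq.trans ?_ (Lp.coeFn_zero ℂ 2 mulMeasure).symm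
      rw [h]
      refine ae_of_all _ fun y => ?_
      simp [M]
    obtain ⟨P, hP⟩ := mem_range_discVec_of_aeval hq h0
    exact ⟨P, (discFun_eq_of_laplace hφf (by rw [hP]; exact hF.symm)).symm⟩
  · rintro _ ⟨P, rfl⟩
    exact ⟨mem_kFinite_of_intertwining (indRep_discFun d) P, discFun_mem_indPlus d P⟩

theorem mem_kFinite_kirillovRep_iff {d : ℕ} (F : KirillovSpace) :
    F ∈ kFinite (kirillovRep d) ↔ ∃ p : ℂ[X], F =ᵐ[mulMeasure] polyExp d p := by
  rw [kFinite_kirillovRep, range_discVec]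
  constructor
  · rintro ⟨p, rfl⟩
    exact ⟨p, polyVec_ae_polyExp d p⟩
  · rintro ⟨p, hp⟩
    exact ⟨p, Lp.ext ((polyVec_ae_polyExp d p).trans hp.symm)⟩

/-! ## The `(𝔤, K)`-module of polynomials in the coordinate of the disc -/

open scoped Matrix.Norms.Operator in
theorem hasDerivAt_expSL (X : sl2) (i j : Fin 2) :
    HasDerivAt (fun t : ℝ => expSL (t • X) i j) ((X : Matrix (Fin 2) (Fin 2) ℝ) i j) 0 := by
  have h : HasDerivAt (fun t : ℝ => NormedSpace.exp (t • (X : Matrix (Fin 2) (Fin 2) ℝ)))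
      (X : Matrix (Fin 2) (Fin 2) ℝ) 0 := by
    have := hasDerivAt_exp_smul_const (𝕂 := ℝ) (X : Matrix (Fin 2) (Fin 2) ℝ) (0 : ℝ)
    simpa using! this
  let ev : Matrix (Fin 2) (Fin 2) ℝ →ₗ[ℝ] ℝ :=
    (LinearMap.proj j).comp (LinearMap.proj (R := ℝ) (φ := fun _ : Fin 2 => Fin 2 → ℝ) i)
  exact (LinearMap.toContinuousLinearMap ev).hasFDerivAt.comp_hasDerivAt 0 h

theorem expSL_zero (X : sl2) : expSL ((0 : ℝ) • X) = 1 := by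
  apply Subtype.ext
  simp [expSL]

theorem sl2_one_one (X : sl2) :
    (X : Matrix (Fin 2) (Fin 2) ℝ) 1 1 = -(X : Matrix (Fin 2) (Fin 2) ℝ) 0 0 := by
  have := trace_sl2 X
  rw [Matrix.trace_fin_two] at this
  linarith

/-- The differential operator `(b + 2 s ζ - c ζ²) ∂ + (d + 1) (s - c ζ)`. -/
def diffOp (d : ℕ) (b s c : ℂ) : Module.End ℂ ℂ[X] where
  toFun P := (C b + C (2 * s) * X - C c * X ^ 2) * derivative P +
    C ((d : ℂ) + 1) * (C s - C c * X) * P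
  map_add' P Q := by rw [derivative_add]; ring
  map_smul' a P := by
    rw [derivative_smul, smul_eq_C_mul, smul_eq_C_mul, RingHom.id_apply, smul_eq_C_mul]; ring

theorem diffOp_apply (d : ℕ) (b s c : ℂ) (P : ℂ[X]) : diffOp d b s c P =
    (C b + C (2 * s) * X - C c * X ^ 2) * derivative P +
      C ((d : ℂ) + 1) * (C s - C c * X) * P := rfl

/-- The operators form a Lie algebra whose bracket on the parameters (b, s, c) is independent of d.
-/
theorem diffOp_commutator (d : ℕ) (b s c b' s' c' : ℂ) (P : ℂ[X]) :
    diffOp d b s c (diffOp d b' s' c' P) - diffOp d b' s' c' (diffOp d b s c P) =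
      diffOp d (2 * (b * s' - b' * s)) (b' * c - b * c') (2 * (s * c' - c * s')) P := by
  simp only [diffOp_apply, derivative_add, derivative_sub, derivative_mul, derivative_C,
    derivative_X, derivative_X_sq, C_mul, C_sub, C_add, zero_mul, mul_zero, zero_add, add_zero,
    mul_one, zero_sub]
  simp only [map_ofNat]
  ring

/-- The coefficient of `∂` in the operator attached to `X ∈ 𝔤`. -/
def lieCoeff (X : sl2) : ℂ := (X : Matrix (Fin 2) (Fin 2) ℝ) 0 0 +
  Complex.I * ((((X : Matrix (Fin 2) (Fin 2) ℝ) 0 1 + (X : Matrix (Fin 2) (Fin 2) ℝ) 1 0) / 2 : ℝ) : ℂ)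

/-- The coefficient of the weight operator in the operator attached to `X ∈ 𝔤`. -/
def lieWeight (X : sl2) : ℂ :=
  Complex.I * ((((X : Matrix (Fin 2) (Fin 2) ℝ) 0 1 - (X : Matrix (Fin 2) (Fin 2) ℝ) 1 0) / 2 : ℝ) : ℂ)

theorem conj_lieCoeff (X : sl2) : (starRingEnd ℂ) (lieCoeff X) =
    (X : Matrix (Fin 2) (Fin 2) ℝ) 0 0 - Complex.I *
      ((((X : Matrix (Fin 2) (Fin 2) ℝ) 0 1 + (X : Matrix (Fin 2) (Fin 2) ℝ) 1 0) / 2 : ℝ) : ℂ) := by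
  simp only [lieCoeff, map_add, map_mul, Complex.conj_ofReal, Complex.conj_I]
  ring

/-- The operator on polynomials attached to `X ∈ 𝔤`. -/
def lieOp (d : ℕ) (X : sl2) : Module.End ℂ ℂ[X] :=
  diffOp d (lieCoeff X) (lieWeight X) ((starRingEnd ℂ) (lieCoeff X))

theorem lieOp_add (d : ℕ) (X Y : sl2) : lieOp d (X + Y) = lieOp d X + lieOp d Y := by
  have h1 : lieCoeff (X + Y) = lieCoeff X + lieCoeff Y := by simp [lieCoeff]; ring
  have h2 : lieWeight (X + Y) = lieWeight X + lieWeight Y := by simp [lieWeight]; ring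
  refine LinearMap.ext fun P => ?_
  simp only [lieOp, LinearMap.add_apply, diffOp_apply, h1, h2, map_add, mul_add]
  ring

theorem lieOp_smul (d : ℕ) (r : ℝ) (X : sl2) : lieOp d (r • X) = (r : ℂ) • lieOp d X := by
  have h1 : lieCoeff (r • X) = r * lieCoeff X := by simp [lieCoeff]; ring
  have h2 : lieWeight (r • X) = r * lieWeight X := by simp [lieWeight]; ring
  refine LinearMap.ext fun P => ?_
  simp only [lieOp, LinearMap.smul_apply, diffOp_apply, h1, h2, map_mul, Complex.conj_ofReal,
    smul_eq_C_mul]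
  ring

theorem lieOp_lie (d : ℕ) (X Y : sl2) (P : ℂ[X]) :
    lieOp d ⁅X, Y⁆ P = lieOp d X (lieOp d Y P) - lieOp d Y (lieOp d X P) := by
  have e : ∀ i j, ((⁅X, Y⁆ : sl2) : Matrix (Fin 2) (Fin 2) ℝ) i j =
      ((X : Matrix (Fin 2) (Fin 2) ℝ) * (Y : Matrix (Fin 2) (Fin 2) ℝ) -
        (Y : Matrix (Fin 2) (Fin 2) ℝ) * (X : Matrix (Fin 2) (Fin 2) ℝ)) i j := fun i j => rfl
  have hX := sl2_one_one X
  have hY := sl2_one_one Y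
  simp only [lieOp]
  rw [diffOp_commutator]
  have h1 : lieCoeff ⁅X, Y⁆ = 2 * (lieCoeff X * lieWeight Y - lieCoeff Y * lieWeight X) := by
    simp only [lieCoeff, lieWeight, e, Matrix.sub_apply, Matrix.mul_apply, Fin.sum_univ_two, hX, hY]
    apply Complex.ext <;> simp <;> ring
  have h2 : lieWeight ⁅X, Y⁆ = lieCoeff Y * (starRingEnd ℂ) (lieCoeff X) -
      lieCoeff X * (starRingEnd ℂ) (lieCoeff Y) := by
    rw [conj_lieCoeff, conj_lieCoeff]
    simp only [lieCoeff, lieWeight, e, Matrix.sub_apply, Matrix.mul_apply, Fin.sum_univ_two, hX, hY]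
    apply Complex.ext <;> simp <;> ring
  -- The weight parameter is purely imaginary, so the third parameter of the bracket is the
  -- conjugate of the first.
  have h3 : (starRingEnd ℂ) (lieWeight X) = -lieWeight X := by
    simp only [lieWeight, map_mul, Complex.conj_I, Complex.conj_ofReal]; ring
  have h4 : (starRingEnd ℂ) (lieWeight Y) = -lieWeight Y := by
    simp only [lieWeight, map_mul, Complex.conj_I, Complex.conj_ofReal]; ring
  rw [h2, h1]
  congr 2
  simp only [map_mul, map_sub, map_ofNat, h3, h4]
  ring

/-- The decomposition of the complexified Lie algebra under K: `lieWeight` has weight 0, and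
`lieCoeff` is multiplied by the inverse square of `rotNum`. -/
theorem Ad_coeff (k : SO2) (X : sl2) :
    lieCoeff (Ad k X) = (starRingEnd ℂ) (rotNum k) ^ 2 * lieCoeff X ∧
      lieWeight (Ad k X) = lieWeight X := by
  obtain ⟨h1, h2, h3⟩ := SO2_entries k.2
  have hX := sl2_one_one X
  have e : ∀ i j, ((Ad k X : sl2) : Matrix (Fin 2) (Fin 2) ℝ) i j =
      (((k : SL(2, ℝ)) : Matrix (Fin 2) (Fin 2) ℝ) * (X : Matrix (Fin 2) (Fin 2) ℝ) *
        (((k : SL(2, ℝ))⁻¹ : SL(2, ℝ)) : Matrix (Fin 2) (Fin 2) ℝ)) i j := fun i j => rfl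
  constructor
  · simp only [lieCoeff, rotNum, e, Matrix.mul_apply, Fin.sum_univ_two, hX,
      Matrix.SpecialLinearGroup.coe_inv, Matrix.adjugate_fin_two, Matrix.of_apply, Matrix.cons_val',
      Matrix.cons_val_zero, Matrix.cons_val_one, Matrix.cons_val_fin_one, h1, h2]
    apply Complex.ext <;> simp [sq] <;> ring
  · simp only [lieWeight, e, Matrix.mul_apply, Fin.sum_univ_two, hX,
      Matrix.SpecialLinearGroup.coe_inv, Matrix.adjugate_fin_two, Matrix.of_apply, Matrix.cons_val',
      Matrix.cons_val_zero, Matrix.cons_val_one, Matrix.cons_val_fin_one, h1, h2]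
    congr 2
    linear_combination ((X : Matrix (Fin 2) (Fin 2) ℝ) 0 1 -
      (X : Matrix (Fin 2) (Fin 2) ℝ) 1 0) / 2 * h3

theorem rotAct_lieOp (d : ℕ) (k : SO2) (Y : sl2) (P : ℂ[X]) :
    rotAct d (rotNum k) (lieOp d Y P) = lieOp d (Ad k Y) (rotAct d (rotNum k) P) := by
  obtain ⟨h1, h2⟩ := Ad_coeff k Y
  have h3 : C (rotNum k ^ 2) * C ((starRingEnd ℂ) (rotNum k) ^ 2) = 1 := by
    rw [← C_mul, ← mul_pow, rotNum_mul_conj, one_pow, C_1]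
  have h4 : (starRingEnd ℂ) ((starRingEnd ℂ) (rotNum k) ^ 2 * lieCoeff Y) =
      rotNum k ^ 2 * (starRingEnd ℂ) (lieCoeff Y) := by simp
  rw [rotAct_apply, rotAct_apply, map_smul]
  congr 1
  simp only [lieOp, diffOp_apply, h1, h2, h4, C_mul, derivative_comp, add_comp, sub_comp, mul_comp,
    pow_comp, C_comp, X_comp, derivative_mul, derivative_C, derivative_X, zero_mul, zero_add, mul_one]
  linear_combination
    (-(C (lieCoeff Y) * (derivative P).comp (C (rotNum k ^ 2) * X))) * h3

/-- The representation of `K` on polynomials. -/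
def rotRep (d : ℕ) : Representation ℂ SO2 ℂ[X] where
  toFun k := rotAct d (rotNum k)
  map_one' := by
    have h : rotNum ((1 : SO2) : SL(2, ℝ)) = 1 := by simp [rotNum]
    refine LinearMap.ext fun P => ?_
    rw [h, rotAct_apply]; simp
  map_mul' k l := by
    refine LinearMap.ext fun P => ?_
    rw [rotNum_mul, Module.End.mul_apply, rotAct_apply, rotAct_apply, rotAct_apply, smul_comp,
      smul_smul, comp_assoc, mul_pow]
    congr 2
    simp only [mul_comp, C_comp, X_comp, C_mul, mul_pow]
    ring

theorem hasDerivAt_rotNum_expSL (X : sl2) : HasDerivAt (fun t : ℝ => rotNum (expSL (t • X)))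
    ((X : Matrix (Fin 2) (Fin 2) ℝ) 0 0 +
      Complex.I * ((X : Matrix (Fin 2) (Fin 2) ℝ) 0 1 : ℝ)) 0 :=
  (hasDerivAt_expSL X 0 0).ofReal_comp.add ((hasDerivAt_expSL X 0 1).ofReal_comp.const_mul _)

theorem entries_of_expSL_mem_SO2 {X : sl2} (hX : ∀ t : ℝ, expSL (t • X) ∈ SO2) :
    (X : Matrix (Fin 2) (Fin 2) ℝ) 0 0 = 0 ∧
      (X : Matrix (Fin 2) (Fin 2) ℝ) 1 0 = -(X : Matrix (Fin 2) (Fin 2) ℝ) 0 1 := by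
  have h1 : (X : Matrix (Fin 2) (Fin 2) ℝ) 1 1 = (X : Matrix (Fin 2) (Fin 2) ℝ) 0 0 := by
    refine (hasDerivAt_expSL X 1 1).unique ?_
    rw [funext fun t => (SO2_entries (hX t)).1]
    exact hasDerivAt_expSL X 0 0
  have h2 : (X : Matrix (Fin 2) (Fin 2) ℝ) 1 0 = -(X : Matrix (Fin 2) (Fin 2) ℝ) 0 1 := by
    refine (hasDerivAt_expSL X 1 0).unique ?_
    rw [funext fun t => (SO2_entries (hX t)).2.1]
    exact (hasDerivAt_expSL X 0 1).neg
  exact ⟨by linarith [sl2_one_one X], h2⟩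

/-- The `(𝔤, K)`-module of polynomials in the coordinate of the disc. -/
def discModule (d : ℕ) : GKModule ℂ[X] where
  lie :=
    { toFun := lieOp d
      map_add' := lieOp_add d
      map_smul' := fun r X => lieOp_smul d r X
      map_lie' := fun {X Y} => LinearMap.ext fun P => lieOp_lie d X Y P }
  grp := rotRep d
  finite := rotAct_orbit_finite d
  diff := by
    intro X hX v l
    obtain ⟨h0, h1⟩ := entries_of_expSL_mem_SO2 hX
    -- On Lie(K) only the weight parameter survives, so both the group and the Lie algebra act
    -- diagonally on monomials.
    have hc : lieCoeff X = 0 := by simp [lieCoeff, h0, h1]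
    have hw : lieWeight X = Complex.I * ((X : Matrix (Fin 2) (Fin 2) ℝ) 0 1 : ℝ) := by
      simp only [lieWeight, h1]; congr 2; ring
    have hd := hasDerivAt_rotNum_expSL X
    rw [h0, Complex.ofReal_zero, zero_add, ← hw] at hd
    have h10 : rotNum (expSL ((0 : ℝ) • X)) = 1 := by rw [expSL_zero]; simp [rotNum]
    change HasDerivAt (fun t : ℝ => l (rotAct d (rotNum (expSL (t • X))) v)) (l (lieOp d X v)) 0
    induction v using Polynomial.induction_on' with
    | add p q hp hq =>
      simp only [map_add]
      exact hp.add hq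
    | monomial n a =>
      have e1 : ∀ b : ℂ, l (rotAct d b (monomial n a)) =
          b ^ (d + 1 + 2 * n) * l (monomial n a) := by
        intro b
        rw [← C_mul_X_pow_eq_monomial, ← smul_eq_C_mul, map_smul, rotAct_X_pow, smul_comm, map_smul,
          smul_eq_mul]
      have e2 : lieOp d X (monomial n a) = ((d + 1 + 2 * n : ℕ) * lieWeight X : ℂ) •
          monomial n a := by
        simp only [lieOp, diffOp_apply, hc, map_zero]
        rw [← C_mul_X_pow_eq_monomial, derivative_C_mul_X_pow, smul_eq_C_mul]
        rcases n with _ | n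
        · simp
        · push_cast
          simp only [C_mul, C_add, C_1, pow_succ]
          ring
      simp only [e1]
      rw [e2, map_smul, smul_eq_mul]
      have h2 := (hd.pow (d + 1 + 2 * n)).mul_const (l (monomial n a))
      rw [h10] at h2
      simpa using h2
  equivariant := rotAct_lieOp d

/-- Lowering and raising operators: with Y = diag(1, -1) and Z the symmetric off-diagonal matrix, (Y
- iZ)/2 acts as ∂ and -(Y + iZ)/2 as ζ²∂ + (d+1)ζ. -/
theorem diffOp_mem {d : ℕ} {U : Submodule ℂ ℂ[X]} (h : ∀ X, ∀ v ∈ U, (discModule d).lie X v ∈ U)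
    {P : ℂ[X]} (hP : P ∈ U) :
    derivative P ∈ U ∧ X ^ 2 * derivative P + C ((d : ℂ) + 1) * X * P ∈ U := by
  set Y : sl2 := ⟨!![1, 0; 0, -1], by
    change Matrix.trace (!![1, 0; 0, -1] : Matrix (Fin 2) (Fin 2) ℝ) = 0
    simp [Matrix.trace_fin_two]⟩ with hY
  set Z : sl2 := ⟨!![0, 1; 1, 0], by
    change Matrix.trace (!![0, 1; 1, 0] : Matrix (Fin 2) (Fin 2) ℝ) = 0
    simp [Matrix.trace_fin_two]⟩ with hZ
  have y1 : lieCoeff Y = 1 := by simp [lieCoeff, hY]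
  have y2 : lieWeight Y = 0 := by simp [lieWeight, hY]
  have z1 : lieCoeff Z = Complex.I := by simp [lieCoeff, hZ]
  have z2 : lieWeight Z = 0 := by simp [lieWeight, hZ]
  have hy : lieOp d Y P ∈ U := h Y P hP
  have hz : lieOp d Z P ∈ U := h Z P hP
  have hII : C Complex.I * C Complex.I = (-1 : ℂ[X]) := by
    rw [← C_mul, Complex.I_mul_I]; simp
  have h2 : C (2⁻¹ : ℂ) * 2 = 1 := by
    rw [show (2 : ℂ[X]) = C 2 from rfl, ← C_mul]; norm_num
  constructor
  · have := U.smul_mem (2⁻¹ : ℂ) (U.sub_mem hy (U.smul_mem Complex.I hz))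
    convert this using 1
    simp only [lieOp, diffOp_apply, y1, y2, z1, z2, map_one, Complex.conj_I, smul_eq_C_mul, mul_zero,
      C_0, C_neg]
    linear_combination (-derivative P) * h2 + (C (2⁻¹ : ℂ) * (derivative P + X ^ 2 * derivative P +
      C ((d : ℂ) + 1) * X * P)) * hII
  · have := U.smul_mem (-2⁻¹ : ℂ) (U.add_mem hy (U.smul_mem Complex.I hz))
    convert this using 1
    simp only [lieOp, diffOp_apply, y1, y2, z1, z2, map_one, Complex.conj_I, smul_eq_C_mul, mul_zero,
      C_0, C_neg]
    linear_combination (-(X ^ 2 * derivative P + C ((d : ℂ) + 1) * X * P)) * h2 +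
      (C (2⁻¹ : ℂ) * (derivative P + X ^ 2 * derivative P + C ((d : ℂ) + 1) * X * P)) * hII

/-- Applying ∂ as many times as the degree leaves a nonzero constant. The raising operator sends ζ^n
to (n+d+1) ζ^(n+1), whose coefficient never vanishes, so every monomial is reached. -/
theorem irreducible_discModule (d : ℕ) : (discModule d).Irreducible := by
  refine ⟨inferInstance, fun U _ hU => ?_⟩
  rw [or_iff_not_imp_left]
  intro hne
  obtain ⟨P, hP, hP0⟩ := (Submodule.ne_bot_iff U).1 hne
  have h1 : (1 : ℂ[X]) ∈ U := by
    have hit : ∀ n, derivative^[n] P ∈ U := by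
      intro n
      induction n with
      | zero => exact hP
      | succ n ih =>
        rw [Function.iterate_succ_apply']
        exact (diffOp_mem hU ih).1
    have h2 := hit P.natDegree
    have h3 : derivative^[P.natDegree] P = C ((P.natDegree.factorial : ℂ) * P.leadingCoeff) := by
      rw [eq_C_of_natDegree_eq_zero (p := derivative^[P.natDegree] P)
        (Nat.le_zero.1 ((natDegree_iterate_derivative P _).trans (by simp)))]
      rw [coeff_iterate_derivative, zero_add, Nat.descFactorial_self, nsmul_eq_mul]
      rfl
    have h4 : ((P.natDegree.factorial : ℂ) * P.leadingCoeff) ≠ 0 :=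
      mul_ne_zero (by exact_mod_cast Nat.factorial_ne_zero _) (leadingCoeff_ne_zero.2 hP0)
    rw [h3] at h2
    have := U.smul_mem ((P.natDegree.factorial : ℂ) * P.leadingCoeff)⁻¹ h2
    rwa [smul_C, smul_eq_mul, inv_mul_cancel₀ h4, C_1] at this
  have hpow : ∀ n : ℕ, (X : ℂ[X]) ^ n ∈ U := by
    intro n
    induction n with
    | zero => simpa using h1
    | succ n ih =>
      have h2 := (diffOp_mem hU ih).2
      have h3 : X ^ 2 * derivative (X ^ n : ℂ[X]) + C ((d : ℂ) + 1) * X * X ^ n =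
          ((n + d + 1 : ℕ) : ℂ) • X ^ (n + 1) := by
        rw [derivative_X_pow, smul_eq_C_mul]
        rcases n with _ | n
        · simp
        · push_cast
          simp only [C_add, C_1, pow_succ]
          ring
      rw [h3] at h2
      have h4 : ((n + d + 1 : ℕ) : ℂ) ≠ 0 := by exact_mod_cast Nat.succ_ne_zero (n + d)
      have := U.smul_mem ((n + d + 1 : ℕ) : ℂ)⁻¹ h2
      rwa [smul_smul, inv_mul_cancel₀ h4, one_smul] at this
  rw [eq_top_iff]
  intro Q _
  induction Q using Polynomial.induction_on' with
  | add p q hp hq => exact U.add_mem (hp trivial) (hq trivial)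
  | monomial n a =>
    rw [← C_mul_X_pow_eq_monomial, ← smul_eq_C_mul]
    exact U.smul_mem a (hpow n)

/-! ## Transport of structure -/

/-- Transport of a `(𝔤, K)`-module structure along a linear equivalence. -/
def GKModule.transport {V W : Type*} [AddCommGroup V] [Module ℂ V] [AddCommGroup W] [Module ℂ W]
    (A : GKModule V) (e : V ≃ₗ[ℂ] W) : GKModule W where
  lie :=
    { toFun := fun X => e.toLinearMap ∘ₗ A.lie X ∘ₗ e.symm.toLinearMap
      map_add' := fun X Y => by ext v; simp
      map_smul' := fun r X => by
        refine LinearMap.ext fun v => ?_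
        rw [map_smul]
        exact e.map_smul (r : ℂ) _
      map_lie' := fun {X Y} => by
        refine LinearMap.ext fun v => ?_
        have h : ∀ v, A.lie ⁅X, Y⁆ v = A.lie X (A.lie Y v) - A.lie Y (A.lie X v) := fun v => by
          rw [A.lie.map_lie]; rfl
        change e (A.lie ⁅X, Y⁆ (e.symm v)) = e (A.lie X (e.symm (e (A.lie Y (e.symm v))))) -
          e (A.lie Y (e.symm (e (A.lie X (e.symm v)))))
        rw [h, map_sub, e.symm_apply_apply, e.symm_apply_apply] }
  grp :=
    { toFun := fun k => e.toLinearMap ∘ₗ A.grp k ∘ₗ e.symm.toLinearMap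
      map_one' := by ext v; simp
      map_mul' := fun k l => by ext v; simp }
  finite v := by
    have := A.finite (e.symm v)
    have h : (Set.range fun k => e (A.grp k (e.symm v))) =
        e.toLinearMap '' Set.range fun k => A.grp k (e.symm v) := by
      rw [← range_comp]; rfl
    change FiniteDimensional ℂ (Submodule.span ℂ (Set.range fun k => e (A.grp k (e.symm v))))
    rw [h, ← Submodule.map_span]
    infer_instance
  diff X hX v l := A.diff X hX (e.symm v) (l ∘ₗ e.toLinearMap)
  equivariant k X v := by
    change e (A.grp k (e.symm (e (A.lie X (e.symm v))))) =
      e (A.lie (Ad k X) (e.symm (e (A.grp k (e.symm v)))))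
    rw [e.symm_apply_apply, e.symm_apply_apply, A.equivariant]

theorem GKModule.transport_grp {V W : Type*} [AddCommGroup V] [Module ℂ V] [AddCommGroup W]
    [Module ℂ W] (A : GKModule V) (e : V ≃ₗ[ℂ] W) (k : SO2) (v : V) :
    (A.transport e).grp k (e v) = e (A.grp k v) := by
  change e (A.grp k (e.symm (e v))) = _
  rw [e.symm_apply_apply]

theorem GKModule.transport_lie {V W : Type*} [AddCommGroup V] [Module ℂ V] [AddCommGroup W]
    [Module ℂ W] (A : GKModule V) (e : V ≃ₗ[ℂ] W) (X : sl2) (v : V) :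
    (A.transport e).lie X (e v) = e (A.lie X v) := by
  change e (A.lie X (e.symm (e v))) = _
  rw [e.symm_apply_apply]

theorem GKModule.transport_iso {V W W' : Type*} [AddCommGroup V] [Module ℂ V] [AddCommGroup W]
    [Module ℂ W] [AddCommGroup W'] [Module ℂ W'] (A : GKModule V) (e : V ≃ₗ[ℂ] W)
    (e' : V ≃ₗ[ℂ] W') : (A.transport e).Iso (A.transport e') := by
  refine ⟨e.symm.trans e', fun k v => ?_, fun X v => ?_⟩
  · obtain ⟨v, rfl⟩ := e.surjective v
    simp [transport_grp]
  · obtain ⟨v, rfl⟩ := e.surjective v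
    simp [transport_lie]

theorem GKModule.Irreducible.transport {V W : Type*} [AddCommGroup V] [Module ℂ V] [AddCommGroup W]
    [Module ℂ W] {A : GKModule V} (hA : A.Irreducible) (e : V ≃ₗ[ℂ] W) :
    (A.transport e).Irreducible := by
  have := hA.1
  refine ⟨e.injective.nontrivial, fun U h1 h2 => ?_⟩
  have h := hA.2 (U.comap e.toLinearMap)
    (fun k v hv => by
      change e (A.grp k v) ∈ U
      rw [← transport_grp]; exact h1 k _ hv)
    (fun X v hv => by
      change e (A.lie X v) ∈ U
      rw [← transport_lie]; exact h2 X _ hv)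
  have hmap : (U.comap e.toLinearMap).map e.toLinearMap = U :=
    Submodule.map_comap_eq_of_surjective e.surjective U
  rw [← hmap]
  rcases h with h | h
  · left; rw [h, Submodule.map_bot]
  · right; rw [h, Submodule.map_top, LinearEquiv.range]

/-! ## The infinitesimal action -/

theorem expSL_add (X : sl2) (s t : ℝ) :
    expSL ((s + t) • X) = expSL (s • X) * expSL (t • X) := by
  apply Subtype.ext
  change NormedSpace.exp ((s + t) • (X : Matrix (Fin 2) (Fin 2) ℝ)) =
    NormedSpace.exp (s • (X : Matrix (Fin 2) (Fin 2) ℝ)) *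
      NormedSpace.exp (t • (X : Matrix (Fin 2) (Fin 2) ℝ))
  rw [add_smul, Matrix.exp_add_of_commute]
  exact ((Commute.refl _).smul_left s).smul_right t

theorem hasDerivAt_homEval {d : ℕ} (P : ℂ[X]) {u v : ℝ → ℂ} {u' v' : ℂ} {t : ℝ}
    (hu : HasDerivAt u u' t) (hv : HasDerivAt v v' t) (h0 : v t ≠ 0) :
    HasDerivAt (fun t => homEval d P (u t) (v t))
      ((v t ^ (d + 1))⁻¹ * ((derivative P).eval (u t / v t) * ((u' * v t - u t * v') / v t ^ 2) -
        ((d : ℂ) + 1) * (v' / v t) * P.eval (u t / v t))) t := by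
  have h1 : HasDerivAt (fun t => (v t ^ (d + 1))⁻¹)
      (-(((d : ℂ) + 1) * v t ^ d * v') / (v t ^ (d + 1)) ^ 2) t := by
    refine ((hv.pow (d + 1)).inv (pow_ne_zero _ h0)).congr_deriv ?_
    simp
  have h2 : HasDerivAt (fun t => P.eval (u t / v t))
      ((derivative P).eval (u t / v t) * ((u' * v t - u t * v') / v t ^ 2)) t :=
    HasDerivAt.comp (h₂ := fun z => P.eval z) (h := fun t => u t / v t) t
      (P.hasDerivAt (u t / v t)) (hu.div hv h0)
  refine (h1.mul h2).congr_deriv ?_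
  field_simp
  ring

theorem hasDerivAt_discNum (X : sl2) (w : ℂ) :
    HasDerivAt (fun t : ℝ => discNum (expSL (t • X)) w)
      (lieCoeff X * (1 + w) + lieWeight X * (1 - w)) 0 := by
  have h := (((hasDerivAt_expSL X 0 0).ofReal_comp).add
    ((hasDerivAt_expSL X 0 1).ofReal_comp.const_mul Complex.I)).add
    ((((hasDerivAt_expSL X 1 0).ofReal_comp.const_mul Complex.I).sub
      (hasDerivAt_expSL X 1 1).ofReal_comp).mul_const w)
  refine h.congr_deriv ?_
  rw [sl2_one_one, lieCoeff, lieWeight]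
  push_cast
  ring

theorem hasDerivAt_discDen (X : sl2) (w : ℂ) :
    HasDerivAt (fun t : ℝ => discDen (expSL (t • X)) w)
      ((starRingEnd ℂ) (lieCoeff X) * (1 - w) - lieWeight X * (1 + w)) 0 := by
  have h := (((hasDerivAt_expSL X 0 0).ofReal_comp).sub
    ((hasDerivAt_expSL X 0 1).ofReal_comp.const_mul Complex.I)).add
    ((((hasDerivAt_expSL X 1 0).ofReal_comp.const_mul Complex.I).add
      (hasDerivAt_expSL X 1 1).ofReal_comp).mul_const w)
  refine h.congr_deriv ?_
  rw [sl2_one_one, conj_lieCoeff, lieWeight]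
  push_cast
  ring

/-- With u = 1-w, v = 1+w, the derivatives at t = 0 are u' = b v + s u and v' = c u - s v. The
quotient rule gives b + 2sζ - cζ² for the derivative of ζ, and v^(-d-1) contributes (d+1)(s - cζ).
-/
theorem hasDerivAt_homEval_disc (d : ℕ) (P : ℂ[X]) (X : sl2) {w : ℂ} (hw : 1 + w ≠ 0) :
    HasDerivAt (fun t : ℝ => homEval d P (discNum (expSL (t • X)) w) (discDen (expSL (t • X)) w))
      (homEval d (lieOp d X P) (1 - w) (1 + w)) 0 := by
  have e1 : discNum (expSL ((0 : ℝ) • X)) w = 1 - w := by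
    rw [expSL_zero]; simp [discNum]; ring
  have e2 : discDen (expSL ((0 : ℝ) • X)) w = 1 + w := by
    rw [expSL_zero]; simp [discDen]
  have h := hasDerivAt_homEval (d := d) P (hasDerivAt_discNum X w) (hasDerivAt_discDen X w)
    (by rwa [e2])
  refine h.congr_deriv ?_
  rw [e1, e2, homEval, lieOp, diffOp_apply]
  simp only [eval_add, eval_sub, eval_mul, eval_pow, eval_C, eval_X]
  field_simp
  ring

/-! ## The derivative in the induced space -/

theorem tendsto_indRep_discFun (d : ℕ) (P : ℂ[X]) (X : sl2) :
    Tendsto (fun t : ℝ => ((t⁻¹ : ℝ) : ℂ) • (indRep d (expSL (t • X)) (discFun d P) - discFun d P))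
      (𝓝[≠] 0) (𝓝 (discFun d (lieOp d X P))) := by
  rw [tendsto_subtype_rng, tendsto_pi_nhds]
  intro z
  have hz : (1 + -(Complex.I * z) : ℂ) ≠ 0 := by
    rw [← sub_eq_add_neg]; exact one_sub_I_mul_ne_zero z
  have h := (hasDerivAt_iff_tendsto_slope.1 ((hasDerivAt_homEval_disc d P X hz).const_mul
    (((Real.sqrt (2 * Real.pi))⁻¹ : ℝ) : ℂ)))
  rw [discFun_apply]
  rw [sub_neg_eq_add, ← sub_eq_add_neg] at h
  refine h.congr fun t => ?_
  change _ = ((t⁻¹ : ℝ) : ℂ) * (indAct d (expSL (t • X)) (discFun d P) z -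
    (discFun d P : ℝ → ℂ) z)
  have h1 : (discFun d P : ℝ → ℂ) z = indAct d (expSL ((0 : ℝ) • X)) (discFun d P) z := by
    rw [expSL_zero]; simp [indAct, indFormula]
  rw [h1, indAct_discFun, indAct_discFun, slope_def_module, sub_zero, Complex.real_smul]

/-! ## The derivative in the Kirillov space -/

/-- Only the independence of c and v from F matters: it transfers a derivative at t = 0 to any other
time by the group law. -/
theorem exists_laplace_kirillovRep (d : ℕ) (g : SL(2, ℝ)) {w : ℂ} (hw : 0 < w.re) :
    ∃ c v : ℂ, 0 < v.re ∧ ∀ F, laplace d (kirillovRep d g F) w = c * laplace d F v := by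
  have hw' : 0 < ((starRingEnd ℂ) w).re := by simpa using hw
  have hp : 0 < ((starRingEnd ℂ) (moeb g⁻¹ ((starRingEnd ℂ) w))).re := by
    simpa using moeb_re_pos g⁻¹ hw'
  refine ⟨(starRingEnd ℂ) ((autFactor g⁻¹ ((starRingEnd ℂ) w) ^ (d + 1))⁻¹), _, hp, fun F => ?_⟩
  have e : kirillovRep d g (kirillovRep d g⁻¹ (expVec d ((starRingEnd ℂ) w))) =
      expVec d ((starRingEnd ℂ) w) := by
    rw [← Module.End.mul_apply, ← map_mul]; simp
  rw [← inner_expVec hw, ← e, inner_kirillovRep, kirillovRep_apply, kirillovOp_expVec d _ hw',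
    actExp, inner_smul_left, ← inner_expVec hp, Complex.conj_conj]

theorem hasDerivAt_laplace_kirillovRep (d : ℕ) (P : ℂ[X]) (X : sl2) {w : ℂ} (hw : 0 < w.re)
    (s : ℝ) : HasDerivAt (fun t : ℝ => laplace d (kirillovRep d (expSL (t • X)) (discVec d P)) w)
      (laplace d (kirillovRep d (expSL (s • X)) (discVec d (lieOp d X P))) w) s := by
  obtain ⟨c, v, hv, h⟩ := exists_laplace_kirillovRep d (expSL (s • X)) hw
  have hv1 : 1 + v ≠ 0 := by
    intro h0
    have := congrArg Complex.re h0
    simp at this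
    linarith
  have h1 := (hasDerivAt_homEval_disc d P X hv1).const_mul c
  rw [← sub_self s] at h1
  have h2 := h1.comp_sub_const s s
  rw [h, laplace_discVec d _ hv.le]
  refine h2.congr_of_eventuallyEq (Eventually.of_forall fun t => ?_)
  beta_reduce
  rw [← laplace_kirillovRep_discVec d _ P hv, ← h, ← Module.End.mul_apply, ← map_mul, ← expSL_add,
    add_sub_cancel]

/-- The orbit is weakly continuous against the dense combinations of `expVec`, hence against every
vector since its norm is constant. Weak continuity and constant norm together give norm continuity.
-/
theorem continuous_kirillovRep_discVec (d : ℕ) (P : ℂ[X]) (X : sl2) :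
    Continuous fun t : ℝ => kirillovRep d (expSL (t • X)) (discVec d P) := by
  set γ : ℝ → KirillovSpace := fun t => kirillovRep d (expSL (t • X)) (discVec d P) with hγ
  have hw : ∀ u, Continuous fun t => inner ℂ u (γ t) := by
    have hcomb : ∀ c, Continuous fun t => inner ℂ (expComb d c) (γ t) := by
      intro c
      induction c using Finsupp.induction_linear with
      | zero => simp only [map_zero, inner_zero_left]; exact continuous_const
      | add a b ha hb => simp only [map_add, inner_add_left]; exact ha.add hb
      | single w a =>
        have hw' : 0 < ((starRingEnd ℂ) (w : ℂ)).re := by simpa using w.2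
        have : (fun t => inner ℂ (expComb d (Finsupp.single w a)) (γ t)) =
            fun t => (starRingEnd ℂ) a * laplace d (γ t) ((starRingEnd ℂ) (w : ℂ)) := by
          ext t
          rw [← inner_expVec hw', Complex.conj_conj]
          simp [expComb, inner_smul_left]
        rw [this]
        exact continuous_const.mul (continuous_iff_continuousAt.2 fun s =>
          (hasDerivAt_laplace_kirillovRep d P X hw' s).continuousAt)
    intro u
    refine continuous_of_uniform_approx_of_continuous fun U hU => ?_
    obtain ⟨η, hη, hηU⟩ := Metric.mem_uniformity_dist.1 hU
    -- The summand 1 keeps the denominator positive and the final estimate strict.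
    set r := η / (‖discVec d P‖ + 1) with hr
    have hr0 : 0 < r := by positivity
    obtain ⟨c, hc⟩ := (denseRange_expComb d).exists_dist_lt u hr0
    refine ⟨_, hcomb c, fun t => hηU ?_⟩
    rw [dist_eq_norm, ← inner_sub_left]
    rw [dist_eq_norm] at hc
    calc _ ≤ ‖u - expComb d c‖ * ‖γ t‖ := norm_inner_le_norm _ _
      _ = ‖u - expComb d c‖ * ‖discVec d P‖ := by rw [hγ, norm_kirillovRep]
      _ ≤ r * ‖discVec d P‖ := by gcongr
      _ < r * (‖discVec d P‖ + 1) := by gcongr; linarith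
      _ = η := by rw [hr]; field_simp
  rw [continuous_iff_continuousAt]
  intro s
  have h1 : ∀ t, ‖γ t - γ s‖ ^ 2 = 2 * ‖γ s‖ ^ 2 - 2 * (inner ℂ (γ s) (γ t)).re := by
    intro t
    have h2 := @norm_sub_sq ℂ _ _ _ _ (γ s) (γ t)
    have h3 : ‖γ t‖ = ‖γ s‖ := by simp only [hγ, norm_kirillovRep]
    rw [norm_sub_rev, h2, h3]
    simp only [RCLike.re_to_complex]
    ring
  have h4 : Tendsto (fun t => ‖γ t - γ s‖ ^ 2) (𝓝 s) (𝓝 0) := by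
    have h5 : Continuous fun t => 2 * ‖γ s‖ ^ 2 - 2 * (inner ℂ (γ s) (γ t)).re :=
      continuous_const.sub (continuous_const.mul (Complex.continuous_re.comp (hw _)))
    have h6 := h5.tendsto s
    rw [← h1] at h6
    simpa only [← h1, sub_self, norm_zero, ne_eq, OfNat.ofNat_ne_zero, not_false_eq_true,
      zero_pow] using h6
  rw [ContinuousAt, tendsto_iff_norm_sub_tendsto_zero]
  simpa using h4.sqrt

/-- Laplace transforms of the orbit are differentiable at all times, so the orbit is the integral of
the candidate derivative when tested on each Laplace functional, hence in the Hilbert space. The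
candidate is norm continuous, so the integral is differentiable in norm. -/
theorem hasDerivAt_kirillovRep_discVec (d : ℕ) (P : ℂ[X]) (X : sl2) :
    HasDerivAt (fun t : ℝ => kirillovRep d (expSL (t • X)) (discVec d P))
      (discVec d (lieOp d X P)) 0 := by
  set δ : ℝ → KirillovSpace := fun t => kirillovRep d (expSL (t • X)) (discVec d (lieOp d X P))
    with hδ
  have hc : Continuous δ := continuous_kirillovRep_discVec d _ X
  have key : ∀ t : ℝ, kirillovRep d (expSL (t • X)) (discVec d P) =
      discVec d P + ∫ s in (0 : ℝ)..t, δ s := by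
    intro t
    refine ext_laplace (d := d) fun w hw => ?_
    rw [← laplaceFunctional_apply hw (_ + _), map_add,
      ← ContinuousLinearMap.intervalIntegral_comp_comm _ (hc.intervalIntegrable _ _)]
    have h := intervalIntegral.integral_eq_sub_of_hasDerivAt
      (fun s _ => hasDerivAt_laplace_kirillovRep d P X hw s)
      (Continuous.intervalIntegrable (by
        have := (laplaceFunctional d w).continuous.comp hc
        simpa only [Function.comp_def, laplaceFunctional_apply hw] using this) 0 t)
    simp only [laplaceFunctional_apply hw]
    rw [h, expSL_zero, map_one, Module.End.one_apply]
    ring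
  rw [funext key]
  have h0 : δ 0 = discVec d (lieOp d X P) := by
    simp only [hδ]; rw [expSL_zero, map_one, Module.End.one_apply]
  rw [← h0]
  exact (intervalIntegral.integral_hasDerivAt_right (hc.intervalIntegrable _ _)
    (hc.stronglyMeasurableAtFilter _ _) hc.continuousAt).const_add _

theorem tendsto_kirillovRep_discVec (d : ℕ) (P : ℂ[X]) (X : sl2) :
    Tendsto (fun t : ℝ => ((t⁻¹ : ℝ) : ℂ) •
        (kirillovRep d (expSL (t • X)) (discVec d P) - discVec d P))
      (𝓝[≠] 0) (𝓝 (discVec d (lieOp d X P))) := by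
  have h := hasDerivAt_iff_tendsto_slope.1 (hasDerivAt_kirillovRep_discVec d P X)
  refine h.congr fun t => ?_
  rw [slope_def_module, sub_zero, expSL_zero, map_one, Module.End.one_apply]
  exact (Complex.coe_smul _ _).symm

/-! ## The modules of `K`-finite vectors -/

/-- A subspace identified with the range of an injective linear map. -/
def rangeEquiv {V E : Type*} [AddCommGroup V] [Module ℂ V] [AddCommGroup E] [Module ℂ E]
    {f : V →ₗ[ℂ] E} (hf : Function.Injective f) {U : Submodule ℂ E} (hU : U = LinearMap.range f) :
    V ≃ₗ[ℂ] U :=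
  (LinearEquiv.ofInjective f hf).trans (LinearEquiv.ofEq _ _ hU.symm)

theorem rangeEquiv_apply {V E : Type*} [AddCommGroup V] [Module ℂ V] [AddCommGroup E] [Module ℂ E]
    {f : V →ₗ[ℂ] E} (hf : Function.Injective f) {U : Submodule ℂ E} (hU : U = LinearMap.range f)
    (v : V) : (rangeEquiv hf hU v : E) = f v := rfl

theorem isInducedBy_transport {d : ℕ} {E : Type*} [AddCommGroup E] [Module ℂ E]
    [TopologicalSpace E] {ρ : Representation ℂ SL(2, ℝ) E} {f : ℂ[X] →ₗ[ℂ] E}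
    (hf : Function.Injective f) {U : Submodule ℂ E} (hU : U = LinearMap.range f)
    (hK : ∀ (k : SO2) (P : ℂ[X]), ρ k (f P) = f (rotAct d (rotNum k) P))
    (hX : ∀ (X : sl2) (P : ℂ[X]), Tendsto (fun t : ℝ => ((t⁻¹ : ℝ) : ℂ) •
      (ρ (expSL (t • X)) (f P) - f P)) (𝓝[≠] 0) (𝓝 (f (lieOp d X P)))) :
    ((discModule d).transport (rangeEquiv hf hU)).IsInducedBy ρ := by
  refine ⟨fun k v => ?_, fun X v => ?_⟩
  · obtain ⟨P, rfl⟩ := (rangeEquiv hf hU).surjective v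
    rw [GKModule.transport_grp, rangeEquiv_apply, rangeEquiv_apply, hK]
    rfl
  · obtain ⟨P, rfl⟩ := (rangeEquiv hf hU).surjective v
    rw [GKModule.transport_lie, rangeEquiv_apply, rangeEquiv_apply]
    exact hX X P

/-- Both modules are transports of `discModule`, from which the isomorphism and irreducibility
follow. -/
theorem exists_modules {d : ℕ} (hd : 0 < d) :
    ∃ (A : GKModule ↥(kFinite (indRep d) ⊓ indPlus d)) (B : GKModule ↥(kFinite (kirillovRep d))),
      A.IsInducedBy (indRep d) ∧ B.IsInducedBy (kirillovRep d) ∧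
        A.Iso B ∧ A.Irreducible ∧ B.Irreducible :=
  ⟨(discModule d).transport (rangeEquiv (discFun_injective d) (kFinite_indRep_inf_indPlus hd)),
    (discModule d).transport (rangeEquiv (discVec_injective d) (kFinite_kirillovRep d)),
    isInducedBy_transport _ _ (indRep_discFun d) fun X P => tendsto_indRep_discFun d P X,
    isInducedBy_transport _ _ (kirillovRep_discVec d) fun X P => tendsto_kirillovRep_discVec d P X,
    GKModule.transport_iso _ _ _, (irreducible_discModule d).transport _,
    (irreducible_discModule d).transport _⟩

end Kirillov

end

theorem mainTheorem7 (d : ℕ) (hd : 0 < d) :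
    (∀ ε : ℤˣ, ∃! R : Representation ℂ SL(2, ℝ) KirillovSpace, IsKirillovRep d ε R) ∧
    (∀ (ε : ℤˣ) (R : Representation ℂ SL(2, ℝ) KirillovSpace), IsKirillovRep d ε R →
      (∀ f ∈ kFinite R, ∃ p : ℂ[X], f =ᵐ[mulMeasure] polyExp d p) ∧
      (∀ p : ℂ[X], ∃ f ∈ kFinite R, f =ᵐ[mulMeasure] polyExp d p)) ∧
    (∀ R : Representation ℂ SL(2, ℝ) KirillovSpace, IsKirillovRep d 1 R →
      ∃ (A : GKModule ↥(kFinite (indRep d) ⊓ indPlus d)) (B : GKModule ↥(kFinite R)),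
        A.IsInducedBy (indRep d) ∧ B.IsInducedBy R ∧
        A.Iso B ∧ A.Irreducible ∧ B.Irreducible) := by
  refine ⟨fun ε => ?_, fun ε R hR => ?_, fun R hR => ?_⟩
  · obtain ⟨R, hR, -⟩ := exists_isKirillovRep hd ε
    exact ⟨R, hR, fun S hS => hS.unique hR⟩
  · have hfin : kFinite R = kFinite (kirillovRep d) := by
      obtain ⟨S, hS, h⟩ := exists_isKirillovRep hd ε
      rw [hR.unique hS]
      rcases h with rfl | rfl
      · rfl
      · exact kFinite_comp_flip _
    rw [hfin]
    refine ⟨fun f hf => (mem_kFinite_kirillovRep_iff f).1 hf, fun p => ?_⟩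
    exact ⟨_, (mem_kFinite_kirillovRep_iff _).2 ⟨p, polyVec_ae_polyExp d p⟩, polyVec_ae_polyExp d p⟩
  · obtain rfl := hR.unique (isKirillovRep_kirillovRep hd)
    exact exists_modules hd
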